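/- Let $n\ge 1$, $0<\alpha<2$, $\sigma>0$, $\rho:=1-\alpha/2$, $0<\theta\le\rho$, and $\langle x\rangle:=(1+|x|^2)^{1/2}$ for $x\in\mathbb R^n$. Let $V\in C^\infty(\mathbb R^n;\mathbb R)$ be such that for every $k\ge 0$ there is a constant $C_{V,k}>0$ with $|\partial^\beta V(x)|\le C_{V,k}\langle x\rangle^{-\theta-k}$ for all multi-indices $\beta$ with $|\beta|=k$ and all sufficiently large $|x|$, and such that, for some constants $0<c_0<C_0$, either $c_0\langle x\rangle^{-\theta}\le V(x)\le C_0\langle x\rangle^{-\theta}$ for all sufficiently large $|x|$, or $c_0\langle x\rangle^{-\theta}\le -V(x)\le C_0\langle x\rangle^{-\theta}$ for all sufficiently large $|x|$. Let $H=p^2-\sigma|x|^\alpha+V$, $p=-i\nabla$, be the self-adjoint operator on $L^2(\mathbb R^n)$ obtained as the closure of $-\Delta-\sigma|x|^\alpha+V$ on $C_0^\infty(\mathbb R^n)$. Let $R>0$ and let $\varphi\in C_0^\infty(\mathbb R)$ satisfy $0\le\varphi\le 1$ and $\varphi(s)=0$ for $|s|\ge R$. For $r>0$ put $$a_{0,r}=n(n+1)(\alpha^2+3\alpha)+n(r+C_{V,0}+\sigma),\qquad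 A_{0,r}=\tfrac12\Big(\alpha\sqrt n(2n+1)+\sqrt{\alpha^2n(2n+1)^2+4a_{0,r}}\Big),$$ and let $A_{1,R}=4n\rho A_{0,2R}$. Let $F\in C^\infty(\mathbb R)$ satisfy $0\le F\le 1$, $F(s)=0$ for $s\le A_{1,R}$ and $F(s)=1$ for $s\ge 2A_{1,R}$. Then there is a constant $C>0$ such that for all $\psi\in L^2(\mathbb R^n)$ $$\int_1^\infty\Big\|F\Big(\frac{|x|^\rho}{t}\Big)e^{-itH}\varphi(H)\langle x\rangle^{-\rho}\psi\Big\|^2\,\frac{dt}{t}\le C\|\psi\|^2,$$ where $\|\cdot\|$ is the norm of $L^2(\mathbb R^n)$. -/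

import Mathlib

open MeasureTheory Filter Topology
open scoped ContDiff Laplacian

noncomputable section

namespace Repulsive

/-- The configuration space `ℝⁿ` with its Euclidean norm. -/
abbrev Conf (n : ℕ) : Type := EuclideanSpace ℝ (Fin n)

/-- The Hilbert space `L²(ℝⁿ)` of complex-valued functions. -/
abbrev L2 (n : ℕ) : Type := Lp ℂ 2 (volume : Measure (Conf n))

/-- `⟨x⟩ = (1 + |x|²)^{1/2}`. -/
def jap {n : ℕ} (x : Conf n) : ℝ := Real.sqrt (1 + ‖x‖ ^ 2)

/-! ### Multiplication operators -/

/-- Multiplication by the real function `m`: it maps `u` to `m u` whenever `m u ∈ L²`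
(in particular always when `m` is measurable and bounded), and to `0` otherwise. -/
def mulOp {n : ℕ} (m : Conf n → ℝ) (u : L2 n) : L2 n := by
  classical
  exact if h : MemLp (fun x => (m x : ℂ) * u x) 2 (volume : Measure (Conf n)) then h.toLp _ else 0

theorem mulOp_coeFn {n : ℕ} {m : Conf n → ℝ} (hm : Measurable m) {B : ℝ}
    (hB : ∀ x, |m x| ≤ B) (u : L2 n) :
    (mulOp m u : Conf n → ℂ) =ᵐ[volume] fun x => (m x : ℂ) * u x := by
  have h : MemLp (fun x => (m x : ℂ) * u x) 2 (volume : Measure (Conf n)) := by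
    refine (Lp.memLp u).of_le_mul (c := B) ?_ (ae_of_all _ fun x => ?_)
    · exact (Complex.measurable_ofReal.comp hm).aestronglyMeasurable.mul
        (Lp.aestronglyMeasurable u)
    · rw [norm_mul, Complex.norm_real, Real.norm_eq_abs]
      exact mul_le_mul_of_nonneg_right (hB x) (norm_nonneg _)
  unfold mulOp
  rw [dif_pos h]
  exact h.coeFn_toLp

/-! ### Schrödinger operators -/

/-- Test functions `C_c^∞(ℝⁿ; ℂ)`. -/
def IsTest {n : ℕ} (f : Conf n → ℂ) : Prop := ContDiff ℝ ∞ f ∧ HasCompactSupport f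

/-- The differential expression `-Δ f + W f`. -/
def schrodingerExpr {n : ℕ} (W : Conf n → ℝ) (f : Conf n → ℂ) (x : Conf n) : ℂ :=
  -(Δ f x) + (W x : ℂ) * f x

theorem schrodingerExpr_zero {n : ℕ} (W : Conf n → ℝ) (x : Conf n) :
    schrodingerExpr W 0 x = 0 := by
  have h0 : Δ (0 : Conf n → ℂ) x = 0 := by
    have := InnerProductSpace.laplacian_smul (v := (0 : ℝ)) (f := (0 : Conf n → ℂ)) (x := x)
      contDiffAt_const
    simpa using this
  simp [schrodingerExpr, h0]

/-- The graph of `-Δ + W` on `C_c^∞(ℝⁿ)`, as a subspace of `L² × L²`. -/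
def coreGraph {n : ℕ} (W : Conf n → ℝ) : Submodule ℂ (L2 n × L2 n) where
  carrier := {q | ∃ f : Conf n → ℂ, IsTest f ∧ q.1 =ᵐ[volume] f ∧
    q.2 =ᵐ[volume] schrodingerExpr W f}
  zero_mem' := by
    refine ⟨0, ⟨contDiff_const, HasCompactSupport.zero⟩, Lp.coeFn_zero _ _ _, ?_⟩
    refine (Lp.coeFn_zero _ _ _).trans (ae_of_all _ fun x => ?_)
    simp [schrodingerExpr_zero]
  add_mem' := by
    rintro ⟨u, u'⟩ ⟨v, v'⟩ ⟨f, hf, hu, hu'⟩ ⟨g, hg, hv, hv'⟩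
    refine ⟨f + g, ⟨hf.1.add hg.1, hf.2.add hg.2⟩, ?_, ?_⟩
    · exact (Lp.coeFn_add u v).trans (hu.add hv)
    · refine (Lp.coeFn_add u' v').trans ((hu'.add hv').trans (ae_of_all _ fun x => ?_))
      have h2 : (2 : WithTop ℕ∞) ≤ ∞ := WithTop.coe_le_coe.2 le_top
      have := (hf.1.contDiffAt.of_le h2 : ContDiffAt ℝ 2 f x).laplacian_add
        (hg.1.contDiffAt.of_le h2)
      simp only [schrodingerExpr, Pi.add_apply, this]
      ring
  smul_mem' := by
    rintro c ⟨u, u'⟩ ⟨f, hf, hu, hu'⟩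
    refine ⟨c • f, ⟨hf.1.const_smul c, hf.2.smul_left⟩, ?_, ?_⟩
    · exact (Lp.coeFn_smul c u).trans (hu.const_smul c)
    · refine (Lp.coeFn_smul c u').trans ((hu'.const_smul c).trans (ae_of_all _ fun x => ?_))
      have h2 : (2 : WithTop ℕ∞) ≤ ∞ := WithTop.coe_le_coe.2 le_top
      have : Δ (c • f) x = c • Δ f x :=
        InnerProductSpace.laplacian_smul c (hf.1.contDiffAt.of_le h2 : ContDiffAt ℝ 2 f x)
      simp only [schrodingerExpr, Pi.smul_apply, this, smul_eq_mul]
      ring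

/-- `-Δ + W` as an operator with domain `C_c^∞(ℝⁿ)`. -/
def coreOp {n : ℕ} (W : Conf n → ℝ) : L2 n →ₗ.[ℂ] L2 n := (coreGraph W).toLinearPMap

theorem coreOp_graph {n : ℕ} (W : Conf n → ℝ) : (coreOp W).graph = coreGraph W := by
  refine Submodule.toLinearPMap_graph_eq _ ?_
  rintro ⟨u, u'⟩ ⟨f, hf, hu, hu'⟩ h0
  have hf0 : f = 0 := by
    refine (hf.1.continuous.ae_eq_iff_eq volume continuous_const).1 ?_
    simp only at h0 hu
    rw [h0] at hu
    exact hu.symm.trans (Lp.coeFn_zero _ _ _)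
  subst hf0
  refine Lp.ext (hu'.trans (EventuallyEq.trans ?_ (Lp.coeFn_zero _ _ _).symm))
  exact ae_of_all _ fun x => schrodingerExpr_zero W x

/-- The Schrödinger operator `-Δ + W` on `L²(ℝⁿ)`: the closure of its restriction to
`C_c^∞(ℝⁿ)`. For continuous real `W` with `W(x) ≥ -c(1 + |x|²)` this closure is self-adjoint, so it
is the only self-adjoint realization of `-Δ + W` whose domain contains `C_c^∞(ℝⁿ)`. -/
def schrodingerOp {n : ℕ} (W : Conf n → ℝ) : L2 n →ₗ.[ℂ] L2 n := (coreOp W).closure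

/-- `H = p² - σ|x|^α + V`. -/
def hamiltonian {n : ℕ} (α σ : ℝ) (V : Conf n → ℝ) : L2 n →ₗ.[ℂ] L2 n :=
  schrodingerOp fun x => -σ * ‖x‖ ^ α + V x

/-! ### Functional calculus of a self-adjoint operator -/

section FunctionalCalculus

variable {E : Type*} [NormedAddCommGroup E] [InnerProductSpace ℂ E] [CompleteSpace E]

/-- `R` is the bounded inverse of `H + i`. -/
def IsResolvent (H : E →ₗ.[ℂ] E) (R : E →L[ℂ] E) : Prop :=
  (∀ u : H.domain, R (H u + Complex.I • (u : E)) = u) ∧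
    ∀ w : E, ∃ h : R w ∈ H.domain, H ⟨R w, h⟩ + Complex.I • R w = w

/-- The resolvent `(H + i)⁻¹`, which exists for every self-adjoint `H`. -/
def resolventI (H : E →ₗ.[ℂ] E) : E →L[ℂ] E := by
  classical exact if h : ∃ R, IsResolvent H R then h.choose else 0

/-- `T = f(H)`. The resolvent `R = (H + i)⁻¹` is a bounded normal operator with dense range whose
spectrum lies in `{(l + i)⁻¹ : l real} ∪ {0}`, and for bounded continuous `f : ℝ → ℂ` the function
`w ↦ w f(Re w⁻¹)`, whose value at `w = (l + i)⁻¹` is `(l + i)⁻¹ f(l)`, is continuous there. Hence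
`f(H) (H + i)⁻¹` is given by the continuous functional calculus of `R`, and this
determines `f(H)`. -/
def IsFunctionOf (H : E →ₗ.[ℂ] E) (f : ℝ → ℂ) (T : E →L[ℂ] E) : Prop :=
  T ∘L resolventI H = cfc (fun w : ℂ => w * f (w⁻¹).re) (resolventI H)

/-- The bounded operator `f(H)`, for `H` self-adjoint and `f` bounded and continuous (existence and
uniqueness are proved in `existsUnique_isFunctionOf`); `0` where it is not defined. -/
def functionOf (H : E →ₗ.[ℂ] E) (f : ℝ → ℂ) : E →L[ℂ] E := by
  classical exact if h : IsSelfAdjoint H ∧ ∃ T, IsFunctionOf H f T then h.2.choose else 0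

theorem selfAdjoint_inner {H : E →ₗ.[ℂ] E} (hH : IsSelfAdjoint H) (u v : H.domain) :
    inner ℂ (H u) (v : E) = inner ℂ (u : E) (H v) := by
  have h := LinearPMap.adjoint_isFormalAdjoint hH.dense_domain
  have hH' : H.adjoint = H := hH
  rw [hH'] at h
  exact h u v

theorem selfAdjoint_norm {H : E →ₗ.[ℂ] E} (hH : IsSelfAdjoint H) {z : ℂ} (hz : z.re = 0)
    (hz1 : ‖z‖ = 1) (u : H.domain) : ‖(u : E)‖ ≤ ‖H u + z • (u : E)‖ := by
  have him : (inner ℂ (H u) (u : E)).im = 0 := by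
    have h1 := selfAdjoint_inner hH u u
    have h2 : (starRingEnd ℂ) (inner ℂ (H u) (u : E)) = inner ℂ (H u) (u : E) := by
      rw [inner_conj_symm, h1]
    exact Complex.conj_eq_iff_im.1 h2
  have h := norm_add_sq (𝕜 := ℂ) (H u) (z • (u : E))
  rw [inner_smul_right, norm_smul, hz1, one_mul] at h
  have h0 : RCLike.re (z * inner ℂ (H u) (u : E)) = 0 := by
    change (z * inner ℂ (H u) (u : E)).re = 0
    rw [Complex.mul_re, hz, him]; ring
  rw [h0] at h
  refine le_of_sq_le_sq ?_ (norm_nonneg _)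
  nlinarith [sq_nonneg ‖H u‖]

theorem exists_inverse {H : E →ₗ.[ℂ] E} (hH : IsSelfAdjoint H) {z : ℂ} (hz : z.re = 0)
    (hz1 : ‖z‖ = 1) : ∃ R : E →L[ℂ] E, (∀ u : H.domain, R (H u + z • (u : E)) = u) ∧
      ∀ w : E, ∃ h : R w ∈ H.domain, H ⟨R w, h⟩ + z • R w = w := by
  let K : H.domain →ₗ[ℂ] E := H.toFun + z • H.domain.subtype
  have hK : ∀ u, K u = H u + z • (u : E) := fun u => rfl
  have hbd : ∀ u : H.domain, ‖(u : E)‖ ≤ ‖K u‖ := fun u => selfAdjoint_norm hH hz hz1 u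
  have hinj : Function.Injective K := by
    refine (injective_iff_map_eq_zero K).2 fun u hu => ?_
    have := hbd u
    rw [hu, norm_zero] at this
    exact Subtype.ext (norm_le_zero_iff.1 this)
  have hclosed : IsClosed (LinearMap.range K : Set E) := by
    refine IsSeqClosed.isClosed fun w w₀ hw hlim => ?_
    choose u hu using hw
    have hc : CauchySeq fun k => (u k : E) := by
      have hc' := hlim.cauchySeq
      rw [Metric.cauchySeq_iff] at hc' ⊢
      intro ε hε
      obtain ⟨N, hN⟩ := hc' ε hε
      refine ⟨N, fun m hm k hk => lt_of_le_of_lt ?_ (hN m hm k hk)⟩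
      rw [dist_eq_norm, dist_eq_norm, ← hu m, ← hu k, ← map_sub]
      exact hbd (u m - u k)
    obtain ⟨u₀, hu₀⟩ := cauchySeq_tendsto_of_complete hc
    have hmem : (u₀, w₀ - z • u₀) ∈ H.graph := by
      have hcl : IsClosed (H.graph : Set (E × E)) := hH.isClosed
      refine hcl.mem_of_tendsto (f := fun k => ((u k : E), w k - z • (u k : E)))
        (b := atTop) (hu₀.prodMk_nhds (hlim.sub (hu₀.const_smul z))) (Eventually.of_forall fun k => ?_)
      have : w k - z • (u k : E) = H (u k) := by rw [← hu k, hK]; abel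
      simp only [this]
      exact LinearPMap.mem_graph H (u k)
    obtain ⟨y, hy1, hy2⟩ := (LinearPMap.mem_graph_iff H).1 hmem
    refine ⟨y, ?_⟩
    rw [hK, hy2]
    simp only at hy1
    rw [hy1]; exact sub_add_cancel _ _
  have hdense : (LinearMap.range K)ᗮ = ⊥ := by
    rw [Submodule.eq_bot_iff]
    intro w hw
    rw [Submodule.mem_orthogonal] at hw
    have hw' : ∀ u : H.domain, inner ℂ w (H u) = inner ℂ (-((starRingEnd ℂ) z) • w) (u : E) := by
      intro u
      have h1 := hw (K u) ⟨u, rfl⟩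
      have h2 : inner ℂ w (K u) = 0 := by rw [← inner_conj_symm, h1, map_zero]
      rw [hK, inner_add_right, inner_smul_right] at h2
      rw [inner_smul_left, map_neg, Complex.conj_conj]
      linear_combination h2
    have hdom : w ∈ H.adjoint.domain := by
      refine LinearPMap.mem_adjoint_domain_of_exists w ⟨_, fun u => (hw' u).symm⟩
    have happ := LinearPMap.adjoint_apply_eq hH.dense_domain ⟨w, hdom⟩ (x₀ := -((starRingEnd ℂ) z) • w)
      (fun u => (hw' u).symm)
    have hH' : H.adjoint = H := hH
    have key : ∀ (A : E →ₗ.[ℂ] E) (_ : A = H) (h : w ∈ A.domain),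
        A ⟨w, h⟩ = -((starRingEnd ℂ) z) • w → w = 0 := by
      rintro A rfl h hA
      have := selfAdjoint_norm hH (z := (starRingEnd ℂ) z) (by simpa using hz) (by simpa using hz1) ⟨w, h⟩
      rw [hA] at this
      simpa using this
    exact key _ hH' hdom happ
  have hsurj : Function.Surjective K := by
    rw [← LinearMap.range_eq_top]
    have := hclosed.submodule_topologicalClosure_eq
    rw [← this, Submodule.topologicalClosure_eq_top_iff]
    exact hdense
  let e := LinearEquiv.ofBijective K ⟨hinj, hsurj⟩
  have he : ∀ w, K (e.symm w) = w := fun w => e.apply_symm_apply w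
  refine ⟨LinearMap.mkContinuous (H.domain.subtype ∘ₗ e.symm.toLinearMap) 1 fun w => ?_, fun u => ?_,
    fun w => ⟨(e.symm w).2, ?_⟩⟩
  · rw [one_mul]
    have := hbd (e.symm w)
    rwa [he] at this
  · change ((e.symm (e u) : H.domain) : E) = u
    rw [e.symm_apply_apply]
  · exact he w

theorem resolventI_spec {H : E →ₗ.[ℂ] E} (hH : IsSelfAdjoint H) :
    IsResolvent H (resolventI H) := by
  have h : ∃ R, IsResolvent H R := exists_inverse hH (by simp) (by simp)
  unfold resolventI
  rw [dif_pos h]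
  exact h.choose_spec

theorem resolventI_normal {H : E →ₗ.[ℂ] E} (hH : IsSelfAdjoint H) :
    IsStarNormal (resolventI H) := by
  obtain ⟨h1, h2⟩ := resolventI_spec hH
  obtain ⟨R', h1', h2'⟩ := exists_inverse hH (z := -Complex.I) (by simp) (by simp)
  set R := resolventI H with hR
  have hadj : star R = R' := by
    rw [ContinuousLinearMap.star_eq_adjoint]
    refine ((ContinuousLinearMap.eq_adjoint_iff _ _).2 fun x y => ?_).symm
    obtain ⟨hx, hx'⟩ := h2' x
    obtain ⟨hy, hy'⟩ := h2 y
    have hs := selfAdjoint_inner hH ⟨R' x, hx⟩ ⟨R y, hy⟩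
    simp only at hs
    conv_rhs => rw [← hx']
    conv_lhs => rw [← hy']
    rw [inner_add_left, inner_add_right, hs, inner_smul_left, inner_smul_right]
    simp
  refine ⟨?_⟩
  rw [hadj]
  ext w
  change R' (R w) = R (R' w)
  obtain ⟨ha, ha'⟩ := h2 w
  obtain ⟨hb, hb'⟩ := h2' w
  have e1 := h1 (⟨R w, ha⟩ - ⟨R' w, hb⟩)
  have e2 := h1' (⟨R w, ha⟩ - ⟨R' w, hb⟩)
  have f1 : H (⟨R w, ha⟩ - ⟨R' w, hb⟩) = (w - Complex.I • R w) - (w + Complex.I • R' w) := by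
    rw [LinearPMap.map_sub]
    congr 1
    · exact eq_sub_of_add_eq ha'
    · rw [neg_smul] at hb'
      exact (eq_add_of_add_neg_eq hb')
  rw [f1] at e1 e2
  have g1 : (w - Complex.I • R w) - (w + Complex.I • R' w) + Complex.I • (R w - R' w)
      = (-2 * Complex.I) • R' w := by module
  have g2 : (w - Complex.I • R w) - (w + Complex.I • R' w) + (-Complex.I) • (R w - R' w)
      = (-2 * Complex.I) • R w := by module
  simp only [AddSubgroupClass.coe_sub] at e1 e2
  rw [g1, map_smul] at e1
  rw [g2, map_smul] at e2
  refine smul_right_injective E (r := (-2 * Complex.I)) (by simp) ?_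
  change (-2 * Complex.I) • R' (R w) = (-2 * Complex.I) • R (R' w)
  rw [e1, e2]

theorem continuous_symbol {f : ℝ → ℂ} (hf : Continuous f) {M : ℝ} (hM : ∀ l, ‖f l‖ ≤ M) :
    Continuous fun w : ℂ => w * f (w⁻¹).re := by
  refine continuous_iff_continuousAt.2 fun w => ?_
  by_cases hw : w = 0
  · subst hw
    have : Tendsto (fun w : ℂ => w * f (w⁻¹).re) (𝓝 0) (𝓝 0) := by
      refine squeeze_zero_norm (a := fun w : ℂ => ‖w‖ * M) (fun w => ?_) ?_
      · rw [norm_mul]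
        exact mul_le_mul_of_nonneg_left (hM _) (norm_nonneg _)
      · have := (continuous_norm (E := ℂ)).tendsto 0 |>.mul_const M
        simpa using this
    simpa [ContinuousAt] using this
  · have h1 : ContinuousAt (fun w : ℂ => (w⁻¹).re) w :=
      Complex.continuous_re.continuousAt.comp (continuousAt_inv₀ hw)
    exact continuousAt_id.mul (hf.continuousAt.comp h1)

open scoped ComplexOrder in
theorem norm_cfc_symbol_le {R : E →L[ℂ] E} (hR : IsStarNormal R) {f : ℝ → ℂ}
    (hf : Continuous f) {M : ℝ} (hM : ∀ l, ‖f l‖ ≤ M) (u : E) :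
    ‖cfc (fun w : ℂ => w * f (w⁻¹).re) R u‖ ≤ M * ‖R u‖ := by
  set g : ℂ → ℂ := fun w => w * f (w⁻¹).re with hg
  have hgc : Continuous g := continuous_symbol hf hM
  have hM0 : 0 ≤ M := (norm_nonneg _).trans (hM 0)
  have key : star (cfc g R) * cfc g R ≤ ((M : ℂ) ^ 2) • (star R * R) := by
    have e1 : star (cfc g R) * cfc g R = cfc (fun w => star (g w) * g w) R := by
      rw [← cfc_star, ← cfc_mul _ _ R (by fun_prop) (by fun_prop)]
    have e2 : ((M : ℂ) ^ 2) • (star R * R) = cfc (fun w : ℂ => ((M : ℂ) ^ 2) * (star w * w)) R := by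
      rw [cfc_const_mul _ _ R (by fun_prop), cfc_mul _ _ R (by fun_prop) (by fun_prop),
        cfc_star, cfc_id' ℂ R]
    rw [e1, e2]
    refine cfc_mono (fun w _ => ?_) (by fun_prop) (by fun_prop)
    have h1 : ∀ a : ℂ, star a * a = ((‖a‖ ^ 2 : ℝ) : ℂ) := fun a => by
      rw [Complex.star_def, Complex.conj_mul', Complex.ofReal_pow]
    rw [h1, h1, ← Complex.ofReal_pow, ← Complex.ofReal_mul, Complex.real_le_real, hg, norm_mul,
      mul_pow, mul_comm]
    gcongr
    exact hM _
  have h := (ContinuousLinearMap.le_def _ _).1 key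
  have h' := h.re_inner_nonneg_left u
  refine le_of_sq_le_sq ?_ (mul_nonneg hM0 (norm_nonneg _))
  have i1 : ∀ A : E →L[ℂ] E, inner ℂ ((star A * A) u) u = ((‖A u‖ ^ 2 : ℝ) : ℂ) := fun A => by
    rw [ContinuousLinearMap.star_eq_adjoint]
    change inner ℂ (ContinuousLinearMap.adjoint A (A u)) u = _
    rw [ContinuousLinearMap.adjoint_inner_left, inner_self_eq_norm_sq_to_K]
    simp
  rw [_root_.sub_apply, inner_sub_left, _root_.smul_apply,
    inner_smul_left, i1, i1] at h'
  have : (starRingEnd ℂ) ((M : ℂ) ^ 2) * ((‖R u‖ ^ 2 : ℝ) : ℂ) - ((‖cfc g R u‖ ^ 2 : ℝ) : ℂ)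
      = ((M ^ 2 * ‖R u‖ ^ 2 - ‖cfc g R u‖ ^ 2 : ℝ) : ℂ) := by
    simp
  rw [this] at h'
  have h'' : 0 ≤ M ^ 2 * ‖R u‖ ^ 2 - ‖cfc g R u‖ ^ 2 := h'
  rw [mul_pow]
  linarith

/-- For self-adjoint `H` and bounded continuous `f`, the operator `f(H)` exists and is unique. -/
theorem existsUnique_isFunctionOf {H : E →ₗ.[ℂ] E} (hH : IsSelfAdjoint H) {f : ℝ → ℂ}
    (hf : Continuous f) {M : ℝ} (hM : ∀ l, ‖f l‖ ≤ M) : ∃! T, IsFunctionOf H f T := by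
  obtain ⟨h1, h2⟩ := resolventI_spec hH
  have hn := resolventI_normal hH
  have hb := norm_cfc_symbol_le hn hf hM
  unfold IsFunctionOf
  set R := resolventI H with hR
  set G := cfc (fun w : ℂ => w * f (w⁻¹).re) R with hG
  have hM0 : 0 ≤ M := (norm_nonneg _).trans (hM 0)
  have hrange : DenseRange R := by
    refine hH.dense_domain.mono ?_
    intro u hu
    exact ⟨_, h1 ⟨u, hu⟩⟩
  have hex : ∃ T : E →L[ℂ] E, ∀ w, T (R w) = G w := by
    let T := LinearMap.extendOfNorm (G : E →ₗ[ℂ] E) (R : E →ₗ[ℂ] E)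
    exact ⟨T, fun w => LinearMap.extendOfNorm_eq hrange ⟨M, hb⟩ w⟩
  obtain ⟨T, hT⟩ := hex
  refine ⟨T, ContinuousLinearMap.ext hT, fun T' hT' => ?_⟩
  refine DFunLike.coe_injective (hrange.equalizer T'.continuous T.continuous ?_)
  funext w
  exact (DFunLike.congr_fun hT' w).trans (hT w).symm

theorem functionOf_spec {H : E →ₗ.[ℂ] E} (hH : IsSelfAdjoint H) {f : ℝ → ℂ}
    (hf : Continuous f) {M : ℝ} (hM : ∀ l, ‖f l‖ ≤ M) : IsFunctionOf H f (functionOf H f) := by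
  have h : IsSelfAdjoint H ∧ ∃ T, IsFunctionOf H f T :=
    ⟨hH, (existsUnique_isFunctionOf hH hf hM).exists⟩
  unfold functionOf
  rw [dif_pos h]
  exact h.2.choose_spec

/-- The propagator `e^{-itH}`. -/
def propagator (H : E →ₗ.[ℂ] E) (t : ℝ) : E →L[ℂ] E :=
  functionOf H fun l => Complex.exp (-(Complex.I * t * l))

end FunctionalCalculus

/-! ### Assumption on the potential and constants -/

/-- Smooth real potentials `V` of exact decay order `θ`, with constants `CV k` in the symbol
estimates for the derivatives of order `k`. All estimates are required for large `|x|` only. -/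
structure IsAdmissiblePotential {n : ℕ} (θ : ℝ) (CV : ℕ → ℝ) (V : Conf n → ℝ) : Prop where
  smooth : ContDiff ℝ ∞ V
  const_pos : ∀ k, 0 < CV k
  decay : ∀ k : ℕ, ∃ r : ℝ, ∀ x : Conf n, r ≤ ‖x‖ →
    ‖iteratedFDeriv ℝ k V x‖ ≤ CV k * jap x ^ (-θ - k)
  sign : ∃ c₀ C₀ : ℝ, 0 < c₀ ∧ c₀ < C₀ ∧
    ((∃ r : ℝ, ∀ x : Conf n, r ≤ ‖x‖ →
        c₀ * jap x ^ (-θ) ≤ V x ∧ V x ≤ C₀ * jap x ^ (-θ)) ∨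
      ∃ r : ℝ, ∀ x : Conf n, r ≤ ‖x‖ →
        c₀ * jap x ^ (-θ) ≤ -V x ∧ -V x ≤ C₀ * jap x ^ (-θ))

/-- `a_{0,R} = n(n+1)(α² + 3α) + n(R + C_{V,0} + σ)`. -/
def smallA0 (n : ℕ) (α σ CV0 R : ℝ) : ℝ :=
  n * (n + 1) * (α ^ 2 + 3 * α) + n * (R + CV0 + σ)

/-- `A_{0,R} = (α √n (2n+1) + √(α² n (2n+1)² + 4 a_{0,R})) / 2`. -/
def bigA0 (n : ℕ) (α σ CV0 R : ℝ) : ℝ :=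
  (α * Real.sqrt n * (2 * n + 1) +
    Real.sqrt (α ^ 2 * n * (2 * n + 1) ^ 2 + 4 * smallA0 n α σ CV0 R)) / 2

/-- `A_{1,R} = 4 n ρ A_{0,2R}` with `ρ = 1 - α/2`. -/
def bigA1 (n : ℕ) (α σ CV0 R : ℝ) : ℝ :=
  4 * n * (1 - α / 2) * bigA0 n α σ CV0 (2 * R)

end Repulsive

end

open Repulsive

/-! ### Differentiation from quadratic bounds -/

/-! Classically a particle of bounded energy has momentum of size about `√σ |x|^{α/2}` far out, so
`|x|^ρ` with `ρ = 1 - α/2` grows at speed at most about `2ρ√σ`. The constant `A_{1,R}` is at least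
`4ρ√σ`, twice that speed, so hardly any mass reaches `|x|^ρ ≥ A_{1,R} t` at time `t`. The proof
gives the pointwise decay `‖F(|x|^ρ/t) e^{-itH} φ(H) ⟨x⟩^{-ρ} ψ‖² ≤ K t^{-ε} ‖ψ‖²` with `ε = min(1,
α/ρ)`, which is integrable against `dt/t`.

The observable is a smooth step `G = g((⟨x⟩^ρ - c)/d)` of width `d = δT`. Its commutator with `-Δ +
W` is of first order and carries `∇G`. Cauchy-Schwarz with weights `k`, `l` such that `|∇G|² ≤ k l`
leaves `l |∇u|²`, and integration by parts trades this for `Re⟨Hu, l u⟩` and the potential term `-l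
W |u|²` (`form_integral_nonneg`, `abs_two_mul_im_inner_le`). With `k = (ρ/d) h`, `l = k ⟨x⟩^{-α}`
and parameter `√σ`, the commutator is at most `2ρ√σ/d` times the mass in the transition region, up
to `O(T^{-1-α/ρ})` (`exists_commutator_bound`). A step moving outwards at speed `b = 2ρ√σ` cancels
the main term, so its mass grows by at most `O(T^{-α/ρ})` during a time `T`
(`weight_evol_moving_le`).

The initial mass beyond `⟨x⟩^ρ ~ T` is `O(T^{-2})` because of the weight `⟨x⟩^{-ρ}`. The cutoff
`φ(H)` is a Fourier superposition of `e^{-isH} (H+i)^{-2}` with rapidly decreasing density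
(`propagator_functionOf_eq_integral`); each resolvent, and each unit of time shift, moves only mass
`O(1/T)` across a fixed step (`weight_resolventI_le`, `weight_evol_static_le`).

All of this needs `H` to be self-adjoint. That is deduced from the absence of square integrable weak
solutions of `(-Δ + W ± i) v = 0` for `W ≥ -c⟨x⟩²`, where the same form inequality is applied to
mollifications of `v` (`ae_eq_zero_of_weak`). -/

theorem hasDerivAt_of_norm_sub_le_sq {E : Type*} [NormedAddCommGroup E] [NormedSpace ℝ E]
    {f : ℝ → E} {f' : E} {x C : ℝ} (h : ∀ τ, ‖f (x + τ) - f x - τ • f'‖ ≤ C * τ ^ 2) :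
    HasDerivAt f f' x := by
  rw [hasDerivAt_iff_isLittleO_nhds_zero]
  refine (Asymptotics.IsBigO.of_bound C (g := fun τ : ℝ => τ ^ 2)
    (Eventually.of_forall fun τ => ?_)).trans_isLittleO ?_
  · simpa using h τ
  · simpa using Asymptotics.isLittleO_pow_id (𝕜 := ℝ) (one_lt_two)

theorem norm_exp_I_sub_one_sub_le (y : ℝ) :
    ‖Complex.exp (Complex.I * y) - 1 - Complex.I * y‖ ≤ 2 * y ^ 2 := by
  have hn : ‖Complex.I * (y : ℂ)‖ = |y| := by simp
  rcases le_total |y| 1 with hy | hy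
  · refine (Complex.norm_exp_sub_one_sub_id_le (hn.le.trans hy)).trans ?_
    rw [hn, sq_abs]
    nlinarith [sq_nonneg y]
  · refine (norm_sub_le _ _).trans ?_
    have h1 := Real.norm_exp_I_mul_ofReal_sub_one_le (x := y)
    rw [Real.norm_eq_abs] at h1
    rw [hn]
    nlinarith [sq_abs y]

namespace Repulsive

/-! ### Resolvent and propagator -/

section Evolution

variable {E : Type*} [NormedAddCommGroup E] [InnerProductSpace ℂ E] [CompleteSpace E]
  {H : E →ₗ.[ℂ] E}

theorem resolventI_mem (hH : IsSelfAdjoint H) (w : E) : resolventI H w ∈ H.domain :=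
  ((resolventI_spec hH).2 w).1

theorem apply_resolventI (hH : IsSelfAdjoint H) (w : E) (h : resolventI H w ∈ H.domain) :
    H ⟨resolventI H w, h⟩ = w - Complex.I • resolventI H w :=
  eq_sub_of_add_eq ((resolventI_spec hH).2 w).2

theorem norm_resolventI_le (hH : IsSelfAdjoint H) (w : E) : ‖resolventI H w‖ ≤ ‖w‖ := by
  obtain ⟨h, h'⟩ := (resolventI_spec hH).2 w
  have := selfAdjoint_norm hH (z := Complex.I) (by simp) (by simp) ⟨_, h⟩
  rwa [h'] at this

/-- This is the resolvent identity between the points `i` and `-i`, checked on the quadratic form so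
that no second resolvent is needed. Its only role is to locate the spectrum. -/
theorem star_resolventI_sub (hH : IsSelfAdjoint H) :
    star (resolventI H) - resolventI H
      = (2 * Complex.I) • (star (resolventI H) * resolventI H) := by
  refine ContinuousLinearMap.ext fun y => ext_inner_left ℂ fun x => ?_
  obtain ⟨hx, hx'⟩ := (resolventI_spec hH).2 x
  obtain ⟨hy, hy'⟩ := (resolventI_spec hH).2 y
  have hs := selfAdjoint_inner hH ⟨_, hx⟩ ⟨_, hy⟩
  simp only at hs
  set R := resolventI H
  have e1 : inner ℂ (R x) y = inner ℂ (R x) (H ⟨R y, hy⟩) + Complex.I * inner ℂ (R x) (R y) := by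
    conv_lhs => rw [← hy']
    rw [inner_add_right, inner_smul_right]
  have e2 : inner ℂ x (R y) = inner ℂ (H ⟨R x, hx⟩) (R y) - Complex.I * inner ℂ (R x) (R y) := by
    conv_lhs => rw [← hx']
    rw [inner_add_left, inner_smul_left]
    simp
    ring
  change inner ℂ x (star R y - R y) = inner ℂ x ((2 * Complex.I) • star R (R y))
  rw [inner_sub_right, inner_smul_right, ContinuousLinearMap.star_eq_adjoint,
    ContinuousLinearMap.adjoint_inner_right, ContinuousLinearMap.adjoint_inner_right, e1, e2, hs]
  ring

/-- The functional calculus turns `R* - R = 2i R*R` into `w̄ - w = 2i |w|²` on the spectrum. This is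
the circle of centre `-i/2` and radius `1/2`, the closure of the image of the real line under `l ↦
(l + i)⁻¹`. -/
theorem spectrum_resolventI (hH : IsSelfAdjoint H) {w : ℂ} (hw : w ∈ spectrum ℂ (resolventI H)) :
    w.re ^ 2 + w.im ^ 2 = -w.im := by
  have hn := resolventI_normal hH
  have h := star_resolventI_sub hH
  have e1 : star (resolventI H) - resolventI H = cfc (fun w : ℂ => star w - w) (resolventI H) := by
    rw [cfc_sub _ _ _ (by fun_prop) (by fun_prop), cfc_star, cfc_id' ℂ (resolventI H)]
  have e2 : (2 * Complex.I) • (star (resolventI H) * resolventI H)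
      = cfc (fun w : ℂ => (2 * Complex.I) * (star w * w)) (resolventI H) := by
    rw [cfc_const_mul _ _ _ (by fun_prop), cfc_mul _ _ _ (by fun_prop) (by fun_prop),
      cfc_star, cfc_id' ℂ (resolventI H)]
  rw [e1, e2] at h
  have h' := eqOn_of_cfc_eq_cfc h (by fun_prop) (by fun_prop) hn hw
  have h2 := congrArg Complex.im h'
  simp at h2
  linarith

theorem norm_le_one_of_mem_spectrum (hH : IsSelfAdjoint H) {w : ℂ}
    (hw : w ∈ spectrum ℂ (resolventI H)) : ‖w‖ ≤ 1 := by
  have h := spectrum_resolventI hH hw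
  rw [← sq_le_one_iff₀ (norm_nonneg _), ← Complex.normSq_eq_norm_sq, Complex.normSq_apply]
  nlinarith [sq_nonneg w.re, sq_nonneg (w.im + 1)]

theorem mul_inv_re_add_I (hH : IsSelfAdjoint H) {w : ℂ} (hw : w ∈ spectrum ℂ (resolventI H))
    (h0 : w ≠ 0) : w * (((w⁻¹).re : ℂ) + Complex.I) = 1 := by
  have h := spectrum_resolventI hH hw
  have him : w⁻¹.im = 1 := by
    have hN : Complex.normSq w = -w.im := by rw [Complex.normSq_apply, ← h]; ring
    have hN0 : Complex.normSq w ≠ 0 := by simpa using h0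
    rw [Complex.inv_im, ← hN, div_self hN0]
  have : ((w⁻¹).re : ℂ) + Complex.I = w⁻¹ := by
    apply Complex.ext <;> simp [← him]
  rw [this, mul_inv_cancel₀ h0]

theorem norm_mul_inv_re_le (w : ℂ) : ‖w‖ * |(w⁻¹).re| ≤ 1 := by
  by_cases h0 : w = 0
  · simp [h0]
  · calc ‖w‖ * |(w⁻¹).re| ≤ ‖w‖ * ‖w⁻¹‖ := by gcongr; exact Complex.abs_re_le_norm _
      _ = 1 := by rw [norm_inv, mul_inv_cancel₀ (norm_ne_zero_iff.2 h0)]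

theorem norm_exp_neg_I_mul (t l : ℝ) : ‖Complex.exp (-(Complex.I * t * l))‖ = 1 := by
  rw [Complex.norm_exp]
  simp

/-- Only `w = 0`, that is infinite energy, is delicate: there the exponential oscillates but has
modulus one, and the prefactor `w` kills it. -/
theorem continuous_exp_symbol :
    Continuous fun p : ℝ × ℂ => p.2 * Complex.exp (-(Complex.I * p.1 * ((p.2⁻¹).re : ℂ))) := by
  refine continuous_iff_continuousAt.2 fun p => ?_
  by_cases hp : p.2 = 0
  · have : Tendsto (fun q : ℝ × ℂ => q.2 * Complex.exp (-(Complex.I * q.1 * ((q.2⁻¹).re : ℂ))))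
        (𝓝 p) (𝓝 0) := by
      refine squeeze_zero_norm (a := fun q : ℝ × ℂ => ‖q.2‖) (fun q => ?_) ?_
      · rw [norm_mul, norm_exp_neg_I_mul, mul_one]
      · have h : Continuous fun q : ℝ × ℂ => ‖q.2‖ := by fun_prop
        simpa [hp] using h.tendsto p
    simpa [ContinuousAt, hp] using this
  · have h1 : ContinuousAt (fun q : ℝ × ℂ => (q.2⁻¹).re) p :=
      Complex.continuous_re.continuousAt.comp ((continuousAt_inv₀ hp).comp continuousAt_snd)
    have h2 : ContinuousAt (fun q : ℝ × ℂ => ((q.2⁻¹).re : ℂ)) p :=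
      Complex.continuous_ofReal.continuousAt.comp h1
    fun_prop

theorem continuous_exp_symbol' (t : ℝ) :
    Continuous fun w : ℂ => w * Complex.exp (-(Complex.I * t * ((w⁻¹).re : ℂ))) :=
  continuous_exp_symbol.comp (Continuous.prodMk_right t)

theorem propagator_comp_resolventI (hH : IsSelfAdjoint H) (t : ℝ) :
    propagator H t ∘L resolventI H
      = cfc (fun w : ℂ => w * Complex.exp (-(Complex.I * t * ((w⁻¹).re : ℂ)))) (resolventI H) :=
  functionOf_spec hH (M := 1) (f := fun l : ℝ => Complex.exp (-(Complex.I * t * l))) (by fun_prop)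
    fun l => (norm_exp_neg_I_mul t l).le

theorem propagator_resolventI (hH : IsSelfAdjoint H) (t : ℝ) (w : E) :
    propagator H t (resolventI H w)
      = cfc (fun w : ℂ => w * Complex.exp (-(Complex.I * t * ((w⁻¹).re : ℂ)))) (resolventI H) w :=
  DFunLike.congr_fun (propagator_comp_resolventI hH t) w

theorem norm_propagator_resolventI_le (hH : IsSelfAdjoint H) (t : ℝ) (w : E) :
    ‖propagator H t (resolventI H w)‖ ≤ ‖w‖ := by
  rw [propagator_resolventI hH]
  refine (norm_cfc_symbol_le (resolventI_normal hH) (M := 1)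
    (f := fun l : ℝ => Complex.exp (-(Complex.I * t * l))) (by fun_prop)
    (fun l => (norm_exp_neg_I_mul t l).le) w).trans ?_
  rw [one_mul]
  exact norm_resolventI_le hH w

theorem propagator_resolventI_comm (hH : IsSelfAdjoint H) (t : ℝ) (w : E) :
    propagator H t (resolventI H (resolventI H w))
      = resolventI H (propagator H t (resolventI H w)) := by
  have hn := resolventI_normal hH
  rw [propagator_resolventI hH, propagator_resolventI hH]
  have := cfc_commute_cfc (fun w : ℂ => w * Complex.exp (-(Complex.I * t * ((w⁻¹).re : ℂ))))
    (fun w : ℂ => w) (resolventI H)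
  rw [cfc_id' ℂ (resolventI H)] at this
  exact DFunLike.congr_fun this w

theorem propagator_resolventI_sq (hH : IsSelfAdjoint H) (t : ℝ) (w : E) :
    propagator H t (resolventI H (resolventI H w))
      = cfc (fun w : ℂ => w * (w * Complex.exp (-(Complex.I * t * ((w⁻¹).re : ℂ)))))
        (resolventI H) w := by
  have hn := resolventI_normal hH
  rw [propagator_resolventI_comm hH, propagator_resolventI hH,
    cfc_mul (fun w : ℂ => w) _ _ (by fun_prop) (continuous_exp_symbol' t).continuousOn,
    cfc_id' ℂ (resolventI H)]
  rfl

theorem propagator_zero_resolventI (hH : IsSelfAdjoint H) (w : E) :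
    propagator H 0 (resolventI H w) = resolventI H w := by
  have hn := resolventI_normal hH
  rw [propagator_resolventI hH]
  simp [cfc_id' ℂ (resolventI H)]

theorem propagator_resolventI_sq_mem (hH : IsSelfAdjoint H) (t : ℝ) (w : E) :
    propagator H t (resolventI H (resolventI H w)) ∈ H.domain := by
  rw [propagator_resolventI_comm hH]
  exact resolventI_mem hH _

theorem apply_propagator_resolventI_sq (hH : IsSelfAdjoint H) (t : ℝ) (w : E)
    (h : propagator H t (resolventI H (resolventI H w)) ∈ H.domain) :
    H ⟨propagator H t (resolventI H (resolventI H w)), h⟩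
      = propagator H t (resolventI H w)
        - Complex.I • propagator H t (resolventI H (resolventI H w)) := by
  have e := propagator_resolventI_comm hH t w
  have h' := resolventI_mem hH (propagator H t (resolventI H w))
  have : (⟨propagator H t (resolventI H (resolventI H w)), h⟩ : H.domain) = ⟨_, h'⟩ :=
    Subtype.ext e
  rw [this, apply_resolventI hH, e]

/-- Two resolvents are what a quadratic remainder requires: the second order Taylor remainder of
`e^{-iτl}` is at most `2τ²l²`, and the symbol `w²` with `w = (l + i)⁻¹` absorbs the `l²` uniformly
on the spectrum. -/
theorem hasDerivAt_propagator_resolventI_sq (hH : IsSelfAdjoint H) (t : ℝ) (w : E) :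
    HasDerivAt (fun t => propagator H t (resolventI H (resolventI H w)))
      (-Complex.I • H ⟨_, propagator_resolventI_sq_mem hH t w⟩) t := by
  have hn := resolventI_normal hH
  refine hasDerivAt_of_norm_sub_le_sq (C := 2 * ‖w‖) fun τ => ?_
  rw [apply_propagator_resolventI_sq hH, propagator_resolventI_sq hH, propagator_resolventI_sq hH,
    propagator_resolventI hH]
  set e : ℝ → ℂ → ℂ := fun t w => w * Complex.exp (-(Complex.I * t * ((w⁻¹).re : ℂ))) with he
  have hc : ∀ t, Continuous (e t) := continuous_exp_symbol'
  have hc' : ∀ t, Continuous fun w => w * e t w := fun t => continuous_id.mul (hc t)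
  have key : cfc (fun w => w * e (t + τ) w) (resolventI H) - cfc (fun w => w * e t w) (resolventI H)
      + (τ * Complex.I) • (cfc (e t) (resolventI H)
        - Complex.I • cfc (fun w => w * e t w) (resolventI H))
      = cfc (fun w => (w * e (t + τ) w - w * e t w)
        + (τ * Complex.I) * (e t w - Complex.I * (w * e t w))) (resolventI H) := by
    have c1 := (hc t).continuousOn (s := spectrum ℂ (resolventI H))
    have c2 := (hc' t).continuousOn (s := spectrum ℂ (resolventI H))
    have c3 := (hc' (t + τ)).continuousOn (s := spectrum ℂ (resolventI H))
    have c4 : ContinuousOn (fun w => Complex.I * (w * e t w)) (spectrum ℂ (resolventI H)) :=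
      continuousOn_const.mul c2
    have c5 : ContinuousOn (fun w => e t w - Complex.I * (w * e t w))
      (spectrum ℂ (resolventI H)) := c1.sub c4
    have c6 : ContinuousOn (fun w => (τ * Complex.I) * (e t w - Complex.I * (w * e t w)))
      (spectrum ℂ (resolventI H)) := continuousOn_const.mul c5
    have c7 : ContinuousOn (fun w => w * e (t + τ) w - w * e t w) (spectrum ℂ (resolventI H)) :=
      c3.sub c2
    rw [cfc_add _ _ _ c7 c6, cfc_sub _ _ _ c3 c2, cfc_const_mul _ _ _ c5, cfc_sub _ _ _ c1 c4,
      cfc_const_mul _ _ _ c2]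
  have key' := DFunLike.congr_fun key w
  have hbound : ‖cfc (fun w => (w * e (t + τ) w - w * e t w)
        + (τ * Complex.I) * (e t w - Complex.I * (w * e t w))) (resolventI H)‖ ≤ 2 * τ ^ 2 := by
    refine norm_cfc_le (by positivity) fun z hz => ?_
    by_cases h0 : z = 0
    · simp [h0, he]
      positivity
    · set l := (z⁻¹).re with hl
      have hzl : z * ((l : ℂ) + Complex.I) = 1 := mul_inv_re_add_I hH hz h0
      have e1 : e (t + τ) z = e t z * Complex.exp (Complex.I * ((-(τ * l) : ℝ) : ℂ)) := by
        simp only [he, ← hl]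
        rw [mul_assoc z, ← Complex.exp_add]
        congr 2
        push_cast
        ring
      -- The relation `z (l + i) = 1` turns the derivative term into `z e_t(z)` times `iτl`, so that
      -- the whole expression is a Taylor remainder.
      have e2 : (z * e (t + τ) z - z * e t z) + (τ * Complex.I) * (e t z - Complex.I * (z * e t z))
          = z * e t z * (Complex.exp (Complex.I * ((-(τ * l) : ℝ) : ℂ)) - 1
            - Complex.I * ((-(τ * l) : ℝ) : ℂ)) := by
        rw [e1]
        push_cast
        linear_combination (-τ * Complex.I * e t z) * hzl
      rw [e2, norm_mul]
      have e3 : ‖z * e t z‖ = ‖z‖ ^ 2 := by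
        simp only [he, norm_mul, ← hl]
        rw [norm_exp_neg_I_mul]
        ring
      rw [e3]
      have h5 : ‖z‖ ^ 2 * l ^ 2 ≤ 1 := by
        have := norm_mul_inv_re_le z
        rw [← hl] at this
        calc ‖z‖ ^ 2 * l ^ 2 = (‖z‖ * |l|) ^ 2 := by rw [mul_pow, sq_abs]
          _ ≤ 1 ^ 2 := by gcongr
          _ = 1 := one_pow 2
      calc _ ≤ ‖z‖ ^ 2 * (2 * (-(τ * l)) ^ 2) := by
            gcongr
            exact norm_exp_I_sub_one_sub_le _
        _ = (‖z‖ ^ 2 * l ^ 2) * (2 * τ ^ 2) := by ring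
        _ ≤ 1 * (2 * τ ^ 2) := by gcongr
        _ = 2 * τ ^ 2 := one_mul _
  have hfin : cfc (fun w => w * e (t + τ) w) (resolventI H) w
      - cfc (fun w => w * e t w) (resolventI H) w
      - τ • (-Complex.I • (cfc (e t) (resolventI H) w
        - Complex.I • cfc (fun w => w * e t w) (resolventI H) w))
      = cfc (fun w => (w * e (t + τ) w - w * e t w)
        + (τ * Complex.I) * (e t w - Complex.I * (w * e t w))) (resolventI H) w := by
    rw [← key']
    simp only [_root_.add_apply, _root_.sub_apply, _root_.smul_apply]
    rw [← Complex.coe_smul τ]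
    module
  rw [hfin]
  refine (ContinuousLinearMap.le_opNorm _ _).trans ?_
  calc _ ≤ (2 * τ ^ 2) * ‖w‖ := by gcongr
    _ = _ := by ring

/-! ### Fourier representation of energy cutoffs. -/

open scoped FourierTransform SchwartzMap

/-- Fourier inversion for `f(l) = (l + i)² φ(l)` writes `φ(H)` as `∫ f̂(ξ) e^{2πiξH} (H + i)⁻² dξ`.
The two resolvents put every vector under the integral in the domain of `H`, where the evolution can
be differentiated. -/
theorem propagator_functionOf_eq_integral (hH : IsSelfAdjoint H) (f : 𝓢(ℝ, ℂ)) {φ : ℝ → ℂ}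
    (hφ : Continuous φ) {M : ℝ} (hM : ∀ l, ‖φ l‖ ≤ M)
    (hf : ∀ l : ℝ, f l = ((l : ℂ) + Complex.I) ^ 2 * φ l) (t : ℝ) (x : E) :
    propagator H t (functionOf H φ x)
      = ∫ ξ : ℝ, (𝓕 f) ξ • propagator H (t - 2 * Real.pi * ξ) (resolventI H (resolventI H x)) := by
  have hn := resolventI_normal hH
  set R := resolventI H with hR
  obtain ⟨B, hB⟩ : ∃ B, ∀ l, ‖f l‖ ≤ B := by
    obtain ⟨B, -, hB⟩ := f.decay 0 0
    exact ⟨B, fun l => by simpa using hB l⟩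
  have hcf : Continuous fun w : ℂ => w * f (w⁻¹).re := continuous_symbol f.continuous hB
  -- Since `f(l)` carries `(l + i)²`, the product `R · (f(H) R)` has symbol `φ`; it is identified
  -- with `φ(H)` by uniqueness after one more multiplication by `R`.
  have hφH : functionOf H φ = R ∘L cfc (fun w : ℂ => w * f (w⁻¹).re) R := by
    refine (existsUnique_isFunctionOf hH hφ hM).unique (functionOf_spec hH hφ hM) ?_
    have e : R * cfc (fun w : ℂ => w * f (w⁻¹).re) R * R
        = cfc (fun w : ℂ => w * (w * f (w⁻¹).re) * w) R := by
      rw [cfc_mul (fun w : ℂ => w * (w * f (w⁻¹).re)) (fun w => w) R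
          (continuous_id.mul hcf).continuousOn (by fun_prop),
        cfc_mul (fun w => w) (fun w : ℂ => w * f (w⁻¹).re) R (by fun_prop) hcf.continuousOn,
        cfc_id' ℂ R]
    unfold IsFunctionOf
    refine Eq.trans e (cfc_congr fun z hz => ?_)
    by_cases h0 : z = 0
    · simp [h0]
    · have := mul_inv_re_add_I hH hz h0
      rw [hf]
      linear_combination (z * φ (z⁻¹).re * (z * (((z⁻¹).re : ℂ) + Complex.I) + 1)) * this
  set e : ℝ → ℂ → ℂ := fun t w => w * Complex.exp (-(Complex.I * t * ((w⁻¹).re : ℂ))) with he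
  have hc : ∀ t, Continuous (e t) := continuous_exp_symbol'
  have e1 : propagator H t ∘L functionOf H φ
      = cfc (fun w : ℂ => ∫ ξ : ℝ, (𝓕 f) ξ * (w * e (t - 2 * Real.pi * ξ) w)) R := by
    have h1 : propagator H t ∘L functionOf H φ
        = cfc (e t) R * cfc (fun w : ℂ => w * f (w⁻¹).re) R := by
      rw [hφH, ← propagator_comp_resolventI hH]
      rfl
    rw [h1, ← cfc_mul _ _ _ (hc t).continuousOn hcf.continuousOn]
    refine cfc_congr fun z _ => ?_
    have hinv : f (z⁻¹).re = 𝓕⁻ (𝓕 f) (z⁻¹).re := by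
      rw [FourierTransform.fourierInv_fourier_eq]
    rw [SchwartzMap.fourierInv_coe, Real.fourierInv_eq'] at hinv
    rw [hinv, ← integral_const_mul, ← integral_const_mul]
    congr 1
    ext ξ
    simp only [he, smul_eq_mul]
    have : Complex.exp (-(Complex.I * ((t - 2 * Real.pi * ξ : ℝ) : ℂ) * ((z⁻¹).re : ℂ)))
        = Complex.exp (-(Complex.I * t * ((z⁻¹).re : ℂ)))
          * Complex.exp (((2 * Real.pi * ξ * (z⁻¹).re : ℝ) : ℂ) * Complex.I) := by
      rw [← Complex.exp_add]
      congr 1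
      push_cast
      ring
    have hin : inner ℝ ξ (z⁻¹).re = ξ * (z⁻¹).re := by
      simp only [RCLike.inner_apply, conj_trivial]
      ring
    rw [this, hin, ← mul_assoc (2 * Real.pi)]
    ring
  have hcont : Continuous (Function.uncurry fun (ξ : ℝ) (w : ℂ) =>
      (𝓕 f) ξ * (w * e (t - 2 * Real.pi * ξ) w)) := by
    have c1 : Continuous fun p : ℝ × ℂ => (𝓕 f) p.1 := (𝓕 f).continuous.comp continuous_fst
    have c2 : Continuous fun p : ℝ × ℂ => e (t - 2 * Real.pi * p.1) p.2 :=
      continuous_exp_symbol.comp (by fun_prop : Continuous fun p : ℝ × ℂ =>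
        (t - 2 * Real.pi * p.1, p.2))
    exact c1.mul (continuous_snd.mul c2)
  have hbd : ∀ᵐ ξ : ℝ, ∀ z ∈ spectrum ℂ R, ‖(𝓕 f) ξ * (z * e (t - 2 * Real.pi * ξ) z)‖
      ≤ ‖(𝓕 f) ξ‖ := by
    refine ae_of_all _ fun ξ z hz => ?_
    have h1 := norm_le_one_of_mem_spectrum hH hz
    rw [norm_mul, norm_mul]
    simp only [he, norm_mul]
    rw [norm_exp_neg_I_mul]
    refine mul_le_of_le_one_right (norm_nonneg _) ?_
    nlinarith [norm_nonneg z]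
  have hint : HasFiniteIntegral (fun ξ : ℝ => ‖(𝓕 f) ξ‖) volume := (𝓕 f).integrable.norm.2
  rw [cfc_integral _ (fun ξ => ‖(𝓕 f) ξ‖) R hcont.continuousOn hbd hint] at e1
  have hI := integrable_cfc (μ := (volume : Measure ℝ)) _ (fun ξ => ‖(𝓕 f) ξ‖) R
    hcont.continuousOn hbd hint
  have e2 := DFunLike.congr_fun e1 x
  rw [ContinuousLinearMap.integral_apply hI] at e2
  refine e2.trans ?_
  congr 1
  ext ξ
  have c : ContinuousOn (fun w => w * e (t - 2 * Real.pi * ξ) w) (spectrum ℂ R) :=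
    (continuous_id.mul (hc _)).continuousOn
  rw [cfc_const_mul _ _ _ c, propagator_resolventI_sq hH]
  rfl

end Evolution

end Repulsive

namespace Repulsive

variable {n : ℕ}

/-! ### Bounded multipliers -/

/-- Bounded measurable real functions. -/
structure IsMultiplier (m : Conf n → ℝ) : Prop where
  measurable : Measurable m
  bounded : ∃ B, ∀ x, |m x| ≤ B

theorem IsMultiplier.neg {m : Conf n → ℝ} (hm : IsMultiplier m) :
    IsMultiplier fun x => -m x := by
  obtain ⟨B, hB⟩ := hm.bounded
  exact ⟨hm.measurable.neg, B, fun x => by simpa using hB x⟩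

theorem IsMultiplier.coeFn_mulOp {m : Conf n → ℝ} (hm : IsMultiplier m) (u : L2 n) :
    (mulOp m u : Conf n → ℂ) =ᵐ[volume] fun x => (m x : ℂ) * u x := by
  obtain ⟨B, hB⟩ := hm.bounded
  exact mulOp_coeFn hm.measurable hB u

theorem norm_mulOp_le {m : Conf n → ℝ} (hm : Measurable m) {B : ℝ} (hB : ∀ x, |m x| ≤ B)
    (u : L2 n) : ‖mulOp m u‖ ≤ B * ‖u‖ := by
  refine Lp.norm_le_mul_norm_of_ae_le_mul ?_
  filter_upwards [mulOp_coeFn hm hB u] with x hx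
  rw [hx, norm_mul, Complex.norm_real, Real.norm_eq_abs]
  exact mul_le_mul_of_nonneg_right (hB x) (norm_nonneg _)

/-- Multiplication by a bounded function as a bounded operator. -/
noncomputable def mulCLM (m : Conf n → ℝ) (hm : IsMultiplier m) : L2 n →L[ℂ] L2 n :=
  LinearMap.mkContinuous
    { toFun := mulOp m
      map_add' := fun u v => by
        refine Lp.ext ?_
        filter_upwards [hm.coeFn_mulOp (u + v), hm.coeFn_mulOp u, hm.coeFn_mulOp v,
          Lp.coeFn_add u v, Lp.coeFn_add (mulOp m u) (mulOp m v)] with x h1 h2 h3 h4 h5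
        rw [h1, h5, h4, Pi.add_apply, Pi.add_apply, h2, h3]
        ring
      map_smul' := fun c u => by
        refine Lp.ext ?_
        filter_upwards [hm.coeFn_mulOp (c • u), hm.coeFn_mulOp u,
          Lp.coeFn_smul c u, Lp.coeFn_smul c (mulOp m u)] with x h1 h2 h4 h5
        rw [h1, RingHom.id_apply, h5, h4, Pi.smul_apply, Pi.smul_apply, h2, smul_eq_mul,
          smul_eq_mul]
        ring }
    hm.bounded.choose fun u => norm_mulOp_le hm.measurable hm.bounded.choose_spec u

@[simp] theorem mulCLM_apply (m : Conf n → ℝ) (hm : IsMultiplier m) (u : L2 n) :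
    mulCLM m hm u = mulOp m u := rfl

theorem inner_mulOp {m : Conf n → ℝ} (hm : IsMultiplier m) (u v : L2 n) :
    inner ℂ u (mulOp m v) = ∫ x, (m x : ℂ) * ((starRingEnd ℂ) (u x) * v x) := by
  rw [L2.inner_def]
  refine integral_congr_ae ?_
  filter_upwards [hm.coeFn_mulOp v] with x hx
  rw [hx, RCLike.inner_apply]
  ring

theorem integrable_inner_mulOp {m : Conf n → ℝ} (hm : IsMultiplier m) (u v : L2 n) :
    Integrable (fun x => (m x : ℂ) * ((starRingEnd ℂ) (u x) * v x)) := by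
  refine (L2.integrable_inner (𝕜 := ℂ) u (mulOp m v)).congr ?_
  filter_upwards [hm.coeFn_mulOp v] with x hx
  rw [hx, RCLike.inner_apply]
  ring

/-- The quadratic form `∫ m |u|²`. -/
noncomputable def weight (m : Conf n → ℝ) (u : L2 n) : ℝ := ∫ x, m x * ‖u x‖ ^ 2

theorem integrable_weight {m : Conf n → ℝ} (hm : IsMultiplier m) (u : L2 n) :
    Integrable fun x => m x * ‖u x‖ ^ 2 := by
  refine (integrable_inner_mulOp hm u u).re.congr (ae_of_all _ fun x => ?_)
  simp only [Complex.conj_mul']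
  norm_cast

theorem inner_mulOp_self {m : Conf n → ℝ} (hm : IsMultiplier m) (u : L2 n) :
    inner ℂ u (mulOp m u) = (weight m u : ℂ) := by
  rw [inner_mulOp hm, weight, ← integral_complex_ofReal]
  congr 1
  ext x
  rw [Complex.conj_mul']
  push_cast
  rfl

theorem re_inner_mulOp {m : Conf n → ℝ} (hm : IsMultiplier m) (u v : L2 n) :
    (inner ℂ u (mulOp m v)).re = ∫ x, m x * ((starRingEnd ℂ) (u x) * v x).re := by
  rw [inner_mulOp hm]
  refine (integral_re (integrable_inner_mulOp hm u v)).symm.trans ?_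
  congr 1
  ext x
  simp

theorem im_inner_mulOp {m : Conf n → ℝ} (hm : IsMultiplier m) (u v : L2 n) :
    (inner ℂ u (mulOp m v)).im = ∫ x, m x * ((starRingEnd ℂ) (u x) * v x).im := by
  rw [inner_mulOp hm]
  refine (integral_im (integrable_inner_mulOp hm u v)).symm.trans ?_
  congr 1
  ext x
  simp

theorem integrable_re_inner {m : Conf n → ℝ} (hm : IsMultiplier m) (u v : L2 n) :
    Integrable fun x => m x * ((starRingEnd ℂ) (u x) * v x).re :=
  (integrable_inner_mulOp hm u v).re.congr (ae_of_all _ fun x => by simp)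

theorem integrable_im_inner {m : Conf n → ℝ} (hm : IsMultiplier m) (u v : L2 n) :
    Integrable fun x => m x * ((starRingEnd ℂ) (u x) * v x).im :=
  (integrable_inner_mulOp hm u v).im.congr (ae_of_all _ fun x => by simp)

theorem weight_mono {m₁ m₂ : Conf n → ℝ} (h₁ : IsMultiplier m₁) (h₂ : IsMultiplier m₂)
    (h : ∀ x, m₁ x ≤ m₂ x) (u : L2 n) : weight m₁ u ≤ weight m₂ u :=
  integral_mono (integrable_weight h₁ u) (integrable_weight h₂ u) fun x =>
    mul_le_mul_of_nonneg_right (h x) (sq_nonneg _)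

theorem weight_nonneg {m : Conf n → ℝ} (h : ∀ x, 0 ≤ m x) (u : L2 n) : 0 ≤ weight m u :=
  integral_nonneg fun x => mul_nonneg (h x) (sq_nonneg _)

theorem weight_one (u : L2 n) : weight (fun _ => 1) u = ‖u‖ ^ 2 := by
  have hm : IsMultiplier (fun _ : Conf n => (1 : ℝ)) := ⟨measurable_const, 1, fun x => by simp⟩
  have h1 := inner_mulOp_self hm u
  have h2 : mulOp (fun _ => 1) u = u := by
    refine Lp.ext ((hm.coeFn_mulOp u).trans (ae_of_all _ fun x => by simp))
  rw [h2, inner_self_eq_norm_sq_to_K] at h1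
  refine Complex.ofReal_injective (h1.symm.trans ?_)
  norm_cast

theorem weight_le_of_le {m : Conf n → ℝ} (hm : IsMultiplier m) {B : ℝ} (h : ∀ x, m x ≤ B)
    (u : L2 n) : weight m u ≤ B * ‖u‖ ^ 2 := by
  rw [← weight_one, weight, weight, ← integral_const_mul]
  have h1 : IsMultiplier (fun _ : Conf n => (1 : ℝ)) := ⟨measurable_const, 1, fun x => by simp⟩
  refine integral_mono (integrable_weight hm u) ((integrable_weight h1 u).const_mul B) fun x => ?_
  simp only [one_mul]
  exact mul_le_mul_of_nonneg_right (h x) (sq_nonneg _)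

theorem norm_mulOp_sq {m : Conf n → ℝ} (hm : IsMultiplier m) (u : L2 n) :
    ‖mulOp m u‖ ^ 2 = weight (fun x => m x ^ 2) u := by
  rw [← weight_one, weight, weight]
  refine integral_congr_ae ?_
  filter_upwards [hm.coeFn_mulOp u] with x hx
  rw [hx, norm_mul, mul_pow, Complex.norm_real, Real.norm_eq_abs, sq_abs, one_mul]

theorem continuous_weight {m : Conf n → ℝ} (hm : IsMultiplier m) : Continuous (weight m) := by
  have h : weight m = fun u => (inner ℂ u (mulCLM m hm u)).re := by
    ext u
    rw [mulCLM_apply, inner_mulOp_self hm, Complex.ofReal_re]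
  rw [h]
  exact Complex.continuous_re.comp (continuous_id.inner (mulCLM m hm).continuous)

/-! ### Line derivatives and the divergence theorem -/

/-- The `i`-th standard basis vector. -/
noncomputable abbrev basisVec (i : Fin n) : Conf n := EuclideanSpace.basisFun (Fin n) ℝ i

/-- Integration by parts against the constant function `1`. -/
theorem integral_lineDeriv_eq_zero {Φ Φ' : Conf n → ℝ} {v : Conf n} (hc : Continuous Φ)
    (hs : HasCompactSupport Φ) (hc' : Continuous Φ') (hs' : HasCompactSupport Φ')
    (h : ∀ x, HasLineDerivAt ℝ Φ (Φ' x) x v) : ∫ x, Φ' x = 0 := by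
  have := integral_bilinear_hasLineDerivAt_right_eq_neg_left_of_integrable
    (μ := (volume : Measure (Conf n))) (f := Φ) (f' := Φ') (g := fun _ => (1 : ℝ))
    (g' := fun _ => (0 : ℝ)) (v := v) (B := ContinuousLinearMap.mul ℝ ℝ)
    (by simpa using hc'.integrable_of_hasCompactSupport hs') (by simp)
    (by simpa using hc.integrable_of_hasCompactSupport hs) (fun x _ => h x)
    (fun x _ => by simpa [HasLineDerivAt] using hasDerivAt_const (0 : ℝ) (1 : ℝ))
  simpa using this

/-- Partial derivatives. -/
noncomputable def pderiv (i : Fin n) (f : Conf n → ℂ) (x : Conf n) : ℂ := fderiv ℝ f x (basisVec i)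

theorem ContDiff.pderiv {f : Conf n → ℂ} (hf : ContDiff ℝ ∞ f) (i : Fin n) :
    ContDiff ℝ ∞ (pderiv i f) :=
  (hf.fderiv_right (m := ∞) (by simp)).clm_apply contDiff_const

theorem hasLineDerivAt_pderiv {f : Conf n → ℂ} (hf : ContDiff ℝ ∞ f) (i : Fin n) (x : Conf n) :
    HasLineDerivAt ℝ f (pderiv i f x) x (basisVec i) :=
  ((hf.differentiable (by simp)) x).hasFDerivAt.hasLineDerivAt _

theorem pderiv_eq_zero {f : Conf n → ℂ} {x : Conf n} (hx : x ∉ tsupport f) (i : Fin n) :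
    pderiv i f x = 0 := by
  rw [pderiv, fderiv_of_notMem_tsupport (𝕜 := ℝ) hx]
  rfl

theorem tsupport_pderiv_subset (f : Conf n → ℂ) (i : Fin n) :
    tsupport (pderiv i f) ⊆ tsupport f := by
  refine closure_minimal (fun x hx => ?_) (isClosed_tsupport f)
  by_contra h
  exact hx (pderiv_eq_zero h i)

theorem laplacian_eq_sum_pderiv {f : Conf n → ℂ} (hf : ContDiff ℝ ∞ f) (x : Conf n) :
    Δ f x = ∑ i, pderiv i (pderiv i f) x := by
  rw [InnerProductSpace.laplacian_eq_iteratedFDeriv_orthonormalBasis f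
    (EuclideanSpace.basisFun (Fin n) ℝ)]
  refine Finset.sum_congr rfl fun i _ => ?_
  rw [iteratedFDeriv_two_apply]
  have hd : DifferentiableAt ℝ (fderiv ℝ f) x :=
    (hf.fderiv_right (m := ∞) (by simp)).differentiable (by simp) x
  simp only [pderiv]
  change _ = fderiv ℝ (fun y => fderiv ℝ f y (basisVec i)) x (basisVec i)
  rw [fderiv_clm_apply hd (by fun_prop)]
  simp

theorem _root_.HasLineDerivAt.re {f : Conf n → ℂ} {f' : ℂ} {x v : Conf n}
    (h : HasLineDerivAt ℝ f f' x v) : HasLineDerivAt ℝ (fun y => (f y).re) f'.re x v :=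
  Complex.reCLM.hasFDerivAt.comp_hasDerivAt (0 : ℝ) h

theorem _root_.HasLineDerivAt.im {f : Conf n → ℂ} {f' : ℂ} {x v : Conf n}
    (h : HasLineDerivAt ℝ f f' x v) : HasLineDerivAt ℝ (fun y => (f y).im) f'.im x v :=
  Complex.imCLM.hasFDerivAt.comp_hasDerivAt (0 : ℝ) h

/-! ### The form inequality -/

/-- `G`, `G₁` and `l`, `l₁`, `l₂` are continuous functions with their partial derivatives. -/
structure FormData (G l : Conf n → ℝ) (G₁ l₁ l₂ : Fin n → Conf n → ℝ) : Prop where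
  contG : Continuous G
  contG₁ : ∀ i, Continuous (G₁ i)
  derivG : ∀ i x, HasLineDerivAt ℝ G (G₁ i x) x (basisVec i)
  contl : Continuous l
  contl₁ : ∀ i, Continuous (l₁ i)
  contl₂ : ∀ i, Continuous (l₂ i)
  derivl : ∀ i x, HasLineDerivAt ℝ l (l₁ i x) x (basisVec i)
  derivl₁ : ∀ i x, HasLineDerivAt ℝ (l₁ i) (l₂ i x) x (basisVec i)

theorem two_mul_le_add_of_sq_le {X A B : ℝ} (hA : 0 ≤ A) (hB : 0 ≤ B) (h : X ^ 2 ≤ A * B) :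
    2 * X ≤ A + B := by
  refine le_of_abs_le (abs_le_of_sq_le_sq (?_ : (2 * X) ^ 2 ≤ (A + B) ^ 2) (add_nonneg hA hB))
  nlinarith [sq_nonneg (A - B)]

/-- Adding divergences, which integrate to zero, changes the integrand into `λ k |f|² + λ⁻¹ l |∇f|²
- 2 Σ Gᵢ Im(conj(∂ᵢf) f)`. This is pointwise nonnegative by Cauchy-Schwarz, the bound `|∇G|² ≤ k l`
and the arithmetic-geometric mean inequality. No derivative of `f` other than `Δf` survives in the
statement. -/
theorem form_integral_nonneg {G l k : Conf n → ℝ} {G₁ l₁ l₂ : Fin n → Conf n → ℝ}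
    (h : FormData G l G₁ l₁ l₂) (hk : Continuous k) (hk0 : ∀ x, 0 ≤ k x) (hl0 : ∀ x, 0 ≤ l x)
    (hgrad : ∀ x, ∑ i, G₁ i x ^ 2 ≤ k x * l x) {lam : ℝ} (hlam : 0 < lam)
    {f : Conf n → ℂ} (hf : IsTest f) :
    Integrable (fun x => lam * k x * ‖f x‖ ^ 2
      + lam⁻¹ * ((∑ i, l₂ i x) / 2 * ‖f x‖ ^ 2 - l x * ((starRingEnd ℂ) (Δ f x) * f x).re)
      + 2 * G x * ((starRingEnd ℂ) (Δ f x) * f x).im) ∧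
    0 ≤ ∫ x, (lam * k x * ‖f x‖ ^ 2
      + lam⁻¹ * ((∑ i, l₂ i x) / 2 * ‖f x‖ ^ 2 - l x * ((starRingEnd ℂ) (Δ f x) * f x).re)
      + 2 * G x * ((starRingEnd ℂ) (Δ f x) * f x).im) := by
  obtain ⟨hf1, hf2⟩ := hf
  have hfc : Continuous f := hf1.continuous
  have hp : ∀ i, ContDiff ℝ ∞ (pderiv i f) := fun i => ContDiff.pderiv hf1 i
  have hpc : ∀ i, Continuous (pderiv i f) := fun i => (hp i).continuous
  have hppc : ∀ i, Continuous (pderiv i (pderiv i f)) := fun i => (ContDiff.pderiv (hp i) i).continuous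
  have z0 : ∀ x ∉ tsupport f, f x = 0 := fun x hx => image_eq_zero_of_notMem_tsupport hx
  have z1 : ∀ x ∉ tsupport f, ∀ i, pderiv i f x = 0 := fun x hx i => pderiv_eq_zero hx i
  have z2 : ∀ x ∉ tsupport f, ∀ i, pderiv i (pderiv i f) x = 0 := fun x hx i =>
    pderiv_eq_zero (fun h => hx (tsupport_pderiv_subset f i h)) i
  -- The `i`-th derivative of the field `λ⁻¹ (l Re(conj(∂ᵢf) f) - (lᵢ/2) |f|²) - 2 G Im(conj(∂ᵢf)
  -- f)`. The term with `lᵢ` cancels the one produced by differentiating `l`.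
  set Φ' : Fin n → Conf n → ℝ := fun i x =>
    lam⁻¹ * (l x * ((starRingEnd ℂ) (pderiv i (pderiv i f) x) * f x).re
      + l x * ‖pderiv i f x‖ ^ 2 - l₂ i x / 2 * ‖f x‖ ^ 2)
      - 2 * G₁ i x * ((starRingEnd ℂ) (pderiv i f x) * f x).im
      - 2 * G x * ((starRingEnd ℂ) (pderiv i (pderiv i f) x) * f x).im with hΦ'
  have hl := h.contl
  have hl1 := h.contl₁
  have hl2 := h.contl₂
  have hG := h.contG
  have hG1 := h.contG₁
  have cre := Complex.continuous_re
  have cim := Complex.continuous_im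
  have hconj : ∀ {a b : Conf n → ℂ}, Continuous a → Continuous b →
      Continuous fun x => (starRingEnd ℂ) (a x) * b x := fun ha hb =>
    (Complex.continuous_conj.comp ha).mul hb
  have cΦ' : ∀ i, Continuous (Φ' i) := fun i => by
    have c1 := cre.comp (hconj (hppc i) hfc)
    have c2 := cim.comp (hconj (hppc i) hfc)
    have c3 := cim.comp (hconj (hpc i) hfc)
    simp only [Function.comp_def] at c1 c2 c3
    exact ((continuous_const.mul (((hl.mul c1).add (hl.mul ((hpc i).norm.pow 2))).sub
      (((hl2 i).div_const 2).mul (hfc.norm.pow 2)))).sub ((continuous_const.mul (hG1 i)).mul c3)).sub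
      ((continuous_const.mul hG).mul c2)
  have sΦ' : ∀ i, HasCompactSupport (Φ' i) := fun i => by
    refine HasCompactSupport.intro hf2 fun x hx => ?_
    simp only [hΦ', z0 x hx, z1 x hx, z2 x hx]
    simp
  have hdiv : ∀ i, ∫ x, Φ' i x = 0 := fun i => by
    refine integral_lineDeriv_eq_zero (v := basisVec i)
      (Φ := fun x => lam⁻¹ * (l x * ((pderiv i f x).re * (f x).re + (pderiv i f x).im * (f x).im)
        - l₁ i x / 2 * ((f x).re * (f x).re + (f x).im * (f x).im))
        - 2 * G x * ((pderiv i f x).re * (f x).im - (pderiv i f x).im * (f x).re))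
      ?_ ?_ (cΦ' i) (sΦ' i) fun x => ?_
    · have r1 := cre.comp hfc
      have r2 := cim.comp hfc
      have r3 := cre.comp (hpc i)
      have r4 := cim.comp (hpc i)
      simp only [Function.comp_def] at r1 r2 r3 r4
      have r5 := hl1 i
      fun_prop
    · refine HasCompactSupport.intro hf2 fun x hx => ?_
      simp only [z0 x hx, z1 x hx]
      simp
    · have d0 := hasLineDerivAt_pderiv hf1 i x
      have d1 := hasLineDerivAt_pderiv (hp i) i x
      have a := d0.re
      have b := d0.im
      have p := d1.re
      have q := d1.im
      have dl := h.derivl i x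
      have dl1 := h.derivl₁ i x
      have dG := h.derivG i x
      unfold HasLineDerivAt at a b p q dl dl1 dG ⊢
      have key := (((dl.mul ((p.mul a).add (q.mul b))).sub
        ((dl1.div_const 2).mul ((a.mul a).add (b.mul b)))).const_mul lam⁻¹).sub
        ((dG.const_mul 2).mul ((p.mul b).sub (q.mul a)))
      refine HasDerivAt.congr_deriv key ?_
      simp only [zero_smul, add_zero, hΦ', Pi.add_apply, Pi.mul_apply, Pi.sub_apply]
      rw [← Complex.normSq_eq_norm_sq, ← Complex.normSq_eq_norm_sq, Complex.normSq_apply,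
        Complex.normSq_apply]
      simp only [Complex.mul_re, Complex.mul_im, Complex.conj_re, Complex.conj_im]
      ring
  set T : Conf n → ℝ := fun x => lam * k x * ‖f x‖ ^ 2
      + lam⁻¹ * ((∑ i, l₂ i x) / 2 * ‖f x‖ ^ 2 - l x * ((starRingEnd ℂ) (Δ f x) * f x).re)
      + 2 * G x * ((starRingEnd ℂ) (Δ f x) * f x).im with hT
  have hΔ : (Δ f) = fun x => ∑ i, pderiv i (pderiv i f) x := by
    ext x
    exact laplacian_eq_sum_pderiv hf1 x
  have cΔ : Continuous (Δ f) := by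
    rw [hΔ]
    exact continuous_finsetSum _ fun i _ => hppc i
  have iT : Integrable T := by
    refine Continuous.integrable_of_hasCompactSupport ?_ ?_
    · have c1 := cre.comp (hconj cΔ hfc)
      have c2 := cim.comp (hconj cΔ hfc)
      simp only [Function.comp_def] at c1 c2
      have c3 : Continuous fun x => ∑ i, l₂ i x := continuous_finsetSum _ fun i _ => hl2 i
      exact (((continuous_const.mul hk).mul (hfc.norm.pow 2)).add (continuous_const.mul
        (((c3.div_const 2).mul (hfc.norm.pow 2)).sub (hl.mul c1)))).add
        ((continuous_const.mul hG).mul c2)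
    · refine HasCompactSupport.intro hf2 fun x hx => ?_
      simp only [hT, z0 x hx]
      simp
  have iΦ : ∀ i, Integrable (Φ' i) := fun i => (cΦ' i).integrable_of_hasCompactSupport (sΦ' i)
  have hsum : ∫ x, T x = ∫ x, (T x + ∑ i, Φ' i x) := by
    rw [integral_add iT (integrable_finsetSum _ fun i _ => iΦ i),
      integral_finsetSum _ fun i _ => iΦ i]
    simp [hdiv]
  refine ⟨iT, ?_⟩
  rw [hsum]
  refine integral_nonneg fun x => ?_
  have e : T x + ∑ i, Φ' i x = lam * k x * ‖f x‖ ^ 2 + lam⁻¹ * l x * ∑ i, ‖pderiv i f x‖ ^ 2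
      - 2 * ∑ i, G₁ i x * ((starRingEnd ℂ) (pderiv i f x) * f x).im := by
    have e1 : ((starRingEnd ℂ) (Δ f x) * f x) =
        ∑ i, (starRingEnd ℂ) (pderiv i (pderiv i f) x) * f x := by
      rw [hΔ, map_sum, Finset.sum_mul]
    have e2 := congrArg Complex.re e1
    have e3 := congrArg Complex.im e1
    rw [Complex.re_sum] at e2
    rw [Complex.im_sum] at e3
    simp only [hT, hΦ', e2, e3, Finset.sum_sub_distrib,
      Finset.sum_add_distrib, ← Finset.mul_sum, ← Finset.sum_mul, ← Finset.sum_div, mul_assoc]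
    ring
  rw [Pi.zero_apply, e, sub_nonneg]
  refine two_mul_le_add_of_sq_le (mul_nonneg (mul_nonneg hlam.le (hk0 x)) (sq_nonneg _))
    (mul_nonneg (mul_nonneg (inv_nonneg.2 hlam.le) (hl0 x))
      (Finset.sum_nonneg fun i _ => sq_nonneg _)) ?_
  calc _ ≤ (∑ i, G₁ i x ^ 2) * ∑ i, ((starRingEnd ℂ) (pderiv i f x) * f x).im ^ 2 :=
        Finset.sum_mul_sq_le_sq_mul_sq _ _ _
    _ ≤ (k x * l x) * ∑ i, ‖pderiv i f x‖ ^ 2 * ‖f x‖ ^ 2 := by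
        refine mul_le_mul (hgrad x) (Finset.sum_le_sum fun i _ => ?_)
          (Finset.sum_nonneg fun i _ => sq_nonneg _) (mul_nonneg (hk0 x) (hl0 x))
        rw [← mul_pow, ← sq_abs]
        gcongr
        refine (Complex.abs_im_le_norm _).trans ?_
        rw [norm_mul, RCLike.norm_conj]
    _ = _ := by
        rw [← Finset.sum_mul]
        field_simp

/-- As `W` is real it disappears from the imaginary part; in the real part it contributes `l W
|f|²`, which the term `-l W` of the weight compensates. -/
theorem two_mul_im_inner_le_of_mem_coreGraph {G l k W : Conf n → ℝ}
    {G₁ l₁ l₂ : Fin n → Conf n → ℝ} (h : FormData G l G₁ l₁ l₂) (hk : Continuous k)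
    (hk0 : ∀ x, 0 ≤ k x) (hl0 : ∀ x, 0 ≤ l x) (hgrad : ∀ x, ∑ i, G₁ i x ^ 2 ≤ k x * l x)
    {lam : ℝ} (hlam : 0 < lam) (hG : IsMultiplier G) (hl : IsMultiplier l)
    (hN : IsMultiplier fun x => lam * k x + lam⁻¹ * ((∑ i, l₂ i x) / 2 - l x * W x))
    {q : L2 n × L2 n} (hq : q ∈ coreGraph W) :
    2 * (inner ℂ q.2 (mulOp G q.1)).im
      ≤ weight (fun x => lam * k x + lam⁻¹ * ((∑ i, l₂ i x) / 2 - l x * W x)) q.1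
        + lam⁻¹ * (inner ℂ q.2 (mulOp l q.1)).re := by
  obtain ⟨f, hf, h1, h2⟩ := hq
  have hnn := (form_integral_nonneg h hk hk0 hl0 hgrad hlam hf).2
  have i1 := integrable_weight hN q.1
  have i2 := (integrable_re_inner hl q.2 q.1).const_mul lam⁻¹
  have i3 := (integrable_im_inner hG q.2 q.1).const_mul 2
  have e := integral_sub (i1.add i2) i3
  simp only [Pi.add_apply] at e
  rw [re_inner_mulOp hl, im_inner_mulOp hG, weight, ← sub_nonneg, ← integral_const_mul,
    ← integral_const_mul, ← integral_add i1 i2, ← e]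
  refine hnn.trans_eq (integral_congr_ae ?_)
  filter_upwards [h1, h2] with x hx1 hx2
  have e1 : (starRingEnd ℂ) (schrodingerExpr W f x) * f x
      = -((starRingEnd ℂ) (Δ f x) * f x) + (W x : ℂ) * (‖f x‖ : ℂ) ^ 2 := by
    rw [schrodingerExpr, map_add, map_neg, map_mul, Complex.conj_ofReal, ← Complex.conj_mul']
    ring
  rw [hx1, hx2, e1]
  simp only [Complex.add_re, Complex.add_im, Complex.neg_re, Complex.neg_im]
  have r1 : ((W x : ℂ) * (‖f x‖ : ℂ) ^ 2).re = W x * ‖f x‖ ^ 2 := by norm_cast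
  have r2 : ((W x : ℂ) * (‖f x‖ : ℂ) ^ 2).im = 0 := by norm_cast
  rw [r1, r2]
  ring

/-! ### Passage from test functions to the closed operator. -/

theorem graph_schrodingerOp (W : Conf n → ℝ) :
    ((schrodingerOp W).graph : Set (L2 n × L2 n)) ⊆ closure (coreGraph W : Set (L2 n × L2 n)) := by
  unfold schrodingerOp
  by_cases h : (coreOp W).IsClosable
  · rw [← h.graph_closure_eq_closure_graph, coreOp_graph]
    exact (Submodule.topologicalClosure_coe _).subset
  -- For an operator that is not closable, `LinearPMap.closure` is by convention the operator
  -- itself.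
  · rw [LinearPMap.closure_def' h, coreOp_graph]
    exact subset_closure

/-- Every coefficient is a bounded multiplier, so both sides are continuous on `L² × L²` and the
inequality defines a closed set. -/
theorem two_mul_im_inner_le_of_mem_closure {G l k W : Conf n → ℝ}
    {G₁ l₁ l₂ : Fin n → Conf n → ℝ} (h : FormData G l G₁ l₁ l₂) (hk : Continuous k)
    (hk0 : ∀ x, 0 ≤ k x) (hl0 : ∀ x, 0 ≤ l x) (hgrad : ∀ x, ∑ i, G₁ i x ^ 2 ≤ k x * l x)
    {lam : ℝ} (hlam : 0 < lam) (hG : IsMultiplier G) (hl : IsMultiplier l)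
    (hN : IsMultiplier fun x => lam * k x + lam⁻¹ * ((∑ i, l₂ i x) / 2 - l x * W x))
    {q : L2 n × L2 n} (hq : q ∈ closure (coreGraph W : Set (L2 n × L2 n))) :
    2 * (inner ℂ q.2 (mulOp G q.1)).im
      ≤ weight (fun x => lam * k x + lam⁻¹ * ((∑ i, l₂ i x) / 2 - l x * W x)) q.1
        + lam⁻¹ * (inner ℂ q.2 (mulOp l q.1)).re := by
  have hcl : IsClosed {q : L2 n × L2 n | 2 * (inner ℂ q.2 (mulCLM G hG q.1)).im
      ≤ weight (fun x => lam * k x + lam⁻¹ * ((∑ i, l₂ i x) / 2 - l x * W x)) q.1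
        + lam⁻¹ * (inner ℂ q.2 (mulCLM l hl q.1)).re} := by
    have c1 : Continuous fun q : L2 n × L2 n => inner ℂ q.2 (mulCLM G hG q.1) :=
      continuous_snd.inner ((mulCLM G hG).continuous.comp continuous_fst)
    have c2 : Continuous fun q : L2 n × L2 n => inner ℂ q.2 (mulCLM l hl q.1) :=
      continuous_snd.inner ((mulCLM l hl).continuous.comp continuous_fst)
    have c3 := (continuous_weight hN).comp (continuous_fst (X := L2 n) (Y := L2 n))
    exact isClosed_le (continuous_const.mul (Complex.continuous_im.comp c1))
      (c3.add (continuous_const.mul (Complex.continuous_re.comp c2)))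
  have hsub := closure_minimal (s := (coreGraph W : Set (L2 n × L2 n)))
    (fun q hq => two_mul_im_inner_le_of_mem_coreGraph h hk hk0 hl0 hgrad hlam hG hl hN hq) hcl
  exact hsub hq

theorem FormData.neg {G l : Conf n → ℝ} {G₁ l₁ l₂ : Fin n → Conf n → ℝ}
    (h : FormData G l G₁ l₁ l₂) : FormData (fun x => -G x) l (fun i x => -G₁ i x) l₁ l₂ where
  contG := h.contG.neg
  contG₁ i := (h.contG₁ i).neg
  derivG i x := HasDerivAt.neg (h.derivG i x)
  contl := h.contl
  contl₁ := h.contl₁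
  contl₂ := h.contl₂
  derivl := h.derivl
  derivl₁ := h.derivl₁

/-- The commutator of `-Δ + W` with the multiplication by `G`, as a quadratic form. -/
theorem abs_two_mul_im_inner_le {G l k W : Conf n → ℝ}
    {G₁ l₁ l₂ : Fin n → Conf n → ℝ} (h : FormData G l G₁ l₁ l₂) (hk : Continuous k)
    (hk0 : ∀ x, 0 ≤ k x) (hl0 : ∀ x, 0 ≤ l x) (hgrad : ∀ x, ∑ i, G₁ i x ^ 2 ≤ k x * l x)
    {lam : ℝ} (hlam : 0 < lam) (hG : IsMultiplier G) (hl : IsMultiplier l)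
    (hN : IsMultiplier fun x => lam * k x + lam⁻¹ * ((∑ i, l₂ i x) / 2 - l x * W x))
    {u v : L2 n} (hq : (u, v) ∈ closure (coreGraph W : Set (L2 n × L2 n))) :
    |2 * (inner ℂ v (mulOp G u)).im|
      ≤ weight (fun x => lam * k x + lam⁻¹ * ((∑ i, l₂ i x) / 2 - l x * W x)) u
        + lam⁻¹ * (inner ℂ v (mulOp l u)).re := by
  have hneg : mulOp (fun x => -G x) u = -mulOp G u := by
    refine Lp.ext ?_
    filter_upwards [hG.neg.coeFn_mulOp u, hG.coeFn_mulOp u,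
      Lp.coeFn_neg (mulOp G u)] with x h1 h2 h3
    rw [h1, h3, Pi.neg_apply, h2]
    push_cast
    ring
  have h0 := two_mul_im_inner_le_of_mem_closure h hk hk0 hl0 hgrad hlam hG hl hN hq
  refine abs_le.2 ⟨?_, h0⟩
  have := two_mul_im_inner_le_of_mem_closure h.neg hk hk0 hl0 (fun x => by simpa using hgrad x) hlam
    hG.neg hl hN hq
  rw [hneg, inner_neg_right, Complex.neg_im] at this
  linarith

theorem mem_closure_coreGraph {W : Conf n → ℝ} (u : (schrodingerOp W).domain) :
    ((u : L2 n), schrodingerOp W u) ∈ closure (coreGraph W : Set (L2 n × L2 n)) :=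
  graph_schrodingerOp W (LinearPMap.mem_graph _ u)

end Repulsive

namespace Repulsive

variable {n : ℕ}

/-! ### A smooth step -/

/-- `g` is a smooth nondecreasing step from `0` on `(-∞, 0]` to `1` on `[1, ∞)` whose first three
derivatives `h`, `h₁`, `h₂` are bounded by `B`. -/
structure SmoothStep (g h h₁ h₂ : ℝ → ℝ) (B : ℝ) : Prop where
  deriv_g : ∀ s, HasDerivAt g (h s) s
  deriv_h : ∀ s, HasDerivAt h (h₁ s) s
  deriv_h₁ : ∀ s, HasDerivAt h₁ (h₂ s) s
  cont_h₂ : Continuous h₂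
  g_nonneg : ∀ s, 0 ≤ g s
  g_le_one : ∀ s, g s ≤ 1
  g_zero : ∀ s, s ≤ 0 → g s = 0
  g_one : ∀ s, 1 ≤ s → g s = 1
  h_nonneg : ∀ s, 0 ≤ h s
  h_le : ∀ s, |h s| ≤ B
  h₁_le : ∀ s, |h₁ s| ≤ B
  h₂_le : ∀ s, |h₂ s| ≤ B
  h_zero : ∀ s < 0, h s = 0
  h₁_zero : ∀ s < 0, h₁ s = 0
  h₂_zero : ∀ s < 0, h₂ s = 0

theorem exists_smoothStep : ∃ (g h h₁ h₂ : ℝ → ℝ) (B : ℝ), SmoothStep g h h₁ h₂ B := by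
  set g := Real.smoothTransition
  have c0 : ContDiff ℝ ∞ g := Real.smoothTransition.contDiff
  have c1 : ContDiff ℝ ∞ (deriv g) := (contDiff_infty_iff_deriv.1 c0).2
  have c2 : ContDiff ℝ ∞ (deriv (deriv g)) := (contDiff_infty_iff_deriv.1 c1).2
  have c3 : ContDiff ℝ ∞ (deriv (deriv (deriv g))) := (contDiff_infty_iff_deriv.1 c2).2
  have z1 : ∀ s < 0, deriv g s = 0 := fun s hs => by
    have : g =ᶠ[𝓝 s] fun _ => 0 := by
      filter_upwards [gt_mem_nhds hs] with y hy
      exact Real.smoothTransition.zero_of_nonpos hy.le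
    rw [this.deriv_eq]
    simp
  have z1' : ∀ s, 1 < s → deriv g s = 0 := fun s hs => by
    have : g =ᶠ[𝓝 s] fun _ => 1 := by
      filter_upwards [lt_mem_nhds hs] with y hy
      exact Real.smoothTransition.one_of_one_le hy.le
    rw [this.deriv_eq]
    simp
  have zd : ∀ f : ℝ → ℝ, (∀ s < 0, f s = 0) → ∀ s < 0, deriv f s = 0 := fun f hf s hs => by
    have : f =ᶠ[𝓝 s] fun _ => 0 := by
      filter_upwards [gt_mem_nhds hs] with y hy
      exact hf y hy
    rw [this.deriv_eq]
    simp
  have s1 : HasCompactSupport (deriv g) := by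
    refine HasCompactSupport.intro (isCompact_Icc (a := (0 : ℝ)) (b := 1)) fun s hs => ?_
    rw [Set.mem_Icc, not_and_or, not_le, not_le] at hs
    exact hs.elim (z1 s) (z1' s)
  obtain ⟨B1, hB1⟩ := s1.exists_bound_of_continuous c1.continuous
  obtain ⟨B2, hB2⟩ := s1.deriv.exists_bound_of_continuous c2.continuous
  obtain ⟨B3, hB3⟩ := s1.deriv.deriv.exists_bound_of_continuous c3.continuous
  have d : ∀ f : ℝ → ℝ, ContDiff ℝ ∞ f → ∀ s, HasDerivAt f (deriv f s) s := fun f hf s =>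
    (hf.differentiable (by simp) s).hasDerivAt
  exact ⟨g, _, _, _, max B1 (max B2 B3),
    { deriv_g := d g c0
      deriv_h := d _ c1
      deriv_h₁ := d _ c2
      cont_h₂ := c3.continuous
      g_nonneg := Real.smoothTransition.nonneg
      g_le_one := Real.smoothTransition.le_one
      g_zero := fun s => Real.smoothTransition.zero_of_nonpos
      g_one := fun s => Real.smoothTransition.one_of_one_le
      h_nonneg := fun s => Real.smoothTransition.monotone.deriv_nonneg
      h_le := fun s => (hB1 s).trans (le_max_left _ _)
      h₁_le := fun s => (hB2 s).trans ((le_max_left _ _).trans (le_max_right _ _))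
      h₂_le := fun s => (hB3 s).trans ((le_max_right _ _).trans (le_max_right _ _))
      h_zero := z1
      h₁_zero := zd _ z1
      h₂_zero := zd _ (zd _ z1) }⟩

namespace SmoothStep

variable {g h h₁ h₂ : ℝ → ℝ} {B : ℝ} (S : SmoothStep g h h₁ h₂ B)
include S

theorem cont_g : Continuous g := continuous_iff_continuousAt.2 fun s => (S.deriv_g s).continuousAt

theorem cont_h : Continuous h := continuous_iff_continuousAt.2 fun s => (S.deriv_h s).continuousAt

theorem cont_h₁ : Continuous h₁ :=
  continuous_iff_continuousAt.2 fun s => (S.deriv_h₁ s).continuousAt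

theorem B_nonneg : 0 ≤ B := (abs_nonneg _).trans (S.h_le 0)

theorem abs_taylor_le (s τ : ℝ) : |g (s + τ) - g s - τ * h s| ≤ B * τ ^ 2 := by
  have hlip : ∀ y, |h (s + y) - h s| ≤ B * |y| := fun y => by
    have := convex_univ.norm_image_sub_le_of_norm_hasDerivWithin_le (f := h) (f' := h₁) (C := B)
      (fun x _ => (S.deriv_h x).hasDerivWithinAt) (fun x _ => S.h₁_le x) (Set.mem_univ s)
      (Set.mem_univ (s + y))
    simpa using this
  have hd : ∀ y, HasDerivAt (fun y => g (s + y) - y * h s) (h (s + y) - h s) y := fun y => by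
    have h1 := (S.deriv_g (s + y)).comp_const_add s y
    have h2 := (hasDerivAt_id y).mul_const (h s)
    exact HasDerivAt.congr_deriv (h1.sub h2) (by simp)
  have hconv : Convex ℝ (Set.Icc (-|τ|) |τ|) := convex_Icc _ _
  have := hconv.norm_image_sub_le_of_norm_hasDerivWithin_le (C := B * |τ|)
    (fun x _ => (hd x).hasDerivWithinAt)
    (fun x hx => (hlip x).trans (mul_le_mul_of_nonneg_left (abs_le.2 hx) S.B_nonneg))
    (show (0 : ℝ) ∈ _ from ⟨by simp, by simp⟩) (show τ ∈ _ from ⟨neg_abs_le τ, le_abs_self τ⟩)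
  simp only [add_zero, zero_mul, sub_zero, Real.norm_eq_abs] at this
  calc _ = |g (s + τ) - τ * h s - g s| := by ring_nf
    _ ≤ B * |τ| * |τ| := this
    _ = B * τ ^ 2 := by rw [mul_assoc, abs_mul_abs_self, sq]

end SmoothStep

/-! ### Radial functions -/

/-- `1 + |x|² = ⟨x⟩²`. -/
noncomputable def rad (x : Conf n) : ℝ := 1 + ‖x‖ ^ 2

theorem one_le_rad (x : Conf n) : 1 ≤ rad x := le_add_of_nonneg_right (sq_nonneg _)

theorem rad_pos (x : Conf n) : 0 < rad x := zero_lt_one.trans_le (one_le_rad x)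

theorem continuous_rad : Continuous (rad (n := n)) := by
  unfold rad
  fun_prop

theorem sum_coord_sq (x : Conf n) : ∑ i, x i ^ 2 = ‖x‖ ^ 2 := by
  rw [EuclideanSpace.norm_sq_eq]
  simp

theorem continuous_coord (i : Fin n) : Continuous fun x : Conf n => x i := by fun_prop

theorem hasLineDerivAt_coord (i : Fin n) (x : Conf n) :
    HasLineDerivAt ℝ (fun y : Conf n => y i) 1 x (basisVec i) := by
  unfold HasLineDerivAt
  have : (fun t : ℝ => (x + t • basisVec i) i) = fun t => x i + t := by
    ext t
    simp
  rw [this]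
  exact (hasDerivAt_id _).const_add _

theorem hasLineDerivAt_rad (i : Fin n) (x : Conf n) :
    HasLineDerivAt ℝ rad (2 * x i) x (basisVec i) := by
  unfold HasLineDerivAt
  have : (fun t : ℝ => rad (x + t • basisVec i)) = fun t => rad x + 2 * x i * t + t ^ 2 := by
    ext t
    have hin : inner ℝ x (basisVec i) = x i := by
      rw [real_inner_comm, basisVec, EuclideanSpace.basisFun_apply, EuclideanSpace.inner_single_left]
      simp
    have hn : ‖basisVec i‖ = 1 := by simp
    rw [rad, rad, norm_add_sq_real, norm_smul, inner_smul_right, hin, hn, Real.norm_eq_abs,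
      mul_one, sq_abs]
    ring
  rw [this]
  have h1 := (((hasDerivAt_id (0 : ℝ)).const_mul (2 * x i)).const_add (rad x)).add
    ((hasDerivAt_id (0 : ℝ)).pow 2)
  exact HasDerivAt.congr_deriv h1 (by simp)

theorem hasLineDerivAt_comp_rad {L : ℝ → ℝ} {L' : ℝ} (i : Fin n) (x : Conf n)
    (h : HasDerivAt L L' (rad x)) :
    HasLineDerivAt ℝ (fun y => L (rad y)) (2 * x i * L') x (basisVec i) := by
  have h0 : rad (x + (0 : ℝ) • basisVec i) = rad x := by simp
  have := HasDerivAt.comp (0 : ℝ) (h₂ := L) (by rw [h0]; exact h) (hasLineDerivAt_rad i x)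
  rw [mul_comm]
  exact this

theorem continuous_comp_rad {L : ℝ → ℝ} (h : ContinuousOn L (Set.Ioi 0)) :
    Continuous fun x : Conf n => L (rad x) :=
  h.comp_continuous continuous_rad fun x => rad_pos x

/-- Using `r = 1 + |x|² ≥ 1` as radial variable avoids the singularity of `|x|` at the origin and
makes all coordinate derivatives explicit; the profiles need only be differentiable on `(0, ∞)`. -/
theorem formData_radial {Γ Γ' L L' L'' : ℝ → ℝ} (hΓ : ∀ r, 0 < r → HasDerivAt Γ (Γ' r) r)
    (hΓ' : ContinuousOn Γ' (Set.Ioi 0)) (hL : ∀ r, 0 < r → HasDerivAt L (L' r) r)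
    (hL' : ∀ r, 0 < r → HasDerivAt L' (L'' r) r) (hL'' : ContinuousOn L'' (Set.Ioi 0)) :
    FormData (n := n) (fun x => Γ (rad x)) (fun x => L (rad x)) (fun i x => 2 * x i * Γ' (rad x))
      (fun i x => 2 * x i * L' (rad x))
      (fun i x => 2 * L' (rad x) + 4 * x i ^ 2 * L'' (rad x)) := by
  have cΓ : ContinuousOn Γ (Set.Ioi 0) := fun r hr => (hΓ r hr).continuousAt.continuousWithinAt
  have cL : ContinuousOn L (Set.Ioi 0) := fun r hr => (hL r hr).continuousAt.continuousWithinAt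
  have cL' : ContinuousOn L' (Set.Ioi 0) := fun r hr => (hL' r hr).continuousAt.continuousWithinAt
  refine ⟨continuous_comp_rad cΓ, fun i => (continuous_const.mul (continuous_coord i)).mul
      (continuous_comp_rad hΓ'), fun i x => hasLineDerivAt_comp_rad i x (hΓ _ (rad_pos x)),
    continuous_comp_rad cL, fun i => (continuous_const.mul (continuous_coord i)).mul
      (continuous_comp_rad cL'), fun i => (continuous_const.mul (continuous_comp_rad cL')).add
      ((continuous_const.mul ((continuous_coord i).pow 2)).mul (continuous_comp_rad hL'')),
    fun i x => hasLineDerivAt_comp_rad i x (hL _ (rad_pos x)), fun i x => ?_⟩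
  have h1 := (HasDerivAt.const_mul 2 (hasLineDerivAt_coord i x)).mul
    (hasLineDerivAt_comp_rad i x (hL' _ (rad_pos x)))
  refine HasDerivAt.congr_deriv h1 ?_
  simp only [zero_smul, add_zero]
  ring

theorem sum_radial (x : Conf n) (a b : ℝ) :
    ∑ i, (2 * a + 4 * x i ^ 2 * b) = 2 * n * a + 4 * ‖x‖ ^ 2 * b := by
  have h : ∑ i, 4 * x i ^ 2 * b = 4 * ‖x‖ ^ 2 * b := by
    rw [← sum_coord_sq, Finset.mul_sum, Finset.sum_mul]
  rw [Finset.sum_add_distrib, h]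
  simp
  ring

end Repulsive

namespace Repulsive

/-! ### A criterion for essential self-adjointness -/

section Criterion

variable {E : Type*} [NormedAddCommGroup E] [InnerProductSpace ℂ E]

/-- Polarization: the quadratic identity at `x + y` and at `x + iy` determines the sesquilinear
form. -/
theorem inner_symm_of_im_eq_zero {T : E →ₗ.[ℂ] E}
    (hT : ∀ x : T.domain, (inner ℂ (T x) (x : E)).im = 0) : T.IsFormalAdjoint T := by
  have hB : ∀ x : T.domain, inner ℂ (T x) (x : E) = inner ℂ (x : E) (T x) := fun x => by
    rw [← inner_conj_symm (x : E)]
    exact (Complex.conj_eq_iff_im.2 (hT x)).symm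
  intro x y
  have h1 := hB (x + y)
  have h2 := hB (x + Complex.I • y)
  have hx := hB x
  have hy := hB y
  simp only [LinearPMap.map_add, LinearPMap.map_smul, Submodule.coe_add, Submodule.coe_smul,
    inner_add_left, inner_add_right, inner_smul_left, inner_smul_right, Complex.conj_I] at h1 h2
  have hI := Complex.I_sq
  linear_combination (1 / 2 : ℂ) * h1 - (Complex.I / 2) * h2 + (Complex.I / 2 - 1 / 2) * hx
    + ((-1 / 2 : ℂ) - Complex.I * Complex.I * Complex.I / 2) * hy
    + ((1 / 2) * inner ℂ (T x) (y : E) - (1 / 2) * inner ℂ (x : E) (T y)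
      - (1 / 2) * inner ℂ (T y) (x : E) + (1 / 2) * inner ℂ (y : E) (T x)) * hI

theorem norm_le_norm_add_I_smul {u v : E} (h : (inner ℂ v u).im = 0) :
    ‖u‖ ≤ ‖v + Complex.I • u‖ := by
  have h1 := norm_add_sq (𝕜 := ℂ) v (Complex.I • u)
  rw [inner_smul_right, norm_smul, Complex.norm_I, one_mul] at h1
  have h0 : RCLike.re (Complex.I * inner ℂ v u) = 0 := by
    change (Complex.I * inner ℂ v u).re = 0
    rw [Complex.I_mul_re, h, neg_zero]
  rw [h0] at h1
  refine le_of_sq_le_sq ?_ (norm_nonneg _)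
  nlinarith [sq_nonneg ‖v‖]

/-- A symmetric densely defined operator with trivial deficiency spaces has a self-adjoint
closure. -/
theorem isSelfAdjoint_closure [CompleteSpace E] {T : E →ₗ.[ℂ] E} (hd : Dense (T.domain : Set E))
    (hT : ∀ x : T.domain, (inner ℂ (T x) (x : E)).im = 0)
    (hpos : ∀ w : E, (∀ y : T.domain, inner ℂ w (T y + Complex.I • (y : E)) = 0) → w = 0)
    (hneg : ∀ w : E, (∀ y : T.domain, inner ℂ w (T y - Complex.I • (y : E)) = 0) → w = 0) :
    IsSelfAdjoint T.closure := by
  have hs := inner_symm_of_im_eq_zero hT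
  have hTle : T ≤ T.adjoint := hs.le_adjoint hd
  have hadjcl : T.adjoint.IsClosed := LinearPMap.adjoint_isClosed hd
  have hcl : T.IsClosable := hadjcl.isClosable.leIsClosable hTle
  have hg : (T.closure.graph : Set (E × E)) = closure (T.graph : Set (E × E)) := by
    rw [← hcl.graph_closure_eq_closure_graph, Submodule.topologicalClosure_coe]
  have hmem : ∀ p : E × E, p ∈ T.adjoint.graph ↔
      ∀ y : T.domain, inner ℂ (T y) p.1 = inner ℂ (y : E) p.2 := fun p => by
    rw [LinearPMap.adjoint_graph_eq_graph_adjoint hd, Submodule.mem_adjoint_iff]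
    refine ⟨fun h y => sub_eq_zero.1 (h _ _ (LinearPMap.mem_graph T y)), fun h a b hab => ?_⟩
    obtain ⟨y, rfl, rfl⟩ := (LinearPMap.mem_graph_iff _).1 hab
    exact sub_eq_zero.2 (h y)
  have hle : T.closure.graph ≤ T.adjoint.graph := fun p hp => by
    have hp' : p ∈ closure (T.graph : Set (E × E)) := hg ▸ hp
    exact closure_minimal (LinearPMap.le_graph_of_le hTle) hadjcl hp'
  have hbd : ∀ y : T.domain, ‖(y : E)‖ ≤ ‖T y + Complex.I • (y : E)‖ := fun y =>
    norm_le_norm_add_I_smul (hT y)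
  let K : T.domain →ₗ[ℂ] E := T.toFun + Complex.I • T.domain.subtype
  have hK : ∀ y, K y = T y + Complex.I • (y : E) := fun y => rfl
  have hdense : Dense (LinearMap.range K : Set E) := by
    rw [Submodule.dense_iff_topologicalClosure_eq_top, Submodule.topologicalClosure_eq_top_iff,
      Submodule.eq_bot_iff]
    intro w hw
    refine hpos w fun y => ?_
    rw [Submodule.mem_orthogonal] at hw
    rw [← inner_conj_symm, ← hK, hw _ ⟨y, rfl⟩, map_zero]
  -- Density of the range of `T + i` and the lower bound `‖(T + i)y‖ ≥ ‖y‖` give `u` with `(T̄ + i)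
  -- u = p.2 + i p.1`. Then `p.1 - u` lies in the kernel of `T* + i`, which `hneg` makes trivial.
  have hge : T.adjoint.graph ≤ T.closure.graph := fun p hp => by
    obtain ⟨w, hw, hlim⟩ := mem_closure_iff_seq_limit.1 (hdense (p.2 + Complex.I • p.1))
    choose y hy using hw
    have hc : CauchySeq fun k => (y k : E) := by
      have hc' := hlim.cauchySeq
      rw [Metric.cauchySeq_iff] at hc' ⊢
      intro ε hε
      obtain ⟨N, hN⟩ := hc' ε hε
      refine ⟨N, fun m hm k hk => lt_of_le_of_lt ?_ (hN m hm k hk)⟩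
      rw [dist_eq_norm, dist_eq_norm, ← hy m, ← hy k, ← map_sub]
      exact hbd (y m - y k)
    obtain ⟨u, hu⟩ := cauchySeq_tendsto_of_complete hc
    have hq : (u, p.2 + Complex.I • p.1 - Complex.I • u) ∈ T.closure.graph := by
      change _ ∈ (T.closure.graph : Set (E × E))
      rw [hg]
      refine mem_closure_of_tendsto (f := fun k => ((y k : E), w k - Complex.I • (y k : E)))
        (hu.prodMk_nhds (hlim.sub (hu.const_smul Complex.I))) (Eventually.of_forall fun k => ?_)
      have : w k - Complex.I • (y k : E) = T (y k) := by
        rw [← hy k, hK]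
        abel
      simp only [this]
      exact LinearPMap.mem_graph T (y k)
    have hd0 : p.1 - u = 0 := by
      refine hneg _ fun y => ?_
      have h1 := (hmem p).1 hp y
      have h2 := (hmem _).1 (hle hq) y
      simp only [inner_sub_right, inner_add_right, inner_smul_right] at h2
      rw [← inner_conj_symm, inner_sub_left, inner_sub_right, inner_sub_right, inner_smul_left,
        inner_smul_left, h1, h2, Complex.conj_I]
      exact (map_eq_zero _).2 (by ring)
    rw [sub_eq_zero] at hd0
    have : p = (u, p.2 + Complex.I • p.1 - Complex.I • u) := by
      rw [← hd0, add_sub_cancel_right]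
    rw [this]
    exact hq
  have hdc : Dense (T.closure.domain : Set E) := hd.mono (LinearPMap.le_closure T).1
  refine LinearPMap.isSelfAdjoint_def.2 (LinearPMap.eq_of_eq_graph ?_)
  refine le_antisymm (fun p hp => hge ((hmem p).2 fun y => ?_)) fun p hp => ?_
  · rw [LinearPMap.adjoint_graph_eq_graph_adjoint hdc, Submodule.mem_adjoint_iff] at hp
    exact sub_eq_zero.1 (hp _ _ (LinearPMap.le_graph_of_le (LinearPMap.le_closure T)
      (LinearPMap.mem_graph T y)))
  · rw [LinearPMap.adjoint_graph_eq_graph_adjoint hdc, Submodule.mem_adjoint_iff]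
    intro a b hab
    have hcl' : _root_.IsClosed {q : E × E | inner ℂ q.2 p.1 - inner ℂ q.1 p.2 = 0} :=
      isClosed_eq ((continuous_snd.inner continuous_const).sub
        (continuous_fst.inner continuous_const)) continuous_const
    have hsub := closure_minimal (s := (T.graph : Set (E × E))) (fun q hq => by
      obtain ⟨y, h1, h2⟩ := (LinearPMap.mem_graph_iff _).1 hq
      rw [Set.mem_ofPred_eq, ← h1, ← h2]
      exact sub_eq_zero.2 ((hmem p).1 (hle hp) y)) hcl'
    have hab' : (a, b) ∈ closure (T.graph : Set (E × E)) := hg ▸ hab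
    exact hsub hab'

end Criterion

end Repulsive

namespace Repulsive

variable {n : ℕ}

/-! ### Mollification -/

/-- The convolution `∫ v(t) η(x - t) dt`. -/
noncomputable def moll (v η : Conf n → ℂ) : Conf n → ℂ :=
  convolution v η (ContinuousLinearMap.mul ℝ ℂ) volume

theorem moll_apply (v η : Conf n → ℂ) (x : Conf n) : moll v η x = ∫ t, v t * η (x - t) := rfl

section Smooth

variable {v η : Conf n → ℂ}

theorem contDiff_moll (hv : LocallyIntegrable v) (hη : IsTest η) : ContDiff ℝ ∞ (moll v η) :=
  hη.2.contDiff_convolution_right (n := ⊤) _ hv hη.1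

theorem IsTest.pderiv (hη : IsTest η) (i : Fin n) : IsTest (pderiv i η) :=
  ⟨ContDiff.pderiv hη.1 i, hη.2.mono' ((subset_tsupport _).trans (tsupport_pderiv_subset η i))⟩

theorem pderiv_moll (hv : LocallyIntegrable v) (hη : IsTest η) (i : Fin n) :
    pderiv i (moll v η) = moll v (pderiv i η) := by
  ext x
  have h1 : ContDiff ℝ 1 η := hη.1.of_le (by simp)
  have h := hη.2.hasFDerivAt_convolution_right (ContinuousLinearMap.mul ℝ ℂ) hv h1 x
  rw [pderiv, moll, h.fderiv, convolution_precompR_apply _ hv (hη.2.fderiv ℝ)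
    (h1.continuous_fderiv one_ne_zero)]
  rfl

theorem integrable_mul_test (hv : LocallyIntegrable v) {φ : Conf n → ℂ} (hφ : Continuous φ)
    (hs : HasCompactSupport φ) : Integrable fun t => v t * φ t := by
  have := hv.integrable_smul_right_of_hasCompactSupport hφ hs
  simpa using this

theorem pderiv_comp_sub (hη : ContDiff ℝ ∞ η) (x : Conf n) (i : Fin n) :
    pderiv i (fun t => η (x - t)) = fun t => -pderiv i η (x - t) := by
  ext t
  have h := ((hη.differentiable (by simp)) (x - t)).hasFDerivAt.comp t
    ((hasFDerivAt_id t).const_sub x)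
  rw [pderiv, HasFDerivAt.fderiv (f := fun t => η (x - t)) h]
  simp [pderiv]

theorem IsTest.comp_sub (hη : IsTest η) (x : Conf n) : IsTest fun t => η (x - t) :=
  ⟨hη.1.comp (contDiff_const.sub contDiff_id),
    hη.2.comp_homeomorph (Homeomorph.subLeft x)⟩

theorem IsTest.laplacian (hη : IsTest η) : IsTest (Δ η) := by
  have : Δ η = fun x => ∑ i, Repulsive.pderiv i (Repulsive.pderiv i η) x :=
    funext (laplacian_eq_sum_pderiv hη.1)
  refine ⟨this ▸ ContDiff.sum fun i _ => ((hη.pderiv i).pderiv i).1,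
    HasCompactSupport.intro hη.2 fun x hx => ?_⟩
  rw [this]
  exact Finset.sum_eq_zero fun i _ =>
    pderiv_eq_zero (fun h => hx (tsupport_pderiv_subset η i h)) i

theorem laplacian_comp_sub (hη : ContDiff ℝ ∞ η) (x t : Conf n) :
    Δ (fun t => η (x - t)) t = Δ η (x - t) := by
  have hc : ContDiff ℝ ∞ fun t => η (x - t) := hη.comp (contDiff_const.sub contDiff_id)
  rw [laplacian_eq_sum_pderiv hc, laplacian_eq_sum_pderiv hη]
  refine Finset.sum_congr rfl fun i _ => ?_
  rw [pderiv_comp_sub hη]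
  have h2 := congrFun (pderiv_comp_sub (ContDiff.pderiv hη i) x i) t
  have h3 : pderiv i (fun t => -pderiv i η (x - t)) t = -pderiv i (fun t => pderiv i η (x - t)) t := by
    simp only [pderiv]
    rw [fderiv_fun_neg]
    rfl
  rw [h3, h2, neg_neg]

theorem laplacian_moll (hv : LocallyIntegrable v) (hη : IsTest η) (x : Conf n) :
    Δ (moll v η) x = ∫ t, v t * Δ (fun t => η (x - t)) t := by
  rw [laplacian_eq_sum_pderiv (contDiff_moll hv hη)]
  simp only [pderiv_moll hv hη, pderiv_moll hv (hη.pderiv _), moll_apply,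
    laplacian_comp_sub hη.1, laplacian_eq_sum_pderiv hη.1, Finset.mul_sum]
  refine (integral_finsetSum _ fun i _ => ?_).symm
  have := ((hη.pderiv i).pderiv i).comp_sub x
  exact integrable_mul_test hv this.1.continuous this.2

end Smooth

/-! ### Bounds for averages -/

/-- Jensen's inequality for the square, read off from the nonnegativity of the variance. -/
theorem sq_integral_mul_le {w f : Conf n → ℝ} (hw0 : ∀ x, 0 ≤ w x) (hw : Integrable w)
    (hw1 : ∫ x, w x = 1) (hf : Integrable fun x => f x * w x)
    (hf2 : Integrable fun x => f x ^ 2 * w x) :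
    (∫ x, f x * w x) ^ 2 ≤ ∫ x, f x ^ 2 * w x := by
  set m := ∫ x, f x * w x with hm
  have h : 0 ≤ ∫ x, (f x - m) ^ 2 * w x := integral_nonneg fun x => mul_nonneg (sq_nonneg _) (hw0 x)
  have i1 := hf.const_mul (2 * m)
  have i2 := hw.const_mul (m ^ 2)
  have e : ∫ x, (f x - m) ^ 2 * w x = (∫ x, f x ^ 2 * w x) - 2 * m * m + m ^ 2 * 1 := by
    calc ∫ x, (f x - m) ^ 2 * w x
        = ∫ x, (f x ^ 2 * w x - 2 * m * (f x * w x) + m ^ 2 * w x) := by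
          refine integral_congr_ae (ae_of_all _ fun x => ?_)
          simp only
          ring
      _ = (∫ x, (f x ^ 2 * w x - 2 * m * (f x * w x))) + ∫ x, m ^ 2 * w x :=
          integral_add (hf2.sub i1) i2
      _ = _ := by
          rw [integral_sub hf2 i1, integral_const_mul, integral_const_mul, hw1]
  rw [e] at h
  linarith

/-- Smooth probability densities supported in the ball of radius `ε`. -/
structure IsMollifier (κ : Conf n → ℝ) (ε : ℝ) : Prop where
  smooth : ContDiff ℝ ∞ κ
  compact : HasCompactSupport κ
  nonneg : ∀ x, 0 ≤ κ x
  integral_eq_one : ∫ x, κ x = 1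
  eq_zero : ∀ x, ε ≤ ‖x‖ → κ x = 0

/-- The average `∫ q(t) κ(x - t) dt`. -/
noncomputable def avg (κ q : Conf n → ℝ) : Conf n → ℝ :=
  convolution q κ (ContinuousLinearMap.mul ℝ ℝ) volume

namespace IsMollifier

variable {κ : Conf n → ℝ} {ε : ℝ} (hκ : IsMollifier κ ε)
include hκ

theorem isTest : IsTest fun x => (κ x : ℂ) :=
  ⟨Complex.ofRealCLM.contDiff.comp hκ.smooth, hκ.compact.comp_left Complex.ofReal_zero⟩

theorem integrable : Integrable κ := hκ.smooth.continuous.integrable_of_hasCompactSupport hκ.compact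

theorem integrable_avg {q : Conf n → ℝ} (hq : Integrable q) : Integrable (avg κ q) :=
  hq.integrable_convolution _ hκ.integrable

theorem integral_avg {q : Conf n → ℝ} (hq : Integrable q) : ∫ x, avg κ q x = ∫ x, q x := by
  have := integral_convolution (ContinuousLinearMap.mul ℝ ℝ) (μ := (volume : Measure (Conf n)))
    (ν := volume) hq hκ.integrable
  rw [hκ.integral_eq_one] at this
  exact this.trans (by simp)

theorem avg_nonneg {q : Conf n → ℝ} (hq : ∀ x, 0 ≤ q x) (x : Conf n) : 0 ≤ avg κ q x :=
  integral_nonneg fun t => mul_nonneg (hq t) (hκ.nonneg _)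

theorem integrable_mul {q : Conf n → ℝ} (hq : LocallyIntegrable q) (x : Conf n) :
    Integrable fun t => q t * κ (x - t) := by
  have := hq.integrable_smul_right_of_hasCompactSupport
    (hκ.smooth.continuous.comp (continuous_const.sub continuous_id))
    (hκ.compact.comp_homeomorph (Homeomorph.subLeft x))
  simpa using this

/-- One bound for two purposes: `c = 1` controls the mollified function, and `c(t) = W(t) - W(x)`
controls the error made by mollifying the equation. -/
theorem norm_integral_sq_le {v : Conf n → ℂ} (hv : MemLp v 2) {c : Conf n → ℝ} {δ : ℝ} (x : Conf n)
    (hc : ∀ t, ‖x - t‖ < ε → |c t| ≤ δ) :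
    ‖∫ t, v t * ((c t * κ (x - t) : ℝ) : ℂ)‖ ^ 2 ≤ δ ^ 2 * avg κ (fun t => ‖v t‖ ^ 2) x := by
  have hl : LocallyIntegrable fun t => ‖v t‖ := hv.norm.locallyIntegrable (by norm_num)
  have hl2 : LocallyIntegrable fun t => ‖v t‖ ^ 2 := (hv.norm.integrable_sq).locallyIntegrable
  have h1 : ‖∫ t, v t * ((c t * κ (x - t) : ℝ) : ℂ)‖ ≤ δ * ∫ t, ‖v t‖ * κ (x - t) := by
    rw [← integral_const_mul]
    refine norm_integral_le_of_norm_le ((hκ.integrable_mul hl x).const_mul δ)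
      (ae_of_all _ fun t => ?_)
    rw [norm_mul, Complex.norm_real, Real.norm_eq_abs, abs_mul, abs_of_nonneg (hκ.nonneg _)]
    by_cases ht : ‖x - t‖ < ε
    · calc _ ≤ ‖v t‖ * (δ * κ (x - t)) := by
            gcongr
            · exact hκ.nonneg _
            · exact hc t ht
        _ = _ := by ring
    · rw [hκ.eq_zero _ (not_lt.1 ht)]
      simp
  have hw : Integrable fun t => κ (x - t) := hκ.integrable.comp_sub_left x
  have hw1 : ∫ t, κ (x - t) = 1 := by rw [integral_sub_left_eq_self, hκ.integral_eq_one]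
  calc _ ≤ (δ * ∫ t, ‖v t‖ * κ (x - t)) ^ 2 := by gcongr
    _ ≤ _ := by
      rw [mul_pow]
      exact mul_le_mul_of_nonneg_left (sq_integral_mul_le (fun t => hκ.nonneg _) hw hw1
        (hκ.integrable_mul hl x) (hκ.integrable_mul hl2 x)) (sq_nonneg _)

theorem norm_moll_sq_le {v : Conf n → ℂ} (hv : MemLp v 2) (x : Conf n) :
    ‖moll v (fun x => (κ x : ℂ)) x‖ ^ 2 ≤ avg κ (fun t => ‖v t‖ ^ 2) x := by
  have := hκ.norm_integral_sq_le hv (c := fun _ => 1) (δ := 1) x (fun t _ => by simp)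
  simpa [moll_apply] using this

/-- The equation satisfied by a mollified weak solution of `(-Δ + W + i) v = 0`. -/
theorem norm_laplacian_moll_sub_sq_le {v : Conf n → ℂ} (hv : MemLp v 2) {W : Conf n → ℝ}
    (hW : Continuous W)
    (hweak : ∀ φ, IsTest φ → ∫ t, v t * (schrodingerExpr W φ t + Complex.I * φ t) = 0) {δ : ℝ}
    (x : Conf n) (hc : ∀ t, ‖x - t‖ < ε → |W t - W x| ≤ δ) :
    ‖Δ (moll v fun x => (κ x : ℂ)) x - (W x + Complex.I) * moll v (fun x => (κ x : ℂ)) x‖ ^ 2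
      ≤ δ ^ 2 * avg κ (fun t => ‖v t‖ ^ 2) x := by
  have hl := hv.locallyIntegrable (by norm_num)
  have hφ := hκ.isTest.comp_sub x
  set φ : Conf n → ℂ := fun t => (κ (x - t) : ℂ)
  have i0 : ∀ {ψ : Conf n → ℂ}, Continuous ψ → Integrable fun t => v t * (ψ t * φ t) := fun hψ =>
    integrable_mul_test hl (hψ.mul hφ.1.continuous) hφ.2.mul_left
  have i1 := integrable_mul_test hl hφ.laplacian.1.continuous hφ.laplacian.2
  have hWc : Continuous fun t => (W t : ℂ) := Complex.continuous_ofReal.comp hW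
  -- Testing the weak equation with `κ(x - ·)` leaves only the commutator of `W` with the mollifier.
  have e : Δ (moll v fun x => (κ x : ℂ)) x - (W x + Complex.I) * moll v (fun x => (κ x : ℂ)) x
      = ∫ t, v t * (((W t - W x) * κ (x - t) : ℝ) : ℂ) := by
    have h1 := hweak φ hφ
    have h2 : ∫ t, v t * (schrodingerExpr W φ t + Complex.I * φ t)
        = -(∫ t, v t * Δ φ t) + ((∫ t, v t * (((W t : ℂ) - W x) * φ t))
          + ∫ t, v t * ((W x + Complex.I) * φ t)) := by
      have j1 : Integrable fun t => v t * (((W t : ℂ) - W x) * φ t) := i0 (hWc.sub continuous_const)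
      have j2 : Integrable fun t => v t * ((W x + Complex.I) * φ t) := i0 continuous_const
      rw [← integral_neg, ← integral_add j1 j2]
      refine Eq.trans ?_ (integral_add i1.neg (j1.add j2))
      refine integral_congr_ae (ae_of_all _ fun t => ?_)
      simp only [schrodingerExpr]
      ring
    rw [laplacian_moll hl hκ.isTest, moll_apply, ← integral_const_mul]
    have h3 : ∫ t, (W x + Complex.I) * (v t * (κ (x - t) : ℂ))
        = ∫ t, v t * ((W x + Complex.I) * φ t) :=
      integral_congr_ae (ae_of_all _ fun t => by simp only [φ]; ring)
    have h4 : ∫ t, v t * (((W t - W x) * κ (x - t) : ℝ) : ℂ)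
        = ∫ t, v t * (((W t : ℂ) - W x) * φ t) :=
      integral_congr_ae (ae_of_all _ fun t => by simp only [φ]; push_cast; ring)
    rw [h3, h4]
    linear_combination h2 - h1
  rw [e]
  exact hκ.norm_integral_sq_le hv x hc

end IsMollifier

end Repulsive

namespace Repulsive

variable {n : ℕ}

/-! ### Localized energy estimate -/

/-- The pointwise arithmetic of the localized estimate: `U = |u|²`, `M` and `Q` are averages of
`|v|²` and of its tail, `H` is the squared derivative of the step, and `dre`, `dim` are the parts of
`conj(Δu) u`. The form parameter is `λs`: in the first term the `s` cancels the factor `1/s` of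
`|∇G|²`, and in the second the factor `(λs)⁻¹` compensates the growth `-W ≤ 3cs` on the support. -/
theorem localized_form_le {s lam H U M Q b c δ S₂ l w Γ dre dim r₁ r₂ β : ℝ} (hs : 1 ≤ s)
    (hlam : 0 < lam) (hb : 0 ≤ b) (hc : 0 ≤ c) (hδ1 : δ ≤ 1) (h1 : H * U ≤ β * Q) (hU : U ≤ M)
    (hS : |S₂| ≤ 2 * b) (hl0 : 0 ≤ l) (hl1 : l ≤ 1) (hΓ0 : 0 ≤ Γ) (hΓ1 : Γ ≤ 1) (hU0 : 0 ≤ U)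
    (hw : -(3 * c * s) ≤ w) (hr₁ : |r₁| ≤ δ * M) (hr₂ : |r₂| ≤ δ * M) (hre : dre = w * U + r₁)
    (him : dim = -U + r₂) :
    lam * s * (8 / s * H) * U + (lam * s)⁻¹ * (S₂ / 2 * U - l * dre) + 2 * Γ * dim
      ≤ 8 * β * lam * Q + (lam⁻¹ * (b + 3 * c + 1) + 2 * δ) * M - 2 * (Γ * U) := by
  have hs0 : 0 < s := zero_lt_one.trans_le hs
  have hM0 : 0 ≤ M := hU0.trans hU
  have hr0 : 0 ≤ δ * M := (abs_nonneg _).trans hr₁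
  rw [abs_le] at hS hr₁ hr₂
  have t1 : lam * s * (8 / s * H) * U ≤ 8 * β * lam * Q := by
    have : lam * s * (8 / s * H) * U = 8 * lam * (H * U) := by
      field_simp
    rw [this]
    calc _ ≤ 8 * lam * (β * Q) := by gcongr
      _ = _ := by ring
  have t2 : S₂ / 2 * U - l * dre ≤ s * ((b + 3 * c + 1) * M) := by
    have a1 : S₂ / 2 * U ≤ b * M := mul_le_mul (by linarith) hU hU0 hb
    have a2 : -(l * (w * U)) ≤ 3 * c * s * M := by
      have : -w * U ≤ 3 * c * s * M := mul_le_mul (by linarith) hU hU0 (by positivity)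
      rcases le_total 0 (-w * U) with h | h
      · nlinarith
      · have : 0 ≤ 3 * c * s * M := by positivity
        nlinarith
    have a3 : -(l * r₁) ≤ M := by
      have : δ * M ≤ M := mul_le_of_le_one_left hM0 hδ1
      nlinarith
    have a4 : b * M ≤ s * (b * M) := le_mul_of_one_le_left (mul_nonneg hb hM0) hs
    have a5 : M ≤ s * M := le_mul_of_one_le_left hM0 hs
    rw [hre]
    linarith
  have t3 : (lam * s)⁻¹ * (S₂ / 2 * U - l * dre) ≤ lam⁻¹ * (b + 3 * c + 1) * M := by
    calc _ ≤ (lam * s)⁻¹ * (s * ((b + 3 * c + 1) * M)) := by gcongr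
      _ = _ := by field_simp
  have t4 : 2 * Γ * dim ≤ 2 * δ * M - 2 * (Γ * U) := by
    have : Γ * r₂ ≤ δ * M := by nlinarith
    rw [him]
    linarith
  linarith

/-! ### Cutoffs at radius `⟨x⟩² ~ s` and the energy estimate for weak solutions. -/

section Cutoff

variable {g h h₁ h₂ : ℝ → ℝ} {B : ℝ} (S : SmoothStep g h h₁ h₂ B)
include S

theorem SmoothStep.h_eq_zero_of_one_lt {r : ℝ} (hr : 1 < r) : h r = 0 := by
  have h1 : g =ᶠ[𝓝 r] fun _ => 1 := by
    filter_upwards [lt_mem_nhds hr] with y hy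
    exact S.g_one y hy.le
  exact (S.deriv_g r).unique ((hasDerivAt_const r (1 : ℝ)).congr_of_eventuallyEq h1)

theorem SmoothStep.h₁_eq_zero_of_one_lt {r : ℝ} (hr : 1 < r) : h₁ r = 0 := by
  have h1 : h =ᶠ[𝓝 r] fun _ => 0 := by
    filter_upwards [lt_mem_nhds hr] with y hy
    exact S.h_eq_zero_of_one_lt hy
  exact (S.deriv_h r).unique ((hasDerivAt_const r (0 : ℝ)).congr_of_eventuallyEq h1)

/-- Two nested cutoffs: `G` descends for `s ≤ ⟨x⟩² ≤ 2s` and `l` for `2s ≤ ⟨x⟩² ≤ 3s`, so `l = 1` on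
the support of `∇G`, as `|∇G|² ≤ k l` requires. -/
theorem formData_cutoff (s : ℝ) :
    FormData (n := n) (fun x => 1 - g (rad x / s - 1)) (fun x => 1 - g (rad x / s - 2))
      (fun i x => 2 * x i * (-(h (rad x / s - 1) / s))) (fun i x => 2 * x i * (-(h (rad x / s - 2) / s)))
      (fun i x => 2 * (-(h (rad x / s - 2) / s)) + 4 * x i ^ 2 * (-(h₁ (rad x / s - 2) / s ^ 2))) := by
  have hd : ∀ (a r : ℝ), HasDerivAt (fun r : ℝ => r / s - a) (1 / s) r := fun a r =>
    ((hasDerivAt_id r).div_const s).sub_const a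
  have hg : ∀ a r : ℝ, HasDerivAt (fun r => 1 - g (r / s - a)) (-(h (r / s - a) / s)) r :=
    fun a r => HasDerivAt.congr_deriv (((S.deriv_g _).comp r (hd a r)).const_sub 1) (by ring)
  have hh : ∀ a r : ℝ, HasDerivAt (fun r => -(h (r / s - a) / s)) (-(h₁ (r / s - a) / s ^ 2)) r :=
    fun a r => HasDerivAt.congr_deriv (((S.deriv_h _).comp r (hd a r)).div_const s).neg (by ring)
  have ch := S.cont_h
  have ch₁ := S.cont_h₁
  exact formData_radial (Γ := fun r => 1 - g (r / s - 1)) (Γ' := fun r => -(h (r / s - 1) / s))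
    (L := fun r => 1 - g (r / s - 2)) (L' := fun r => -(h (r / s - 2) / s))
    (L'' := fun r => -(h₁ (r / s - 2) / s ^ 2)) (fun r _ => hg 1 r)
    (by fun_prop) (fun r _ => hg 2 r) (fun r _ => hh 2 r) (by fun_prop)

theorem abs_sum_cutoff_le {s : ℝ} (hs : 1 ≤ s) (x : Conf n) :
    |∑ i, (2 * (-(h (rad x / s - 2) / s)) + 4 * x i ^ 2 * (-(h₁ (rad x / s - 2) / s ^ 2)))|
      ≤ 2 * ((n + 6) * B) := by
  have hB := S.B_nonneg
  have hs0 : 0 < s := zero_lt_one.trans_le hs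
  rw [sum_radial]
  by_cases hx : 1 < rad x / s - 2
  · rw [S.h_eq_zero_of_one_lt hx, S.h₁_eq_zero_of_one_lt hx]
    simp only [zero_div, neg_zero, mul_zero, add_zero, abs_zero]
    positivity
  · have hr : ‖x‖ ^ 2 ≤ 3 * s := by
      have : rad x ≤ 3 * s := by
        rw [not_lt, sub_le_iff_le_add, div_le_iff₀ hs0] at hx
        linarith
      exact (le_add_of_nonneg_left zero_le_one).trans this
    have e1 : |h (rad x / s - 2) / s| ≤ B := by
      rw [abs_div, abs_of_pos hs0]
      exact (div_le_self (abs_nonneg _) hs).trans (S.h_le _)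
    have e2 : |‖x‖ ^ 2 * (h₁ (rad x / s - 2) / s ^ 2)| ≤ 3 * B := by
      rw [abs_mul, abs_div, abs_of_nonneg (sq_nonneg ‖x‖), abs_of_nonneg (sq_nonneg s), ← mul_div_assoc,
        div_le_iff₀ (by positivity)]
      calc _ ≤ (3 * s) * B := by
            gcongr
            exact S.h₁_le _
        _ ≤ (3 * s) * B * s := le_mul_of_one_le_right (by positivity) hs
        _ = _ := by ring
    have hn : (0 : ℝ) ≤ n := Nat.cast_nonneg n
    rw [abs_le] at e1 e2 ⊢
    constructor <;> nlinarith

theorem sum_sq_cutoff_le {s : ℝ} (hs : 1 ≤ s) (x : Conf n) :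
    ∑ i, (2 * x i * (-(h (rad x / s - 1) / s))) ^ 2
      ≤ 8 / s * h (rad x / s - 1) ^ 2 * (1 - g (rad x / s - 2)) := by
  have hs0 : 0 < s := zero_lt_one.trans_le hs
  have e : ∑ i, (2 * x i * (-(h (rad x / s - 1) / s))) ^ 2
      = 4 * ‖x‖ ^ 2 * (h (rad x / s - 1) / s) ^ 2 := by
    rw [← sum_coord_sq, Finset.mul_sum, Finset.sum_mul]
    exact Finset.sum_congr rfl fun i _ => by ring
  rw [e]
  by_cases hx : 1 < rad x / s - 1
  · rw [S.h_eq_zero_of_one_lt hx]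
    simp
  · rw [not_lt] at hx
    have hr : ‖x‖ ^ 2 ≤ 2 * s := by
      have : rad x ≤ 2 * s := by
        rw [sub_le_iff_le_add, div_le_iff₀ hs0] at hx
        linarith
      exact (le_add_of_nonneg_left zero_le_one).trans this
    rw [S.g_zero _ (by linarith), sub_zero, mul_one, div_pow]
    calc _ ≤ 4 * (2 * s) * (h (rad x / s - 1) ^ 2 / s ^ 2) := by gcongr
      _ = _ := by
        field_simp
        ring

/-- The mollified solution satisfies `Δu = (W + i) u` up to a small error, so `2 G Im(conj(Δu) u)`
is close to `-2 G |u|²` and the form inequality bounds the localized mass. The part coming from `∇G`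
sees only the tail of `v`. -/
theorem two_mul_integral_cutoff_le {s lam : ℝ} (hs : 1 ≤ s) (hlam : 0 < lam) {κ : Conf n → ℝ} {ε : ℝ}
    (hκ : IsMollifier κ ε) (hε : ε ≤ 1) {v : Conf n → ℂ} (hv : MemLp v 2) {W : Conf n → ℝ}
    (hW : Continuous W) {c : ℝ} (hc : 0 ≤ c) (hWc : ∀ x, -(c * rad x) ≤ W x)
    (hweak : ∀ φ, IsTest φ → ∫ t, v t * (schrodingerExpr W φ t + Complex.I * φ t) = 0) {δ : ℝ}
    (hδ0 : 0 ≤ δ) (hδ1 : δ ≤ 1) (hδ : ∀ x t, rad x ≤ 3 * s → ‖x - t‖ < ε → |W t - W x| ≤ δ)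
    {N : ℝ} (hN : ∀ x : Conf n, s ≤ rad x → N + 1 ≤ ‖x‖) :
    Integrable (fun x => (1 - g (rad x / s - 1)) * ‖moll v (fun x => (κ x : ℂ)) x‖ ^ 2) ∧
    2 * ∫ x, (1 - g (rad x / s - 1)) * ‖moll v (fun x => (κ x : ℂ)) x‖ ^ 2
      ≤ 8 * B ^ 2 * lam * (∫ x, {x : Conf n | N ≤ ‖x‖}.indicator (fun x => ‖v x‖ ^ 2) x)
        + (lam⁻¹ * ((n + 6) * B + 3 * c + 1) + 2 * δ) * ∫ x, ‖v x‖ ^ 2 := by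
  have hs0 : 0 < s := zero_lt_one.trans_le hs
  have hB := S.B_nonneg
  set u := moll v fun x => (κ x : ℂ) with hu
  set p : Conf n → ℝ := fun x => ‖v x‖ ^ 2 with hp
  set q := {x : Conf n | N ≤ ‖x‖}.indicator p with hq
  have hpi : Integrable p := hv.norm.integrable_sq
  have hqi : Integrable q := hpi.indicator (measurableSet_le measurable_const measurable_norm)
  have hp0 : ∀ x, 0 ≤ p x := fun x => sq_nonneg _
  have hq0 : ∀ x, 0 ≤ q x := fun x => Set.indicator_nonneg (fun x _ => hp0 x) x
  have hus : ContDiff ℝ ∞ u := contDiff_moll (hv.locallyIntegrable (by norm_num)) hκ.isTest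
  -- The bump makes `u` a test function without altering it where the cutoffs live: `1 + |x|² ≤ 3s`
  -- and `s ≥ 1` force `|x| < 2s`.
  let b : ContDiffBump (0 : Conf n) := ⟨2 * s, 2 * s + 1, by positivity, by linarith⟩
  set f : Conf n → ℂ := fun x => (b x : ℂ) * u x with hf
  have hft : IsTest f :=
    ⟨(Complex.ofRealCLM.contDiff.comp b.contDiff).mul hus,
      (b.hasCompactSupport.comp_left Complex.ofReal_zero).mul_right⟩
  have hlams : 0 < lam * s := mul_pos hlam hs0
  have hgc : ∀ a : ℝ, Continuous fun x : Conf n => g (rad x / s - a) := fun a =>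
    S.cont_g.comp ((continuous_rad.div_const s).sub continuous_const)
  have hk : Continuous fun x : Conf n => 8 / s * h (rad x / s - 1) ^ 2 :=
    continuous_const.mul ((S.cont_h.comp ((continuous_rad.div_const s).sub continuous_const)).pow 2)
  obtain ⟨hI, hI0⟩ := form_integral_nonneg (formData_cutoff (n := n) S s) hk
    (fun x => by positivity) (fun x => sub_nonneg.2 (S.g_le_one _)) (sum_sq_cutoff_le S hs) hlams hft
  have hΓ0 : ∀ x : Conf n, 2 * s < rad x → 1 - g (rad x / s - 1) = 0 := fun x hx => by
    rw [S.g_one, sub_self]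
    rw [le_sub_iff_add_le, le_div_iff₀ hs0]
    linarith
  have iΓ : Integrable fun x => (1 - g (rad x / s - 1)) * ‖u x‖ ^ 2 := by
    refine Continuous.integrable_of_hasCompactSupport ((continuous_const.sub (hgc 1)).mul
      (hus.continuous.norm.pow 2)) ?_
    refine HasCompactSupport.intro (isCompact_closedBall 0 (2 * s)) fun x hx => ?_
    rw [hΓ0, zero_mul]
    rw [mem_closedBall_zero_iff, not_le] at hx
    rw [rad]
    nlinarith
  have iq := hκ.integrable_avg hqi
  have ip := hκ.integrable_avg hpi
  have i1 := iq.const_mul (8 * B ^ 2 * lam)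
  have i2 := ip.const_mul (lam⁻¹ * ((n + 6) * B + 3 * c + 1) + 2 * δ)
  have i3 := iΓ.const_mul 2
  have i12 : Integrable fun x => 8 * B ^ 2 * lam * avg κ q x
      + (lam⁻¹ * ((n + 6) * B + 3 * c + 1) + 2 * δ) * avg κ p x := i1.add i2
  refine ⟨iΓ, ?_⟩
  have hmain := hI0.trans (integral_mono hI (i12.sub i3) fun x => ?_)
  · simp only [Pi.sub_apply] at hmain
    rw [integral_sub i12 i3, integral_add i1 i2, integral_const_mul, integral_const_mul,
      integral_const_mul, hκ.integral_avg hqi, hκ.integral_avg hpi] at hmain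
    linarith
  simp only [Pi.sub_apply]
  have hM0 := hκ.avg_nonneg hp0 x
  have hQ0 := hκ.avg_nonneg hq0 x
  rcases le_or_gt (rad x) (3 * s) with hx | hx
  · have hxs : x ∈ Metric.ball (0 : Conf n) b.rIn := by
      rw [mem_ball_zero_iff]
      change ‖x‖ < 2 * s
      rw [rad] at hx
      nlinarith [norm_nonneg x]
    have hfu : f =ᶠ[𝓝 x] u := by
      filter_upwards [b.eventuallyEq_one_of_mem_ball hxs] with y hy
      rw [hf]
      simp only [hy, Pi.one_apply, Complex.ofReal_one, one_mul]
    rw [hfu.eq_of_nhds, InnerProductSpace.laplacian_congr_nhds hfu |>.eq_of_nhds]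
    have hU := hκ.norm_moll_sq_le hv x
    have he := hκ.norm_laplacian_moll_sub_sq_le hv hW hweak x (hδ x · hx)
    rw [← hu] at hU he
    change _ ≤ avg κ p x at hU
    change _ ≤ δ ^ 2 * avg κ p x at he
    set e := Δ u x - (W x + Complex.I) * u x with he0
    have hd : (starRingEnd ℂ) (Δ u x) * u x
        = ((W x * ‖u x‖ ^ 2 : ℝ) : ℂ) - Complex.I * ((‖u x‖ ^ 2 : ℝ) : ℂ)
          + (starRingEnd ℂ) e * u x := by
      have : Δ u x = e + (W x + Complex.I) * u x := (sub_add_cancel _ _).symm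
      rw [this, map_add, map_mul, map_add, Complex.conj_ofReal, Complex.conj_I]
      push_cast
      rw [← Complex.conj_mul']
      ring
    have hr : ‖(starRingEnd ℂ) e * u x‖ ≤ δ * avg κ p x := by
      rw [norm_mul, RCLike.norm_conj]
      refine le_of_sq_le_sq ?_ (mul_nonneg hδ0 hM0)
      calc _ = ‖e‖ ^ 2 * ‖u x‖ ^ 2 := mul_pow _ _ _
        _ ≤ (δ ^ 2 * avg κ p x) * avg κ p x := by gcongr
        _ = _ := by ring
    have hre := (Complex.abs_re_le_norm _).trans hr
    have him := (Complex.abs_im_le_norm _).trans hr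
    -- The derivative of the step vanishes unless `⟨x⟩² ≥ s`, hence `|x| ≥ N + 1`; a mollifier of
    -- radius at most `1` then averages only over `|t| ≥ N`.
    have h1 : h (rad x / s - 1) ^ 2 * ‖u x‖ ^ 2 ≤ B ^ 2 * avg κ q x := by
      rcases lt_or_ge (rad x) s with hxs | hxs
      · rw [S.h_zero _ (by rw [sub_neg, div_lt_one hs0]; exact hxs)]
        simpa using mul_nonneg (sq_nonneg B) hQ0
      · have hpq : avg κ q x = avg κ p x := by
          refine integral_congr_ae (ae_of_all _ fun t => ?_)
          simp only [ContinuousLinearMap.mul_apply']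
          by_cases ht : ‖x - t‖ < ε
          · have h2 := hN x hxs
            have h3 := norm_sub_norm_le x t
            rw [hq, Set.indicator_of_mem]
            change N ≤ ‖t‖
            linarith
          · rw [hκ.eq_zero _ (not_lt.1 ht), mul_zero, mul_zero]
        rw [hpq]
        refine mul_le_mul ?_ hU (sq_nonneg _) (sq_nonneg _)
        rw [← sq_abs]
        exact pow_le_pow_left₀ (abs_nonneg _) (S.h_le _) 2
    have hdre : ((starRingEnd ℂ) (Δ u x) * u x).re
        = W x * ‖u x‖ ^ 2 + ((starRingEnd ℂ) e * u x).re := by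
      rw [hd, Complex.add_re, Complex.sub_re, Complex.ofReal_re, Complex.I_mul_re,
        Complex.ofReal_im]
      ring
    have hdim : ((starRingEnd ℂ) (Δ u x) * u x).im
        = -‖u x‖ ^ 2 + ((starRingEnd ℂ) e * u x).im := by
      rw [hd, Complex.add_im, Complex.sub_im, Complex.ofReal_im, Complex.I_mul_im,
        Complex.ofReal_re]
      ring
    have hw : -(3 * c * s) ≤ W x := by nlinarith [hWc x]
    exact localized_form_le hs hlam (by positivity) hc hδ1 h1 hU (abs_sum_cutoff_le S hs x)
      (sub_nonneg.2 (S.g_le_one _)) (sub_le_self _ (S.g_nonneg _)) (sub_nonneg.2 (S.g_le_one _))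
      (sub_le_self _ (S.g_nonneg _)) (sq_nonneg _) hw hre him hdre hdim
  · have hx1 : 1 < rad x / s - 1 := by
      rw [lt_sub_iff_add_lt, lt_div_iff₀ hs0]
      linarith
    have hx2 : 1 < rad x / s - 2 := by
      rw [lt_sub_iff_add_lt, lt_div_iff₀ hs0]
      linarith
    rw [S.h_eq_zero_of_one_lt hx1, S.h_eq_zero_of_one_lt hx2, S.h₁_eq_zero_of_one_lt hx2,
      S.g_one _ hx1.le, S.g_one _ hx2.le]
    simp only [zero_div, neg_zero, mul_zero, add_zero, Finset.sum_const_zero, zero_mul, sub_self,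
      ne_eq, OfNat.ofNat_ne_zero, not_false_eq_true, zero_pow, sub_zero]
    positivity

end Cutoff

end Repulsive

namespace Repulsive

variable {n : ℕ}

/-! ### Essential self-adjointness -/

theorem exists_abs_sub_le {W : Conf n → ℝ} (hW : Continuous W) (r : ℝ) {δ : ℝ} (hδ : 0 < δ) :
    ∃ ε > 0, ∀ x t : Conf n, rad x ≤ r → ‖x - t‖ < ε → |W t - W x| ≤ δ := by
  have hu := (isCompact_closedBall (0 : Conf n) (r + 1)).uniformContinuousOn_of_continuous
    hW.continuousOn
  obtain ⟨ε, hε, h⟩ := Metric.uniformContinuousOn_iff_le.1 hu δ hδ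
  refine ⟨min ε 1, lt_min hε one_pos, fun x t hx hxt => ?_⟩
  have h1 : ‖x‖ ≤ r := by
    rw [rad] at hx
    nlinarith [sq_nonneg (‖x‖ - 1), norm_nonneg x]
  have h2 : ‖t‖ ≤ r + 1 := by
    have := norm_sub_norm_le t x
    rw [norm_sub_rev] at this
    linarith [hxt.trans_le (min_le_right ε 1)]
  have := h x (by rw [mem_closedBall_zero_iff]; linarith) t (by rwa [mem_closedBall_zero_iff])
    (by rw [dist_eq_norm]; exact (hxt.trans_le (min_le_left _ _)).le)
  rwa [Real.dist_eq, abs_sub_comm] at this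

theorem isMollifier_normed (b : ContDiffBump (0 : Conf n)) :
    IsMollifier (b.normed volume) b.rOut where
  smooth := b.contDiff_normed
  compact := b.hasCompactSupport_normed
  nonneg := b.nonneg_normed
  integral_eq_one := b.integral_normed
  eq_zero x hx := by
    have : x ∉ Function.support (b.normed volume) := by
      rw [b.support_normed_eq, mem_ball_zero_iff, not_lt]
      exact hx
    exact Function.notMem_support.1 this

theorem moll_normed (v : Conf n → ℂ) (b : ContDiffBump (0 : Conf n)) (x : Conf n) :
    moll v (fun x => (b.normed volume x : ℂ)) x
      = convolution (b.normed volume) v (ContinuousLinearMap.lsmul ℝ ℝ) volume x := by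
  rw [moll_apply, convolution_lsmul_swap]
  refine integral_congr_ae (ae_of_all _ fun t => ?_)
  simp only [Complex.real_smul]
  ring

theorem tendsto_integral_indicator_norm_le {p : Conf n → ℝ} (hp : Integrable p) :
    Tendsto (fun N : ℕ => ∫ x, {x : Conf n | (N : ℝ) ≤ ‖x‖}.indicator p x) atTop (𝓝 0) := by
  have h := tendsto_integral_of_dominated_convergence (μ := (volume : Measure (Conf n)))
    (F := fun (N : ℕ) x => {x : Conf n | (N : ℝ) ≤ ‖x‖}.indicator p x) (f := fun _ => 0)
    (fun x => ‖p x‖)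
    (fun N => (hp.indicator (measurableSet_le measurable_const measurable_norm)).aestronglyMeasurable)
    hp.norm (fun N => ae_of_all _ fun x => norm_indicator_le_norm_self _ _)
    (ae_of_all _ fun x => ?_)
  · simpa using h
  · refine tendsto_const_nhds.congr' ?_
    obtain ⟨N, hN⟩ := exists_nat_gt ‖x‖
    filter_upwards [eventually_ge_atTop N] with M hM
    have hNM : (N : ℝ) ≤ M := by exact_mod_cast hM
    have hx : x ∉ {x : Conf n | (M : ℝ) ≤ ‖x‖} := fun h => by
      have h' : (M : ℝ) ≤ ‖x‖ := h
      linarith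
    exact (Set.indicator_of_notMem hx p).symm

/-- A square integrable weak solution of `(-Δ + W + i) v = 0` vanishes. -/
theorem ae_eq_zero_of_weak {v : Conf n → ℂ} (hv : MemLp v 2) {W : Conf n → ℝ}
    (hW : Continuous W) {c : ℝ} (hc : 0 ≤ c) (hWc : ∀ x, -(c * rad x) ≤ W x)
    (hweak : ∀ φ, IsTest φ → ∫ t, v t * (schrodingerExpr W φ t + Complex.I * φ t) = 0) :
    v =ᵐ[volume] 0 := by
  obtain ⟨g, h, h₁, h₂, B, S⟩ := exists_smoothStep
  have hB := S.B_nonneg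
  set K := (n + 6) * B + 3 * c + 1 with hK
  have hK0 : 0 < K := by positivity
  have hp : Integrable fun x => ‖v x‖ ^ 2 := hv.norm.integrable_sq
  set I := ∫ x, ‖v x‖ ^ 2 with hI
  have hI0 : 0 ≤ I := integral_nonneg fun x => sq_nonneg _
  set s : ℕ → ℝ := fun N => 1 + ((N : ℝ) + 1) ^ 2 with hs
  have hδ : ∀ N : ℕ, (0 : ℝ) < 1 / ((N : ℝ) + 1) := fun N => by positivity
  choose ε hε0 hε using fun N : ℕ => exists_abs_sub_le hW (3 * s N) (hδ N)
  have hr : ∀ N, 0 < min (ε N) (1 / ((N : ℝ) + 1)) := fun N => lt_min (hε0 N) (hδ N)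
  -- The radius is small enough for `W` to oscillate by at most `1/(N+1)` on the cutoff region, and
  -- it tends to zero. The fixed ratio `2` of outer to inner radius is what the almost everywhere
  -- convergence of the mollifications needs.
  let b : ℕ → ContDiffBump (0 : Conf n) := fun N =>
    ⟨min (ε N) (1 / ((N : ℝ) + 1)) / 2, min (ε N) (1 / ((N : ℝ) + 1)), half_pos (hr N),
      half_lt_self (hr N)⟩
  have hb : ∀ N, (b N).rOut = min (ε N) (1 / ((N : ℝ) + 1)) := fun N => rfl
  have hN1 : ∀ N : ℕ, 1 / ((N : ℝ) + 1) ≤ 1 := fun N => by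
    rw [div_le_one (by positivity)]
    linarith [(Nat.cast_nonneg N : (0 : ℝ) ≤ N)]
  set u : ℕ → Conf n → ℂ := fun N => moll v fun x => ((b N).normed volume x : ℂ) with hu
  -- With `λ = K` the term `λ⁻¹ K I` is exactly `I`, against `2I` on the left in the limit. Since
  -- `λ` does not depend on `N`, the tail term still tends to zero.
  have hbound := fun N : ℕ => two_mul_integral_cutoff_le S (s := s N) (lam := K)
    (by simp only [hs]; nlinarith [sq_nonneg ((N : ℝ) + 1)]) hK0 (isMollifier_normed (b N))
    ((min_le_right _ _).trans (hN1 N)) hv hW hc hWc hweak (hδ N).le (hN1 N)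
    (fun x t hx hxt => hε N x t hx (hxt.trans_le (min_le_left _ _))) (N := N) (fun x hx => by
      simp only [hs, rad] at hx
      exact le_of_sq_le_sq (by linarith) (norm_nonneg x))
  set R : ℕ → ℝ := fun N => (8 * B ^ 2 * K
    * (∫ x, {x : Conf n | (N : ℝ) ≤ ‖x‖}.indicator (fun x => ‖v x‖ ^ 2) x)
    + (1 + 2 * (1 / ((N : ℝ) + 1))) * I) / 2 with hR
  have hRlim : Tendsto R atTop (𝓝 (I / 2)) := by
    have := (((tendsto_integral_indicator_norm_le hp).const_mul (8 * B ^ 2 * K)).add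
      (((tendsto_one_div_add_atTop_nhds_zero_nat (𝕜 := ℝ)).const_mul 2).const_add 1
        |>.mul_const I)).div_const 2
    rwa [mul_zero, mul_zero, add_zero, one_mul, zero_add] at this
  set Φ : ℕ → Conf n → ℝ := fun N x => (1 - g (rad x / s N - 1)) * ‖u N x‖ ^ 2 with hΦ
  have hΦ0 : ∀ N x, 0 ≤ Φ N x := fun N x => mul_nonneg (sub_nonneg.2 (S.g_le_one _)) (sq_nonneg _)
  have hΦi : ∀ N, Integrable (Φ N) := fun N => (hbound N).1
  have hΦle : ∀ N, ∫ x, Φ N x ≤ R N := fun N => by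
    have := (hbound N).2
    rw [inv_mul_cancel₀ hK0.ne'] at this
    simp only [hR]
    linarith
  have hlim : ∀ᵐ x, Tendsto (fun N => u N x) atTop (𝓝 (v x)) := by
    have hrl : Tendsto (fun N => (b N).rOut) atTop (𝓝 0) :=
      squeeze_zero (fun N => (hr N).le) (fun N => min_le_right _ _)
        tendsto_one_div_add_atTop_nhds_zero_nat
    have := ContDiffBump.ae_convolution_tendsto_right_of_locallyIntegrable (K := 2)
      (μ := (volume : Measure (Conf n))) hrl
      (Eventually.of_forall fun N => (mul_div_cancel₀ _ two_ne_zero).ge)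
      (hv.locallyIntegrable (by norm_num))
    filter_upwards [this] with x hx
    simpa only [hu, moll_normed] using hx
  have hΦlim : ∀ᵐ x, Tendsto (fun N => ENNReal.ofReal (Φ N x)) atTop
      (𝓝 (ENNReal.ofReal (‖v x‖ ^ 2))) := by
    filter_upwards [hlim] with x hx
    refine ENNReal.tendsto_ofReal ((hx.norm.pow 2).congr' ?_)
    obtain ⟨N, hN⟩ := exists_nat_gt ‖x‖
    filter_upwards [eventually_ge_atTop N] with M hM
    have h1 : (N : ℝ) ≤ M := by exact_mod_cast hM
    have h2 : rad x ≤ s M := by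
      simp only [rad, hs]
      have := norm_nonneg x
      gcongr
      linarith
    simp only [hΦ]
    rw [S.g_zero, sub_zero, one_mul]
    rw [sub_nonpos, div_le_one (by positivity)]
    exact h2
  -- Fatou's lemma gives `I ≤ I/2` for the finite number `I = ‖v‖²`, so `I = 0`.
  have hfatou : ENNReal.ofReal I ≤ ENNReal.ofReal (I / 2) := by
    calc ENNReal.ofReal I = ∫⁻ x, ENNReal.ofReal (‖v x‖ ^ 2) :=
          ofReal_integral_eq_lintegral_ofReal hp (ae_of_all _ fun x => sq_nonneg _)
      _ = ∫⁻ x, liminf (fun N => ENNReal.ofReal (Φ N x)) atTop := by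
          refine lintegral_congr_ae ?_
          filter_upwards [hΦlim] with x hx using hx.liminf_eq.symm
      _ ≤ liminf (fun N => ∫⁻ x, ENNReal.ofReal (Φ N x)) atTop :=
          lintegral_liminf_le' fun N => (hΦi N).aestronglyMeasurable.aemeasurable.ennreal_ofReal
      _ ≤ liminf (fun N => ENNReal.ofReal (R N)) atTop := by
          refine liminf_le_liminf (Eventually.of_forall fun N => ?_)
          rw [← ofReal_integral_eq_lintegral_ofReal (hΦi N) (ae_of_all _ (hΦ0 N))]
          exact ENNReal.ofReal_le_ofReal (hΦle N)
      _ = ENNReal.ofReal (I / 2) := (ENNReal.tendsto_ofReal hRlim).liminf_eq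
  have hI2 : I = 0 := by
    have := (ENNReal.ofReal_le_ofReal_iff (by positivity)).1 hfatou
    linarith
  have h0 := (integral_eq_zero_iff_of_nonneg (fun x => sq_nonneg ‖v x‖) hp).1 hI2
  filter_upwards [h0] with x hx
  simpa using hx

theorem schrodingerExpr_conj {W : Conf n → ℝ} (φ : Conf n → ℂ) (x : Conf n) :
    schrodingerExpr W (fun y => (starRingEnd ℂ) (φ y)) x = (starRingEnd ℂ) (schrodingerExpr W φ x) := by
  have h : Δ (fun y => (starRingEnd ℂ) (φ y)) x = (starRingEnd ℂ) (Δ φ x) :=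
    congrFun (InnerProductSpace.laplacian_CLE_comp_left (f := φ) (l := Complex.conjCLE)) x
  rw [schrodingerExpr, schrodingerExpr, h, map_add, map_neg, map_mul, Complex.conj_ofReal]

theorem isTest_conj {φ : Conf n → ℂ} (hφ : IsTest φ) : IsTest fun y => (starRingEnd ℂ) (φ y) :=
  ⟨Complex.conjCLE.contDiff.comp hφ.1, hφ.2.comp_left (map_zero _)⟩

theorem exists_coreOp_eq {W : Conf n → ℝ} (hW : Continuous W) {φ : Conf n → ℂ} (hφ : IsTest φ) :
    ∃ y : (coreOp W).domain, (y : L2 n) =ᵐ[volume] φ ∧ coreOp W y =ᵐ[volume] schrodingerExpr W φ := by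
  have h1 : MemLp φ 2 (volume : Measure (Conf n)) :=
    hφ.1.continuous.memLp_of_hasCompactSupport hφ.2
  have h2 : MemLp (schrodingerExpr W φ) 2 (volume : Measure (Conf n)) := by
    refine Continuous.memLp_of_hasCompactSupport ?_ ?_
    · exact hφ.laplacian.1.continuous.neg.add
        ((Complex.continuous_ofReal.comp hW).mul hφ.1.continuous)
    · exact hφ.laplacian.2.neg.add hφ.2.mul_left
  have hg : (h1.toLp φ, h2.toLp _) ∈ (coreOp W).graph := by
    rw [coreOp_graph]
    exact ⟨φ, hφ, h1.coeFn_toLp, h2.coeFn_toLp⟩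
  obtain ⟨y, hy1, hy2⟩ := (LinearPMap.mem_graph_iff _).1 hg
  simp only at hy1 hy2
  exact ⟨y, hy1 ▸ h1.coeFn_toLp, hy2 ▸ h2.coeFn_toLp⟩

/-- The form inequality with `G = 1` and `k = l = 0` has a vanishing right-hand side. -/
theorem im_inner_coreOp {W : Conf n → ℝ} (y : (coreOp W).domain) :
    (inner ℂ (coreOp W y) (y : L2 n)).im = 0 := by
  have hy : ((y : L2 n), coreOp W y) ∈ closure (coreGraph W : Set (L2 n × L2 n)) := by
    rw [← coreOp_graph]
    exact subset_closure (LinearPMap.mem_graph _ y)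
  have hF : FormData (n := n) (fun _ => 1) (fun _ => 0) (fun _ _ => 0) (fun _ _ => 0)
      (fun _ _ => 0) :=
    ⟨continuous_const, fun _ => continuous_const, fun _ _ => hasDerivAt_const _ _,
      continuous_const, fun _ => continuous_const, fun _ => continuous_const,
      fun _ _ => hasDerivAt_const _ _, fun _ _ => hasDerivAt_const _ _⟩
  have m0 : IsMultiplier fun _ : Conf n => (0 : ℝ) := ⟨measurable_const, 0, fun _ => by simp⟩
  have m1 : IsMultiplier fun _ : Conf n => (1 : ℝ) := ⟨measurable_const, 1, fun _ => by simp⟩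
  have h := abs_two_mul_im_inner_le hF (k := fun _ => 0) (W := W) (lam := 1) continuous_const
    (fun _ => le_rfl) (fun _ => le_rfl) (fun _ => by simp) one_pos m1 m0 (by simpa using m0) hy
  have e1 : mulOp (fun _ => 1) (y : L2 n) = y := by
    refine Lp.ext ?_
    filter_upwards [m1.coeFn_mulOp (y : L2 n)] with x hx
    rw [hx, Complex.ofReal_one, one_mul]
  have e0 : mulOp (fun _ => 0) (y : L2 n) = 0 := by
    refine Lp.ext ?_
    filter_upwards [m0.coeFn_mulOp (y : L2 n), Lp.coeFn_zero ℂ 2 (volume : Measure (Conf n))]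
      with x hx h0
    rw [hx, h0, Complex.ofReal_zero, zero_mul, Pi.zero_apply]
  rw [e1, e0] at h
  have h' : 2 * |(inner ℂ (coreOp W y) (y : L2 n)).im| ≤ 0 := by simpa [weight] using h
  exact abs_eq_zero.1 (le_antisymm (by linarith) (abs_nonneg _))

theorem inner_eq_integral_conj_mul {w y : L2 n} {f : Conf n → ℂ} (h : y =ᵐ[volume] f) :
    inner ℂ w y = ∫ x, (starRingEnd ℂ) (w x) * f x := by
  rw [L2.inner_def]
  refine integral_congr_ae ?_
  filter_upwards [h] with x hx
  rw [hx, RCLike.inner_apply, mul_comm]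

theorem dense_domain_coreOp {W : Conf n → ℝ} (hW : Continuous W) :
    Dense ((coreOp W).domain : Set (L2 n)) := by
  rw [Submodule.dense_iff_topologicalClosure_eq_top, Submodule.topologicalClosure_eq_top_iff,
    Submodule.eq_bot_iff]
  intro w hw
  rw [Submodule.mem_orthogonal'] at hw
  have hl : LocallyIntegrable fun x => (starRingEnd ℂ) (w x) :=
    (Lp.memLp w).star.locallyIntegrable (by norm_num)
  have h0 := ae_eq_zero_of_integral_contDiff_smul_eq_zero hl fun φ hφ hs => by
    obtain ⟨y, hy, -⟩ := exists_coreOp_eq hW (φ := fun x => (φ x : ℂ))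
      ⟨Complex.ofRealCLM.contDiff.comp hφ, hs.comp_left Complex.ofReal_zero⟩
    rw [← hw y y.2, inner_eq_integral_conj_mul hy]
    refine integral_congr_ae (ae_of_all _ fun x => ?_)
    simp only [Complex.real_smul]
    ring
  refine Lp.ext ?_
  filter_upwards [h0, Lp.coeFn_zero ℂ 2 (volume : Measure (Conf n))] with x hx h0
  rw [h0, Pi.zero_apply, ← map_eq_zero (starRingEnd ℂ)]
  exact hx

/-- For continuous `W ≥ -c(1 + |x|²)` the operator `-Δ + W` is essentially self-adjoint on
`C_c^∞(ℝⁿ)`. -/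
theorem isSelfAdjoint_schrodingerOp {W : Conf n → ℝ} (hW : Continuous W) {c : ℝ} (hc : 0 ≤ c)
    (hWc : ∀ x, -(c * rad x) ≤ W x) : IsSelfAdjoint (schrodingerOp W) := by
  refine isSelfAdjoint_closure (dense_domain_coreOp hW) im_inner_coreOp (fun w hw => ?_)
    fun w hw => ?_
  · have h0 := ae_eq_zero_of_weak (Lp.memLp w).star hW hc hWc fun φ hφ => by
      obtain ⟨y, hy1, hy2⟩ := exists_coreOp_eq hW hφ
      have h3 : coreOp W y + Complex.I • (y : L2 n)
          =ᵐ[volume] fun t => schrodingerExpr W φ t + Complex.I * φ t := by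
        filter_upwards [hy1, hy2, Lp.coeFn_add (coreOp W y) (Complex.I • (y : L2 n)),
          Lp.coeFn_smul Complex.I (y : L2 n)] with x a1 a2 a3 a4
        rw [a3, Pi.add_apply, a4, Pi.smul_apply, a1, a2, smul_eq_mul]
      rw [← hw y, inner_eq_integral_conj_mul h3]
      rfl
    refine Lp.ext ?_
    filter_upwards [h0, Lp.coeFn_zero ℂ 2 (volume : Measure (Conf n))] with x hx h0
    rw [h0, Pi.zero_apply, ← map_eq_zero (starRingEnd ℂ)]
    exact hx
  -- Complex conjugation of the test functions exchanges `i` and `-i`: here `w` itself is the weak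
  -- solution, while in the first case it was its conjugate.
  · have h0 := ae_eq_zero_of_weak (Lp.memLp w) hW hc hWc fun φ hφ => by
      obtain ⟨y, hy1, hy2⟩ := exists_coreOp_eq hW (isTest_conj hφ)
      have h3 : coreOp W y - Complex.I • (y : L2 n)
          =ᵐ[volume] fun t => (starRingEnd ℂ) (schrodingerExpr W φ t + Complex.I * φ t) := by
        filter_upwards [hy1, hy2, Lp.coeFn_sub (coreOp W y) (Complex.I • (y : L2 n)),
          Lp.coeFn_smul Complex.I (y : L2 n)] with x a1 a2 a3 a4
        rw [a3, Pi.sub_apply, a4, Pi.smul_apply, a1, a2, smul_eq_mul, schrodingerExpr_conj, map_add,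
          map_mul, Complex.conj_I]
        ring
      have h4 := hw y
      rw [inner_eq_integral_conj_mul h3] at h4
      simp only [← map_mul] at h4
      rw [integral_conj] at h4
      exact (map_eq_zero _).1 h4
    refine Lp.ext ?_
    filter_upwards [h0, Lp.coeFn_zero ℂ 2 (volume : Measure (Conf n))] with x hx h0
    rw [h0, hx]

end Repulsive

namespace Repulsive

variable {n : ℕ}

/-! ### The commutator with a radial step -/

/-- The argument `(r^{ρ/2} - c) / d` of the step, as a function of `r = ⟨x⟩²`. -/
noncomputable def stepArg (ρ c d r : ℝ) : ℝ := (r ^ (ρ / 2) - c) / d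

/-- The derivative of `stepArg`. -/
noncomputable def stepArg₁ (ρ d r : ℝ) : ℝ := ρ / 2 * r ^ (ρ / 2 - 1) / d

/-- The second derivative of `stepArg`. -/
noncomputable def stepArg₂ (ρ d r : ℝ) : ℝ := ρ / 2 * ((ρ / 2 - 1) * r ^ (ρ / 2 - 1 - 1)) / d

theorem hasDerivAt_stepArg (ρ c d : ℝ) {r : ℝ} (hr : 0 < r) :
    HasDerivAt (stepArg ρ c d) (stepArg₁ ρ d r) r :=
  ((Real.hasDerivAt_rpow_const (Or.inl hr.ne')).sub_const c).div_const d

theorem hasDerivAt_stepArg₁ (ρ d : ℝ) {r : ℝ} (hr : 0 < r) :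
    HasDerivAt (stepArg₁ ρ d) (stepArg₂ ρ d r) r :=
  ((Real.hasDerivAt_rpow_const (Or.inl hr.ne')).const_mul (ρ / 2)).div_const d

theorem continuousOn_rpow_Ioi (p : ℝ) : ContinuousOn (fun r : ℝ => r ^ p) (Set.Ioi 0) :=
  fun _ hr => (Real.continuousAt_rpow_const _ _ (Or.inl (ne_of_gt hr))).continuousWithinAt

theorem continuousOn_stepArg (ρ c d : ℝ) : ContinuousOn (stepArg ρ c d) (Set.Ioi 0) :=
  ((continuousOn_rpow_Ioi _).sub continuousOn_const).div_const d

theorem continuousOn_stepArg₁ (ρ d : ℝ) : ContinuousOn (stepArg₁ ρ d) (Set.Ioi 0) :=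
  (continuousOn_const.mul (continuousOn_rpow_Ioi _)).div_const d

theorem continuousOn_stepArg₂ (ρ d : ℝ) : ContinuousOn (stepArg₂ ρ d) (Set.Ioi 0) :=
  (continuousOn_const.mul (continuousOn_const.mul (continuousOn_rpow_Ioi _))).div_const d

/-- The bounds involve only the lower bound `δ` of the width, so they are uniform in the scale `T`
when `d = δT`. The second one rests on `r (r^{ρ/2-1})² = r^{ρ-1} ≤ 1`. -/
theorem abs_stepArg₁_le {ρ d δ r : ℝ} (hρ0 : 0 < ρ) (hρ1 : ρ ≤ 1) (hδ : 0 < δ) (hd : δ ≤ d)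
    (hr : 1 ≤ r) : |stepArg₁ ρ d r| ≤ δ⁻¹ ∧ r * stepArg₁ ρ d r ^ 2 ≤ δ⁻¹ ^ 2 := by
  have hr0 : 0 < r := zero_lt_one.trans_le hr
  have hd0 : 0 < d := hδ.trans_le hd
  have hdi : d⁻¹ ≤ δ⁻¹ := inv_anti₀ hδ hd
  have hp0 : 0 < r ^ (ρ / 2 - 1) := Real.rpow_pos_of_pos hr0 _
  have hp1 : r ^ (ρ / 2 - 1) ≤ 1 := Real.rpow_le_one_of_one_le_of_nonpos hr (by linarith)
  have hp2 : r * (r ^ (ρ / 2 - 1)) ^ 2 ≤ 1 := by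
    have : r * (r ^ (ρ / 2 - 1)) ^ 2 = r ^ (ρ - 1) := by
      rw [← Real.rpow_natCast, ← Real.rpow_mul hr0.le]
      nth_rewrite 1 [← Real.rpow_one r]
      rw [← Real.rpow_add hr0]
      congr 1
      push_cast
      ring
    rw [this]
    exact Real.rpow_le_one_of_one_le_of_nonpos hr (by linarith)
  have hi0 : 0 < d⁻¹ := inv_pos.2 hd0
  constructor
  · rw [stepArg₁, abs_of_nonneg (by positivity), div_eq_mul_inv]
    calc _ ≤ 1 * 1 * δ⁻¹ := by gcongr; linarith
      _ = δ⁻¹ := by ring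
  · have : r * stepArg₁ ρ d r ^ 2 = (ρ / 2) ^ 2 * (r * (r ^ (ρ / 2 - 1)) ^ 2) * d⁻¹ ^ 2 := by
      rw [stepArg₁]
      field_simp
    rw [this]
    calc _ ≤ 1 ^ 2 * 1 * δ⁻¹ ^ 2 := by gcongr; linarith
      _ = _ := by ring

theorem abs_stepArg₂_le {ρ d δ r : ℝ} (hρ0 : 0 < ρ) (hρ1 : ρ ≤ 1) (hδ : 0 < δ) (hd : δ ≤ d)
    (hr : 1 ≤ r) : r * |stepArg₂ ρ d r| ≤ δ⁻¹ := by
  have hr0 : 0 < r := zero_lt_one.trans_le hr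
  have hd0 : 0 < d := hδ.trans_le hd
  have hdi : d⁻¹ ≤ δ⁻¹ := inv_anti₀ hδ hd
  have hi0 : 0 < d⁻¹ := inv_pos.2 hd0
  have hp0 : 0 < r ^ (ρ / 2 - 1) := Real.rpow_pos_of_pos hr0 _
  have hp1 : r ^ (ρ / 2 - 1) ≤ 1 := Real.rpow_le_one_of_one_le_of_nonpos hr (by linarith)
  have hp2 : r * r ^ (ρ / 2 - 1 - 1) = r ^ (ρ / 2 - 1) := by
    rw [Real.rpow_sub_one hr0.ne' (ρ / 2 - 1)]
    field_simp
  have hneg : ρ / 2 - 1 ≤ 0 := by linarith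
  have : r * |stepArg₂ ρ d r| = ρ / 2 * (1 - ρ / 2) * (r * r ^ (ρ / 2 - 1 - 1)) * d⁻¹ := by
    rw [stepArg₂, abs_div, abs_mul, abs_mul, abs_of_nonneg hd0.le, abs_of_nonpos hneg,
      abs_of_nonneg (Real.rpow_nonneg hr0.le _), abs_of_pos (half_pos hρ0)]
    field_simp
    ring
  rw [this, hp2]
  have h1 : 0 ≤ 1 - ρ / 2 := by linarith
  calc _ ≤ 1 * 1 * 1 * δ⁻¹ := by gcongr <;> linarith
    _ = _ := by ring

/-! ### The weight `h(s(r)) r^{-α/2}` of the gradient term and its derivatives. -/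

section Profile

variable (h h₁ h₂ : ℝ → ℝ) (α ρ c d : ℝ)

/-- `h(s(r)) r^{-α/2}`. -/
noncomputable def profile (r : ℝ) : ℝ := h (stepArg ρ c d r) * r ^ (-(α / 2))

/-- The derivative of `profile`. -/
noncomputable def profile₁ (r : ℝ) : ℝ :=
  h₁ (stepArg ρ c d r) * stepArg₁ ρ d r * r ^ (-(α / 2))
    + h (stepArg ρ c d r) * (-(α / 2) * r ^ (-(α / 2) - 1))

/-- The second derivative of `profile`. -/
noncomputable def profile₂ (r : ℝ) : ℝ :=
  (h₂ (stepArg ρ c d r) * stepArg₁ ρ d r * stepArg₁ ρ d r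
      + h₁ (stepArg ρ c d r) * stepArg₂ ρ d r) * r ^ (-(α / 2))
    + h₁ (stepArg ρ c d r) * stepArg₁ ρ d r * (-(α / 2) * r ^ (-(α / 2) - 1))
    + (h₁ (stepArg ρ c d r) * stepArg₁ ρ d r * (-(α / 2) * r ^ (-(α / 2) - 1))
      + h (stepArg ρ c d r) * (-(α / 2) * ((-(α / 2) - 1) * r ^ (-(α / 2) - 1 - 1))))

variable {h h₁ h₂}
variable {g : ℝ → ℝ} {B : ℝ} (S : SmoothStep g h h₁ h₂ B)
include S

theorem hasDerivAt_profile {r : ℝ} (hr : 0 < r) :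
    HasDerivAt (profile h α ρ c d) (profile₁ h h₁ α ρ c d r) r :=
  ((S.deriv_h _).comp r (hasDerivAt_stepArg ρ c d hr)).mul
    (Real.hasDerivAt_rpow_const (Or.inl hr.ne'))

theorem hasDerivAt_profile₁ {r : ℝ} (hr : 0 < r) :
    HasDerivAt (profile₁ h h₁ α ρ c d) (profile₂ h h₁ h₂ α ρ c d r) r :=
  ((((S.deriv_h₁ _).comp r (hasDerivAt_stepArg ρ c d hr)).mul (hasDerivAt_stepArg₁ ρ d hr)).mul
    (Real.hasDerivAt_rpow_const (Or.inl hr.ne'))).add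
    (((S.deriv_h _).comp r (hasDerivAt_stepArg ρ c d hr)).mul
      ((Real.hasDerivAt_rpow_const (Or.inl hr.ne')).const_mul _))

theorem continuousOn_profile₂ : ContinuousOn (profile₂ h h₁ h₂ α ρ c d) (Set.Ioi 0) := by
  have a := continuousOn_stepArg ρ c d
  have a1 := continuousOn_stepArg₁ ρ d
  have a2 := continuousOn_stepArg₂ ρ d
  have b := S.cont_h.comp_continuousOn a
  have b1 := S.cont_h₁.comp_continuousOn a
  have b2 := S.cont_h₂.comp_continuousOn a
  have p := continuousOn_rpow_Ioi (-(α / 2))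
  have p1 := continuousOn_rpow_Ioi (-(α / 2) - 1)
  have p2 := continuousOn_rpow_Ioi (-(α / 2) - 1 - 1)
  have q1 : ContinuousOn (fun r : ℝ => -(α / 2) * r ^ (-(α / 2) - 1)) (Set.Ioi 0) :=
    continuousOn_const.mul p1
  exact (((((b2.mul a1).mul a1).add (b1.mul a2)).mul p).add ((b1.mul a1).mul q1)).add
    (((b1.mul a1).mul q1).add (b.mul (continuousOn_const.mul (continuousOn_const.mul p2))))

variable {α ρ c d}

/-- The second derivative is multiplied by `r` because it enters the Laplacian with the factor
`4|x|² ≤ 4r`; differentiating a power of `r` gains the factor `r⁻¹` that pays for it. -/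
theorem profile_bounds (hα0 : 0 < α) (hα2 : α < 2) (hρ0 : 0 < ρ) (hρ1 : ρ ≤ 1) {δ : ℝ}
    (hδ : 0 < δ) (hd : δ ≤ d) {r : ℝ} (hr : 1 ≤ r) :
    |profile h α ρ c d r| ≤ B * r ^ (-(α / 2)) ∧
    |profile₁ h h₁ α ρ c d r| ≤ B * (δ⁻¹ + 1) * r ^ (-(α / 2)) ∧
    r * |profile₂ h h₁ h₂ α ρ c d r| ≤ B * (δ⁻¹ ^ 2 + 3 * δ⁻¹ + 2) * r ^ (-(α / 2)) := by
  have hr0 : 0 < r := zero_lt_one.trans_le hr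
  have hB := S.B_nonneg
  obtain ⟨hs1, hs1'⟩ := abs_stepArg₁_le hρ0 hρ1 hδ hd hr
  have hs2 := abs_stepArg₂_le hρ0 hρ1 hδ hd hr
  have b0 := S.h_le (stepArg ρ c d r)
  have b1 := S.h₁_le (stepArg ρ c d r)
  have b2 := S.h₂_le (stepArg ρ c d r)
  have hq1 : r ^ (-(α / 2) - 1) = r ^ (-(α / 2)) / r := Real.rpow_sub_one hr0.ne' _
  have hq2 : r ^ (-(α / 2) - 1 - 1) = r ^ (-(α / 2)) / r / r := by
    rw [Real.rpow_sub_one hr0.ne' _, hq1]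
  set q := r ^ (-(α / 2)) with hq
  have hq0 : 0 < q := Real.rpow_pos_of_pos hr0 _
  set s1 := stepArg₁ ρ d r
  set s2 := stepArg₂ ρ d r
  set H0 := h (stepArg ρ c d r)
  set H1 := h₁ (stepArg ρ c d r)
  set H2 := h₂ (stepArg ρ c d r)
  have hδi : 0 < δ⁻¹ := inv_pos.2 hδ
  set D := δ⁻¹
  have hri : r⁻¹ ≤ 1 := inv_le_one_of_one_le₀ hr
  have hri0 : 0 < r⁻¹ := inv_pos.2 hr0
  have hα2' : α / 2 ≤ 1 := by linarith
  have hα0' : 0 ≤ α / 2 := by linarith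
  have hh1 : |H0 * (-(α / 2))| ≤ B := by
    rw [abs_mul, abs_neg, abs_of_nonneg hα0']
    calc |H0| * (α / 2) ≤ B * 1 := by gcongr
      _ = B := mul_one B
  refine ⟨?_, ?_, ?_⟩
  · rw [profile, abs_mul, abs_of_pos hq0]
    exact mul_le_mul_of_nonneg_right b0 hq0.le
  · have e : profile₁ h h₁ α ρ c d r = (H1 * s1 + H0 * (-(α / 2)) * r⁻¹) * q := by
      rw [profile₁, hq1, ← hq]
      ring
    rw [e, abs_mul, abs_of_pos hq0]
    gcongr
    refine (abs_add_le _ _).trans ?_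
    rw [abs_mul, abs_mul _ r⁻¹, abs_of_pos hri0]
    calc |H1| * |s1| + |H0 * (-(α / 2))| * r⁻¹ ≤ B * D + B * 1 := by gcongr
      _ = _ := by ring
  · have e : r * profile₂ h h₁ h₂ α ρ c d r = (H2 * (r * s1 ^ 2) + H1 * (r * s2)
        + 2 * (H1 * s1 * (-(α / 2))) + H0 * (-(α / 2)) * ((-(α / 2) - 1) * r⁻¹)) * q := by
      rw [profile₂, hq1, hq2, ← hq]
      field_simp
      ring
    rw [← abs_of_pos hr0, ← abs_mul, abs_of_pos hr0, e, abs_mul, abs_of_pos hq0]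
    gcongr
    have t1 : |H2 * (r * s1 ^ 2)| ≤ B * D ^ 2 := by
      rw [abs_mul, abs_of_nonneg (by positivity : 0 ≤ r * s1 ^ 2)]
      gcongr
    have t2 : |H1 * (r * s2)| ≤ B * D := by
      rw [abs_mul, abs_mul r, abs_of_pos hr0]
      gcongr
    have t3 : |2 * (H1 * s1 * (-(α / 2)))| ≤ 2 * (B * D) := by
      rw [abs_mul, abs_mul, abs_mul, abs_neg, abs_of_nonneg hα0', abs_two]
      calc 2 * (|H1| * |s1| * (α / 2)) ≤ 2 * (B * D * 1) := by gcongr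
        _ = _ := by ring
    have t4 : |H0 * (-(α / 2)) * ((-(α / 2) - 1) * r⁻¹)| ≤ B * 2 := by
      rw [abs_mul, abs_mul (-(α / 2) - 1), abs_of_pos hri0,
        abs_of_nonpos (by linarith : -(α / 2) - 1 ≤ 0), neg_sub_left, neg_neg]
      calc _ ≤ B * (2 * 1) := by
            gcongr
            linarith
        _ = _ := by ring
    calc _ ≤ B * D ^ 2 + B * D + 2 * (B * D) + B * 2 :=
          (abs_add_le _ _).trans (add_le_add ((abs_add_le _ _).trans (add_le_add
            ((abs_add_le _ _).trans (add_le_add t1 t2)) t3)) t4)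
      _ = _ := by ring

/-- On the support of the step, `r^{ρ/2} ≥ c ≥ A`. -/
theorem profile_bounds_of_le (hα0 : 0 < α) (hα2 : α < 2) (hρ0 : 0 < ρ) (hρ1 : ρ ≤ 1) {δ A : ℝ}
    (hδ : 0 < δ) (hd : δ ≤ d) (hA : 0 < A) (hAc : A ≤ c) {r : ℝ} (hr : 1 ≤ r) :
    |profile h α ρ c d r| ≤ B * A ^ (-(α / ρ)) ∧
    |profile₁ h h₁ α ρ c d r| ≤ B * (δ⁻¹ + 1) * A ^ (-(α / ρ)) ∧
    r * |profile₂ h h₁ h₂ α ρ c d r| ≤ B * (δ⁻¹ ^ 2 + 3 * δ⁻¹ + 2) * A ^ (-(α / ρ)) := by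
  have hr0 : 0 < r := zero_lt_one.trans_le hr
  have hB := S.B_nonneg
  have hA' : 0 < A ^ (-(α / ρ)) := Real.rpow_pos_of_pos hA _
  have hδi : 0 < δ⁻¹ := inv_pos.2 hδ
  by_cases hs : stepArg ρ c d r < 0
  · rw [profile, profile₁, profile₂, S.h_zero _ hs, S.h₁_zero _ hs, S.h₂_zero _ hs]
    simp only [zero_mul, add_zero, abs_zero, mul_zero]
    exact ⟨by positivity, by positivity, by positivity⟩
  · have hrc : A ≤ r ^ (ρ / 2) := by
      rw [stepArg, not_lt, le_div_iff₀ (hδ.trans_le hd), zero_mul, sub_nonneg] at hs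
      exact hAc.trans hs
    have hq : r ^ (-(α / 2)) ≤ A ^ (-(α / ρ)) := by
      have : r ^ (-(α / 2)) = (r ^ (ρ / 2)) ^ (-(α / ρ)) := by
        rw [← Real.rpow_mul hr0.le]
        congr 1
        field_simp
      rw [this]
      exact Real.rpow_le_rpow_of_nonpos hA hrc (by rw [neg_nonpos]; positivity)
    obtain ⟨p0, p1, p2⟩ := profile_bounds S (c := c) hα0 hα2 hρ0 hρ1 hδ hd hr
    exact ⟨p0.trans (by gcongr), p1.trans (by gcongr), p2.trans (by gcongr)⟩

end Profile

end Repulsive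

namespace Repulsive

variable {n : ℕ}

/-! ### The velocity bound for radial steps. -/

theorem isMultiplier_of_continuous {m : Conf n → ℝ} (hm : Continuous m) {B : ℝ}
    (hB : ∀ x, |m x| ≤ B) : IsMultiplier m := ⟨hm.measurable, B, hB⟩

theorem weight_const_mul_add {m : Conf n → ℝ} (hm : IsMultiplier m) (a b : ℝ) (u : L2 n) :
    weight (fun x => a * m x + b) u = a * weight m u + b * ‖u‖ ^ 2 := by
  have h1 : IsMultiplier (fun _ : Conf n => (1 : ℝ)) := ⟨measurable_const, 1, fun x => by simp⟩
  rw [← weight_one, weight, weight, weight, ← integral_const_mul, ← integral_const_mul,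
    ← integral_add ((integrable_weight hm u).const_mul a) ((integrable_weight h1 u).const_mul b)]
  congr 1
  ext x
  ring

theorem rpow_norm_mul_rad_le {α : ℝ} (hα : 0 < α) (x : Conf n) :
    rad x ^ (-(α / 2)) * ‖x‖ ^ α ≤ 1 := by
  have h1 : ‖x‖ ^ α = (‖x‖ ^ 2) ^ (α / 2) := by
    rw [← Real.rpow_natCast, ← Real.rpow_mul (norm_nonneg _)]
    congr 1
    push_cast
    ring
  rw [h1, Real.rpow_neg (rad_pos x).le, inv_mul_le_iff₀ (Real.rpow_pos_of_pos (rad_pos x) _),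
    mul_one]
  exact Real.rpow_le_rpow (sq_nonneg _) (le_add_of_nonneg_left zero_le_one) (by positivity)

/-- This is where `ρ = 1 - α/2` matters: `r · (r^{ρ/2-1})² = r^{-α/2}`, so `|∇G|²` factors into `k =
(ρ/d) h` and `l = k ⟨x⟩^{-α}`. Multiplying `l` by the potential `σ|x|^α` gives at most `σ k`. -/
theorem sum_grad_step_sq_le {h : ℝ → ℝ} {α ρ c d : ℝ} (hρ : ρ = 1 - α / 2) (hρ0 : 0 < ρ) (hd : 0 < d)
    (x : Conf n) :
    ∑ i, (2 * x i * (h (stepArg ρ c d (rad x)) * stepArg₁ ρ d (rad x))) ^ 2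
      ≤ (ρ / d * h (stepArg ρ c d (rad x))) * (ρ / d * profile h α ρ c d (rad x)) := by
  have hr0 := rad_pos x
  set H := h (stepArg ρ c d (rad x))
  set p := rad x ^ (ρ / 2 - 1) with hp
  have e1 : ∑ i, (2 * x i * (H * stepArg₁ ρ d (rad x))) ^ 2
      = (ρ / d) ^ 2 * H ^ 2 * (‖x‖ ^ 2 * p ^ 2) := by
    rw [← sum_coord_sq, Finset.sum_mul, Finset.mul_sum]
    refine Finset.sum_congr rfl fun i _ => ?_
    rw [stepArg₁, ← hp]
    field_simp
  have e2 : rad x * p ^ 2 = rad x ^ (-(α / 2)) := by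
    rw [hp, ← Real.rpow_natCast, ← Real.rpow_mul hr0.le]
    nth_rewrite 1 [← Real.rpow_one (rad x)]
    rw [← Real.rpow_add hr0]
    congr 1
    rw [hρ]
    push_cast
    ring
  have e3 : (ρ / d * H) * (ρ / d * profile h α ρ c d (rad x))
      = (ρ / d) ^ 2 * H ^ 2 * (rad x * p ^ 2) := by
    rw [e2, profile]
    ring
  rw [e1, e3]
  gcongr
  exact le_add_of_nonneg_left zero_le_one

section Step

variable {g h h₁ h₂ : ℝ → ℝ} {B : ℝ} (S : SmoothStep g h h₁ h₂ B)
include S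

theorem isMultiplier_step (ρ c d : ℝ) :
    IsMultiplier fun x : Conf n => g (stepArg ρ c d (rad x)) :=
  isMultiplier_of_continuous (S.cont_g.comp (continuous_comp_rad (continuousOn_stepArg ρ c d)))
    (B := 1) fun x => by rw [abs_of_nonneg (S.g_nonneg _)]; exact S.g_le_one _

theorem isMultiplier_step_deriv (ρ c d : ℝ) :
    IsMultiplier fun x : Conf n => h (stepArg ρ c d (rad x)) :=
  isMultiplier_of_continuous (S.cont_h.comp (continuous_comp_rad (continuousOn_stepArg ρ c d)))
    fun _ => S.h_le _

theorem formData_step (α ρ c d κ : ℝ) :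
    FormData (n := n) (fun x => g (stepArg ρ c d (rad x))) (fun x => κ * profile h α ρ c d (rad x))
      (fun i x => 2 * x i * (h (stepArg ρ c d (rad x)) * stepArg₁ ρ d (rad x)))
      (fun i x => 2 * x i * (κ * profile₁ h h₁ α ρ c d (rad x)))
      (fun i x => 2 * (κ * profile₁ h h₁ α ρ c d (rad x))
        + 4 * x i ^ 2 * (κ * profile₂ h h₁ h₂ α ρ c d (rad x))) :=
  formData_radial (Γ := fun r => g (stepArg ρ c d r))
    (Γ' := fun r => h (stepArg ρ c d r) * stepArg₁ ρ d r)
    (L := fun r => κ * profile h α ρ c d r) (L' := fun r => κ * profile₁ h h₁ α ρ c d r)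
    (L'' := fun r => κ * profile₂ h h₁ h₂ α ρ c d r)
    (fun r hr => (S.deriv_g _).comp r (hasDerivAt_stepArg ρ c d hr))
    ((S.cont_h.comp_continuousOn (continuousOn_stepArg ρ c d)).mul (continuousOn_stepArg₁ ρ d))
    (fun _ hr => (hasDerivAt_profile α ρ c d S hr).const_mul κ)
    (fun _ hr => (hasDerivAt_profile₁ α ρ c d S hr).const_mul κ)
    (continuousOn_const.mul (continuousOn_profile₂ α ρ c d S))

/-- The commutator of `H` with a step of width `δ T` located at `⟨x⟩^ρ ≥ c ≥ a T`. -/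
theorem exists_commutator_bound {α σ ρ : ℝ} (hα0 : 0 < α) (hα2 : α < 2) (hσ : 0 < σ)
    (hρ : ρ = 1 - α / 2) {V : Conf n → ℝ} (hV : Continuous V) {BV : ℝ} (hBV : ∀ x, |V x| ≤ BV)
    {a δ : ℝ} (ha : 0 < a) (hδ : 0 < δ) :
    ∃ C, 0 ≤ C ∧ ∀ T, 1 ≤ T → ∀ c, a * T ≤ c → ∀ u v : L2 n,
      (u, v) ∈ closure (coreGraph fun x : Conf n => -σ * ‖x‖ ^ α + V x : Set (L2 n × L2 n)) →
      |2 * (inner ℂ v (mulOp (fun x => g (stepArg ρ c (δ * T) (rad x))) u)).im|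
        ≤ 2 * ρ * √σ / (δ * T) * weight (fun x => h (stepArg ρ c (δ * T) (rad x))) u
          + C * T ^ (-(1 + α / ρ)) * (‖v‖ + ‖u‖) ^ 2 := by
  have hρ0 : 0 < ρ := by linarith
  have hρ1 : ρ ≤ 1 := by linarith
  have hB := S.B_nonneg
  have hBV0 : 0 ≤ BV := (abs_nonneg _).trans (hBV 0)
  have hδi : 0 < δ⁻¹ := inv_pos.2 hδ
  have hs0 : 0 < √σ := Real.sqrt_pos.2 hσ
  have hsi : 0 < (√σ)⁻¹ := inv_pos.2 hs0
  set K : ℝ := n * (B * (δ⁻¹ + 1)) + 2 * (B * (δ⁻¹ ^ 2 + 3 * δ⁻¹ + 2)) with hK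
  have hK0 : 0 ≤ K := by positivity
  have haε : 0 < a ^ (-(α / ρ)) := Real.rpow_pos_of_pos ha _
  refine ⟨(√σ)⁻¹ * (ρ / δ) * (K + B * BV + B) * a ^ (-(α / ρ)), by positivity, ?_⟩
  intro T hT c hc u v huv
  have hT0 : 0 < T := zero_lt_one.trans_le hT
  set d := δ * T with hd
  have hd0 : 0 < d := mul_pos hδ hT0
  have hδd : δ ≤ d := le_mul_of_one_le_right hδ.le hT
  set κ := ρ / d with hκ
  have hκ0 : 0 < κ := div_pos hρ0 hd0
  set Aε := (a * T) ^ (-(α / ρ)) with hAε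
  have hAε0 : 0 < Aε := Real.rpow_pos_of_pos (mul_pos ha hT0) _
  set Hx : Conf n → ℝ := fun x => h (stepArg ρ c d (rad x)) with hHx
  have mH : IsMultiplier Hx := isMultiplier_step_deriv S ρ c d
  have hH0 : ∀ x, 0 ≤ Hx x := fun x => S.h_nonneg _
  have bounds := fun x : Conf n =>
    profile_bounds_of_le S hα0 hα2 hρ0 hρ1 hδ hδd (mul_pos ha hT0) hc (one_le_rad x)
  have hF := formData_step (n := n) S α ρ c d κ
  have hl0 : ∀ x : Conf n, 0 ≤ κ * profile h α ρ c d (rad x) := fun x =>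
    mul_nonneg hκ0.le (mul_nonneg (S.h_nonneg _) (Real.rpow_nonneg (rad_pos x).le _))
  have hlb : ∀ x : Conf n, |κ * profile h α ρ c d (rad x)| ≤ κ * (B * Aε) := fun x => by
    rw [abs_mul, abs_of_pos hκ0]
    exact mul_le_mul_of_nonneg_left (bounds x).1 hκ0.le
  have mG := isMultiplier_step (n := n) S ρ c d
  have ml : IsMultiplier fun x : Conf n => κ * profile h α ρ c d (rad x) :=
    isMultiplier_of_continuous hF.contl hlb
  set W : Conf n → ℝ := fun x => -σ * ‖x‖ ^ α + V x with hW
  have hWc : Continuous W :=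
    (continuous_const.mul (continuous_norm.rpow_const fun _ => Or.inr hα0.le)).add hV
  set Sl : Conf n → ℝ := fun x => ∑ i, (2 * (κ * profile₁ h h₁ α ρ c d (rad x))
        + 4 * x i ^ 2 * (κ * profile₂ h h₁ h₂ α ρ c d (rad x))) with hSl
  have hSl_le : ∀ x, |Sl x / 2| ≤ κ * (K * Aε) := fun x => by
    obtain ⟨-, p1, p2⟩ := bounds x
    have e : Sl x / 2 = κ * (n * profile₁ h h₁ α ρ c d (rad x)
        + 2 * (‖x‖ ^ 2 * profile₂ h h₁ h₂ α ρ c d (rad x))) := by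
      rw [hSl]
      simp only
      rw [sum_radial]
      ring
    rw [e, abs_mul, abs_of_pos hκ0]
    refine mul_le_mul_of_nonneg_left ((abs_add_le _ _).trans ?_) hκ0.le
    have t1 : |(n : ℝ) * profile₁ h h₁ α ρ c d (rad x)| ≤ n * (B * (δ⁻¹ + 1) * Aε) := by
      rw [abs_mul, Nat.abs_cast]
      gcongr
    have t2 : |2 * (‖x‖ ^ 2 * profile₂ h h₁ h₂ α ρ c d (rad x))|
        ≤ 2 * (B * (δ⁻¹ ^ 2 + 3 * δ⁻¹ + 2) * Aε) := by
      rw [abs_mul, abs_two, abs_mul, abs_of_nonneg (sq_nonneg ‖x‖)]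
      refine mul_le_mul_of_nonneg_left (le_trans ?_ p2) zero_le_two
      exact mul_le_mul_of_nonneg_right (le_add_of_nonneg_left zero_le_one) (abs_nonneg _)
    refine (add_le_add t1 t2).trans_eq ?_
    rw [hK]
    ring
  have hlW : ∀ x, κ * profile h α ρ c d (rad x) * ‖x‖ ^ α ≤ κ * Hx x := fun x => by
    rw [profile, mul_assoc, mul_assoc]
    refine mul_le_mul_of_nonneg_left ?_ hκ0.le
    calc _ ≤ Hx x * 1 := mul_le_mul_of_nonneg_left (rpow_norm_mul_rad_le hα0 x) (hH0 x)
      _ = Hx x := mul_one _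
  have hlV : ∀ x, |κ * profile h α ρ c d (rad x) * V x| ≤ κ * (B * Aε) * BV := fun x => by
    rw [abs_mul]
    exact mul_le_mul (hlb x) (hBV x) (abs_nonneg _) (by positivity)
  -- The parameter `λ = √σ` balances `λ κ h` against the term `λ⁻¹ σ κ h` coming from `-l W`, and
  -- yields the optimal constant `2√σ κ`.
  set N : Conf n → ℝ := fun x => √σ * (κ * Hx x)
    + (√σ)⁻¹ * (Sl x / 2 - κ * profile h α ρ c d (rad x) * W x) with hN
  have hNc : Continuous N := by
    have c1 : Continuous Hx := S.cont_h.comp (continuous_comp_rad (continuousOn_stepArg ρ c d))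
    have c2 : Continuous Sl := continuous_finsetSum _ fun i _ => hF.contl₂ i
    exact (continuous_const.mul (continuous_const.mul c1)).add
      (continuous_const.mul ((c2.div_const 2).sub (hF.contl.mul hWc)))
  have hlWle : ∀ x, |κ * profile h α ρ c d (rad x) * W x| ≤ κ * B * σ + κ * (B * Aε) * BV :=
    fun x => by
    have e : κ * profile h α ρ c d (rad x) * W x
        = -(κ * profile h α ρ c d (rad x) * ‖x‖ ^ α * σ)
          + κ * profile h α ρ c d (rad x) * V x := by
      rw [hW]
      ring
    rw [e]
    refine (abs_add_le _ _).trans (add_le_add ?_ (hlV x))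
    have h0 : 0 ≤ κ * profile h α ρ c d (rad x) * ‖x‖ ^ α :=
      mul_nonneg (hl0 x) (Real.rpow_nonneg (norm_nonneg _) _)
    rw [abs_neg, abs_mul, abs_of_nonneg h0, abs_of_pos hσ]
    exact mul_le_mul_of_nonneg_right ((hlW x).trans
      (mul_le_mul_of_nonneg_left ((le_abs_self _).trans (S.h_le _)) hκ0.le)) hσ.le
  have mN : IsMultiplier N := by
    refine isMultiplier_of_continuous hNc (B := √σ * (κ * B)
      + (√σ)⁻¹ * (κ * (K * Aε) + (κ * B * σ + κ * (B * Aε) * BV))) fun x => ?_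
    refine (abs_add_le _ _).trans ?_
    rw [abs_mul, abs_mul κ, abs_of_pos hs0, abs_of_pos hκ0, abs_mul, abs_of_pos hsi]
    gcongr
    · exact S.h_le _
    · exact (abs_sub _ _).trans (add_le_add (hSl_le x) (hlWle x))
  have hNle : ∀ x, N x ≤ (2 * √σ * κ) * Hx x + (√σ)⁻¹ * (κ * (K + B * BV) * Aε) := fun x => by
    have e : N x = √σ * (κ * Hx x) + (√σ)⁻¹ * (σ * (κ * profile h α ρ c d (rad x) * ‖x‖ ^ α))
        + (√σ)⁻¹ * (Sl x / 2 - κ * profile h α ρ c d (rad x) * V x) := by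
      rw [hN, hW]
      ring
    have hσs : (√σ)⁻¹ * (σ * (κ * Hx x)) = √σ * (κ * Hx x) := by
      nth_rewrite 2 [← Real.mul_self_sqrt hσ.le]
      field_simp
    have t1 : (√σ)⁻¹ * (σ * (κ * profile h α ρ c d (rad x) * ‖x‖ ^ α)) ≤ √σ * (κ * Hx x) := by
      rw [← hσs]
      exact mul_le_mul_of_nonneg_left (mul_le_mul_of_nonneg_left (hlW x) hσ.le) hsi.le
    have t2 : (√σ)⁻¹ * (Sl x / 2 - κ * profile h α ρ c d (rad x) * V x)
        ≤ (√σ)⁻¹ * (κ * (K + B * BV) * Aε) := by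
      refine mul_le_mul_of_nonneg_left ?_ hsi.le
      have a1 := (le_abs_self _).trans (hSl_le x)
      have a2 := (neg_le_abs _).trans (hlV x)
      linarith
    rw [e]
    linarith
  have hcont : Continuous fun x => κ * Hx x := continuous_const.mul
    (S.cont_h.comp (continuous_comp_rad (continuousOn_stepArg ρ c d)))
  have key := abs_two_mul_im_inner_le hF hcont (fun x => mul_nonneg hκ0.le (hH0 x)) hl0
    (fun x => sum_grad_step_sq_le hρ hρ0 hd0 x) hs0 mG ml mN huv
  refine key.trans ?_
  have mU : IsMultiplier fun x => (2 * √σ * κ) * Hx x + (√σ)⁻¹ * (κ * (K + B * BV) * Aε) := by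
    obtain ⟨b, hb⟩ := mH.bounded
    refine ⟨(measurable_const.mul mH.measurable).add measurable_const,
      (2 * √σ * κ) * b + |(√σ)⁻¹ * (κ * (K + B * BV) * Aε)|, fun x => ?_⟩
    refine (abs_add_le _ _).trans (add_le_add ?_ le_rfl)
    rw [abs_mul, abs_of_pos (by positivity : 0 < 2 * √σ * κ)]
    gcongr
    exact hb x
  have w1 := weight_mono mN mU hNle u
  rw [weight_const_mul_add mH] at w1
  have w2 : (inner ℂ v (mulOp (fun x : Conf n => κ * profile h α ρ c d (rad x)) u)).re
      ≤ κ * (B * Aε) * (‖v‖ * ‖u‖) := by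
    refine (Complex.re_le_norm _).trans ((norm_inner_le_norm _ _).trans ?_)
    calc _ ≤ ‖v‖ * (κ * (B * Aε) * ‖u‖) := by
          gcongr
          exact norm_mulOp_le ml.measurable hlb u
      _ = _ := by ring
  have hTε : T ^ (-(1 + α / ρ)) = T⁻¹ * T ^ (-(α / ρ)) := by
    rw [neg_add, Real.rpow_add hT0, Real.rpow_neg_one]
  have hsq1 : ‖u‖ ^ 2 ≤ (‖v‖ + ‖u‖) ^ 2 := by
    gcongr
    exact le_add_of_nonneg_left (norm_nonneg _)
  have hsq2 : ‖v‖ * ‖u‖ ≤ (‖v‖ + ‖u‖) ^ 2 := by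
    nlinarith [norm_nonneg u, norm_nonneg v, sq_nonneg ‖u‖, sq_nonneg ‖v‖]
  have hconst : (√σ)⁻¹ * (ρ / δ) * (K + B * BV + B) * a ^ (-(α / ρ)) * T ^ (-(1 + α / ρ))
      = (√σ)⁻¹ * (κ * (K + B * BV) * Aε) + (√σ)⁻¹ * (κ * (B * Aε)) := by
    rw [hTε, hκ, hAε, hd, Real.mul_rpow ha.le hT0.le]
    field_simp
  calc _ ≤ (2 * √σ * κ * weight Hx u + (√σ)⁻¹ * (κ * (K + B * BV) * Aε) * ‖u‖ ^ 2)
        + (√σ)⁻¹ * (κ * (B * Aε) * (‖v‖ * ‖u‖)) := by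
        gcongr
    _ ≤ (2 * √σ * κ * weight Hx u + (√σ)⁻¹ * (κ * (K + B * BV) * Aε) * (‖v‖ + ‖u‖) ^ 2)
        + (√σ)⁻¹ * (κ * (B * Aε) * (‖v‖ + ‖u‖) ^ 2) := by
        gcongr
    _ = 2 * √σ * κ * weight Hx u + ((√σ)⁻¹ * (κ * (K + B * BV) * Aε)
        + (√σ)⁻¹ * (κ * (B * Aε))) * (‖v‖ + ‖u‖) ^ 2 := by ring
    _ = _ := by
        rw [hconst, hκ]
        ring

end Step

end Repulsive

namespace Repulsive

variable {n : ℕ}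

/-! ### Evolution of radial steps -/

/-- The step `g((⟨x⟩^ρ - c) / d)`. -/
noncomputable def stepFun (g : ℝ → ℝ) (ρ c d : ℝ) (x : Conf n) : ℝ := g (stepArg ρ c d (rad x))

theorem inner_mulOp_comm {m : Conf n → ℝ} (hm : IsMultiplier m) (u v : L2 n) :
    (inner ℂ u (mulOp m v)).re = (inner ℂ v (mulOp m u)).re := by
  rw [re_inner_mulOp hm, re_inner_mulOp hm]
  congr 1
  ext x
  simp only [Complex.mul_re, Complex.conj_re, Complex.conj_im]
  ring

theorem abs_im_inner_mulOp_le {m : Conf n → ℝ} (hm : IsMultiplier m) (hm0 : ∀ x, 0 ≤ m x)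
    (u v : L2 n) : |(inner ℂ u (mulOp m v)).im| ≤ (weight m u + weight m v) / 2 := by
  rw [im_inner_mulOp hm, weight, weight, ← integral_add (integrable_weight hm u)
    (integrable_weight hm v), ← integral_div]
  refine (abs_integral_le_integral_abs).trans (integral_mono (integrable_im_inner hm u v).abs
    (((integrable_weight hm u).add (integrable_weight hm v)).div_const 2) fun x => ?_)
  simp only
  rw [abs_mul, abs_of_nonneg (hm0 x), ← mul_add, mul_div_assoc]
  refine mul_le_mul_of_nonneg_left ?_ (hm0 x)
  refine (Complex.abs_im_le_norm _).trans ?_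
  rw [norm_mul, RCLike.norm_conj]
  nlinarith [sq_nonneg (‖u x‖ - ‖v x‖)]

section Step

variable {g h h₁ h₂ : ℝ → ℝ} {B : ℝ} (S : SmoothStep g h h₁ h₂ B)
include S

theorem isMultiplier_stepFun (ρ c d : ℝ) : IsMultiplier (stepFun (n := n) g ρ c d) :=
  isMultiplier_step S ρ c d

theorem isMultiplier_stepFun_deriv (ρ c d : ℝ) : IsMultiplier (stepFun (n := n) h ρ c d) :=
  isMultiplier_step_deriv S ρ c d

/-- The Taylor remainder of `g` is quadratic uniformly in its argument, hence in `x`, so the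
derivative exists in operator norm. -/
theorem hasDerivAt_mulCLM_step (ρ c b d t : ℝ) :
    HasDerivAt (fun t => (mulCLM (stepFun (n := n) g ρ (c + b * t) d)
        (isMultiplier_stepFun S ρ (c + b * t) d)).restrictScalars ℝ)
      (-(b / d) • (mulCLM (stepFun (n := n) h ρ (c + b * t) d)
        (isMultiplier_stepFun_deriv S ρ (c + b * t) d)).restrictScalars ℝ) t := by
  have hB := S.B_nonneg
  refine hasDerivAt_of_norm_sub_le_sq (C := B * (b / d) ^ 2) fun τ => ?_
  refine ContinuousLinearMap.opNorm_le_bound _ (by positivity) fun u => ?_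
  have e : stepFun (n := n) g ρ (c + b * (t + τ)) d
      = fun x => g (stepArg ρ (c + b * t) d (rad x) + -(τ * (b / d))) := by
    ext x
    rw [stepFun, stepArg, stepArg]
    congr 1
    ring
  have m1 := isMultiplier_stepFun (n := n) S ρ (c + b * (t + τ)) d
  have m2 := isMultiplier_stepFun (n := n) S ρ (c + b * t) d
  have m3 := isMultiplier_stepFun_deriv (n := n) S ρ (c + b * t) d
  change ‖mulOp (stepFun g ρ (c + b * (t + τ)) d) u - mulOp (stepFun g ρ (c + b * t) d) u
    - τ • -(b / d) • mulOp (stepFun h ρ (c + b * t) d) u‖ ≤ _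
  refine Lp.norm_le_mul_norm_of_ae_le_mul ?_
  filter_upwards [m1.coeFn_mulOp u, m2.coeFn_mulOp u, m3.coeFn_mulOp u,
    Lp.coeFn_sub (mulOp (stepFun g ρ (c + b * (t + τ)) d) u - mulOp (stepFun g ρ (c + b * t) d) u)
      (τ • -(b / d) • mulOp (stepFun h ρ (c + b * t) d) u),
    Lp.coeFn_sub (mulOp (stepFun g ρ (c + b * (t + τ)) d) u) (mulOp (stepFun g ρ (c + b * t) d) u),
    Lp.coeFn_smul τ (-(b / d) • mulOp (stepFun h ρ (c + b * t) d) u),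
    Lp.coeFn_smul (-(b / d)) (mulOp (stepFun h ρ (c + b * t) d) u)] with x a1 a2 a3 a4 a5 a6 a7
  rw [a4, Pi.sub_apply, a5, Pi.sub_apply, a6, Pi.smul_apply, a7, Pi.smul_apply, a1, a2, a3, e]
  have hT := S.abs_taylor_le (stepArg ρ (c + b * t) d (rad x)) (-(τ * (b / d)))
  have e2 : ((g (stepArg ρ (c + b * t) d (rad x) + -(τ * (b / d))) : ℝ) : ℂ) * u x
      - ((stepFun g ρ (c + b * t) d x : ℝ) : ℂ) * u x
      - τ • -(b / d) • (((stepFun h ρ (c + b * t) d x : ℝ) : ℂ) * u x)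
      = ((g (stepArg ρ (c + b * t) d (rad x) + -(τ * (b / d)))
        - g (stepArg ρ (c + b * t) d (rad x))
        - -(τ * (b / d)) * h (stepArg ρ (c + b * t) d (rad x)) : ℝ) : ℂ) * u x := by
    simp only [stepFun, Complex.real_smul]
    push_cast
    ring
  rw [e2, norm_mul, Complex.norm_real, Real.norm_eq_abs]
  refine mul_le_mul_of_nonneg_right (hT.trans_eq ?_) (norm_nonneg _)
  ring

/-- The Heisenberg derivative. Shifting the step outwards at speed `b` contributes the nonpositive
term `-(b/d) ∫ h |u|²` when `b/d ≥ 0`, which is there to absorb the main part of the commutator. -/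
theorem hasDerivAt_weight_step {u : ℝ → L2 n} {v : L2 n} (ρ c b d : ℝ) {t : ℝ}
    (hu : HasDerivAt u (-Complex.I • v) t) :
    HasDerivAt (fun t => weight (stepFun g ρ (c + b * t) d) (u t))
      (-(2 * (inner ℂ v (mulOp (stepFun g ρ (c + b * t) d) (u t))).im)
        - b / d * weight (stepFun h ρ (c + b * t) d) (u t)) t := by
  have m := fun t => isMultiplier_stepFun (n := n) S ρ (c + b * t) d
  have m' := isMultiplier_stepFun_deriv (n := n) S ρ (c + b * t) d
  have h1 := (hasDerivAt_mulCLM_step (n := n) S ρ c b d t).clm_apply hu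
  have h2 := HasDerivAt.inner ℂ hu h1
  have h3 := Complex.reCLM.hasFDerivAt.comp_hasDerivAt t h2
  have e : (fun t => weight (stepFun g ρ (c + b * t) d) (u t)) = Complex.reCLM ∘ fun t =>
      inner ℂ (u t) (((mulCLM (stepFun (n := n) g ρ (c + b * t) d)
        (isMultiplier_stepFun S ρ (c + b * t) d)).restrictScalars ℝ) (u t)) := by
    ext t
    change _ = (inner ℂ (u t) (mulOp (stepFun g ρ (c + b * t) d) (u t))).re
    rw [inner_mulOp_self (m t), Complex.ofReal_re]
  rw [e]
  refine h3.congr_deriv ?_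
  change (inner ℂ (u t) (-(b / d) • mulOp (stepFun h ρ (c + b * t) d) (u t)
      + mulOp (stepFun g ρ (c + b * t) d) (-Complex.I • v))
    + inner ℂ (-Complex.I • v) (mulOp (stepFun g ρ (c + b * t) d) (u t))).re = _
  have e1 : (inner ℂ (-Complex.I • v) (mulOp (stepFun g ρ (c + b * t) d) (u t))).re
      = -(inner ℂ v (mulOp (stepFun g ρ (c + b * t) d) (u t))).im := by
    rw [inner_smul_left]
    simp
  have e2 : -(b / d) • mulOp (stepFun h ρ (c + b * t) d) (u t)
      = ((-(b / d) : ℝ) : ℂ) • mulOp (stepFun h ρ (c + b * t) d) (u t) :=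
    (algebraMap_smul ℂ (-(b / d)) (mulOp (stepFun h ρ (c + b * t) d) (u t))).symm
  rw [inner_add_right, Complex.add_re, Complex.add_re, inner_mulOp_comm (m t), e1, e2,
    inner_smul_right, inner_mulOp_self m', ← Complex.ofReal_mul, Complex.ofReal_re]
  ring

end Step

/-- The evolution `e^{-itH} (H + i)⁻² w` of `H = -Δ + W`. -/
noncomputable def evol (W : Conf n → ℝ) (t : ℝ) (w : L2 n) : L2 n :=
  propagator (schrodingerOp W) t (resolventI (schrodingerOp W) (resolventI (schrodingerOp W) w))

/-! ### Mass outside fixed and moving spheres along the evolution. -/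

variable {W : Conf n → ℝ} (hH : IsSelfAdjoint (schrodingerOp W))
include hH

theorem resolventI_mem_closure_coreGraph (w : L2 n) :
    (resolventI (schrodingerOp W) w, w - Complex.I • resolventI (schrodingerOp W) w)
      ∈ closure (coreGraph W : Set (L2 n × L2 n)) := by
  rw [← apply_resolventI hH w (resolventI_mem hH w)]
  exact mem_closure_coreGraph ⟨_, resolventI_mem hH w⟩

theorem norm_sub_add_norm_resolventI_le (w : L2 n) :
    ‖w - Complex.I • resolventI (schrodingerOp W) w‖ + ‖resolventI (schrodingerOp W) w‖
      ≤ 3 * ‖w‖ := by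
  have h1 := norm_resolventI_le hH w
  have h2 := norm_sub_le w (Complex.I • resolventI (schrodingerOp W) w)
  rw [norm_smul, Complex.norm_I, one_mul] at h2
  linarith

theorem continuous_evol (w : L2 n) : Continuous fun t => evol W t w :=
  continuous_iff_continuousAt.2 fun t => (hasDerivAt_propagator_resolventI_sq hH t w).continuousAt

theorem norm_evol_le (t : ℝ) (w : L2 n) : ‖evol W t w‖ ≤ ‖w‖ :=
  (norm_propagator_resolventI_le hH t _).trans (norm_resolventI_le hH w)

theorem evol_zero (w : L2 n) :
    evol W 0 w = resolventI (schrodingerOp W) (resolventI (schrodingerOp W) w) :=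
  propagator_zero_resolventI hH _

variable {g h h₁ h₂ : ℝ → ℝ} {B : ℝ} (S : SmoothStep g h h₁ h₂ B)
include S

/-- The vector `v` is `H` applied to the evolved state. Its norm is controlled by `‖w‖` because one
of the two resolvents pays for `H`. -/
theorem hasDerivAt_weight_evol (t : ℝ) (w : L2 n) :
    ∃ v : L2 n, (evol W t w, v) ∈ closure (coreGraph W : Set (L2 n × L2 n)) ∧
      ‖v‖ + ‖evol W t w‖ ≤ 3 * ‖w‖ ∧ ∀ ρ c b d : ℝ,
      HasDerivAt (fun t => weight (stepFun g ρ (c + b * t) d) (evol W t w))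
        (-(2 * (inner ℂ v (mulOp (stepFun g ρ (c + b * t) d) (evol W t w))).im)
          - b / d * weight (stepFun h ρ (c + b * t) d) (evol W t w)) t := by
  have hmem := propagator_resolventI_sq_mem hH t w
  refine ⟨schrodingerOp W ⟨_, hmem⟩, mem_closure_coreGraph ⟨_, hmem⟩, ?_, fun ρ c b d =>
    hasDerivAt_weight_step S ρ c b d (hasDerivAt_propagator_resolventI_sq hH t w)⟩
  have h1 := norm_evol_le hH t w
  have h2 := norm_propagator_resolventI_le hH t w
  rw [apply_propagator_resolventI_sq hH]
  have h3 := norm_sub_le (propagator (schrodingerOp W) t (resolventI (schrodingerOp W) w))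
    (Complex.I • evol W t w)
  rw [norm_smul, Complex.norm_I, one_mul] at h3
  change ‖propagator (schrodingerOp W) t (resolventI (schrodingerOp W) w)
    - Complex.I • evol W t w‖ + _ ≤ _
  linarith

omit hH S in
/-- The commutator of `-Δ + W` with steps of width `δ T` located at `⟨x⟩^ρ ≥ a T` is of order
`b / (δ T)` on the step, up to an error of order `T^{-1-ε}`. -/
def CommutatorBound (W : Conf n → ℝ) (g h : ℝ → ℝ) (ρ a δ b ε C : ℝ) : Prop :=
  ∀ T, 1 ≤ T → ∀ c, a * T ≤ c → ∀ u v : L2 n,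
    (u, v) ∈ closure (coreGraph W : Set (L2 n × L2 n)) →
    |2 * (inner ℂ v (mulOp (stepFun g ρ c (δ * T)) u)).im|
      ≤ b / (δ * T) * weight (stepFun h ρ c (δ * T)) u
        + C * T ^ (-(1 + ε)) * (‖v‖ + ‖u‖) ^ 2

variable {ρ a δ b ε C : ℝ} (hC : CommutatorBound W g h ρ a δ b ε C)
include hC

omit hH in
-- Without motion nothing cancels, but the main term is itself `O(1/T)`, since the step has width
-- `δT` and `h ≤ B`.
theorem static_commutator_le (hδ : 0 < δ) (hb : 0 ≤ b) (hε : 0 ≤ ε) (hC0 : 0 ≤ C)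
    {T : ℝ} (hT : 1 ≤ T) {c : ℝ} (hc : a * T ≤ c) {u v : L2 n} {w : L2 n}
    (huv : (u, v) ∈ closure (coreGraph W : Set (L2 n × L2 n))) (hw : ‖v‖ + ‖u‖ ≤ 3 * ‖w‖) :
    |2 * (inner ℂ v (mulOp (stepFun g ρ c (δ * T)) u)).im|
      ≤ 9 * (b / δ * B + C) * T⁻¹ * ‖w‖ ^ 2 := by
  have hT0 : 0 < T := zero_lt_one.trans_le hT
  have hB := S.B_nonneg
  have hu : ‖u‖ ≤ ‖v‖ + ‖u‖ := le_add_of_nonneg_left (norm_nonneg _)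
  have h1 : weight (stepFun h ρ c (δ * T)) u ≤ B * (‖v‖ + ‖u‖) ^ 2 :=
    (weight_le_of_le (isMultiplier_stepFun_deriv S ρ c (δ * T))
      (fun x => (le_abs_self _).trans (S.h_le _)) u).trans (by gcongr)
  have h2 : T ^ (-(1 + ε)) ≤ T⁻¹ := by
    rw [← Real.rpow_neg_one]
    exact Real.rpow_le_rpow_of_exponent_le hT (by linarith)
  calc _ ≤ b / (δ * T) * weight (stepFun h ρ c (δ * T)) u
        + C * T ^ (-(1 + ε)) * (‖v‖ + ‖u‖) ^ 2 := hC T hT c hc u v huv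
    _ ≤ b / (δ * T) * (B * (‖v‖ + ‖u‖) ^ 2) + C * T⁻¹ * (‖v‖ + ‖u‖) ^ 2 := by gcongr
    _ = (b / δ * B + C) * T⁻¹ * (‖v‖ + ‖u‖) ^ 2 := by field_simp
    _ ≤ (b / δ * B + C) * T⁻¹ * (3 * ‖w‖) ^ 2 := by gcongr
    _ = _ := by ring

/-- For `u = (H + i)⁻¹ w` one has `Hu = w - iu`, so `Im⟨Hu, Gu⟩ = Im⟨w, Gu⟩ + ⟨u, Gu⟩`. The left
side is half a commutator, and the cross term costs at most half of each mass. -/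
theorem weight_resolventI_le (hδ : 0 < δ) (hb : 0 ≤ b) (hε : 0 ≤ ε) (hC0 : 0 ≤ C)
    {T : ℝ} (hT : 1 ≤ T) {c : ℝ} (hc : a * T ≤ c) (w : L2 n) :
    weight (stepFun g ρ c (δ * T)) (resolventI (schrodingerOp W) w)
      ≤ weight (stepFun g ρ c (δ * T)) w + 9 * (b / δ * B + C) * T⁻¹ * ‖w‖ ^ 2 := by
  have m := isMultiplier_stepFun (n := n) S ρ c (δ * T)
  have h1 := static_commutator_le S hC hδ hb hε hC0 hT hc (resolventI_mem_closure_coreGraph hH w)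
    (norm_sub_add_norm_resolventI_le hH w)
  set v := resolventI (schrodingerOp W) w
  have h2 := abs_im_inner_mulOp_le m (fun x => S.g_nonneg _) w v
  have e : (inner ℂ (w - Complex.I • v) (mulOp (stepFun g ρ c (δ * T)) v)).im
      = (inner ℂ w (mulOp (stepFun g ρ c (δ * T)) v)).im
        + weight (stepFun g ρ c (δ * T)) v := by
    rw [inner_sub_left, inner_smul_left, inner_mulOp_self m]
    simp
  rw [e] at h1
  have h3 := (abs_le.1 h1).2
  have h4 := (abs_le.1 h2).1
  linarith

theorem weight_evol_static_le (hδ : 0 < δ) (hb : 0 ≤ b) (hε : 0 ≤ ε) (hC0 : 0 ≤ C)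
    {T : ℝ} (hT : 1 ≤ T) {c : ℝ} (hc : a * T ≤ c) (s : ℝ) (w : L2 n) :
    weight (stepFun g ρ c (δ * T)) (evol W s w) ≤ weight (stepFun g ρ c (δ * T)) (evol W 0 w)
      + 9 * (b / δ * B + C) * T⁻¹ * ‖w‖ ^ 2 * |s| := by
  choose v hv1 hv2 hv3 using fun t => hasDerivAt_weight_evol hH S t w
  have hd : ∀ t, HasDerivAt (fun t => weight (stepFun g ρ c (δ * T)) (evol W t w))
      (-(2 * (inner ℂ (v t) (mulOp (stepFun g ρ c (δ * T)) (evol W t w))).im)) t := fun t => by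
    simpa using hv3 t ρ c 0 (δ * T)
  have := convex_univ.norm_image_sub_le_of_norm_hasDerivWithin_le
    (C := 9 * (b / δ * B + C) * T⁻¹ * ‖w‖ ^ 2)
    (fun t _ => (hd t).hasDerivWithinAt) (fun t _ => by
      rw [norm_neg, Real.norm_eq_abs]
      exact static_commutator_le S hC hδ hb hε hC0 hT hc (hv1 t) (hv2 t))
    (Set.mem_univ 0) (Set.mem_univ s)
  rw [Real.norm_eq_abs, Real.norm_eq_abs, sub_zero] at this
  linarith [le_abs_self (weight (stepFun g ρ c (δ * T)) (evol W s w)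
    - weight (stepFun g ρ c (δ * T)) (evol W 0 w))]

/-- The shift of the step at speed `b` cancels the commutator's main term exactly; what remains is
`O(T^{-1-ε})` per unit time over a time `T`. -/
theorem weight_evol_moving_le (hb : 0 ≤ b) (hC0 : 0 ≤ C) {T : ℝ} (hT : 1 ≤ T) (s : ℝ) (w : L2 n) :
    weight (stepFun g ρ (a * T + b * T) (δ * T)) (evol W (T + s) w)
      ≤ weight (stepFun g ρ (a * T) (δ * T)) (evol W s w) + 9 * C * T ^ (-ε) * ‖w‖ ^ 2 := by
  have hT0 : 0 < T := zero_lt_one.trans_le hT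
  choose v hv1 hv2 hv3 using fun t => hasDerivAt_weight_evol hH S t w
  have hd := fun t => hv3 t ρ (a * T - b * s) b (δ * T)
  have hle := (convex_Icc s (T + s)).image_sub_le_mul_sub_of_deriv_le
    (f := fun t => weight (stepFun g ρ (a * T - b * s + b * t) (δ * T)) (evol W t w))
    (C := C * T ^ (-(1 + ε)) * (3 * ‖w‖) ^ 2)
    (fun t _ => (hd t).continuousAt.continuousWithinAt)
    (fun t _ => (hd t).differentiableAt.differentiableWithinAt)
    (fun t ht => by
      rw [(hd t).deriv]
      rw [interior_Icc] at ht
      -- The centre starts at `aT` at time `s` and only moves outwards, so it stays where the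
      -- commutator bound applies.
      have hc : a * T ≤ a * T - b * s + b * t := by nlinarith [ht.1]
      have h1 := hC T hT _ hc _ _ (hv1 t)
      have h2 : C * T ^ (-(1 + ε)) * (‖v t‖ + ‖evol W t w‖) ^ 2
          ≤ C * T ^ (-(1 + ε)) * (3 * ‖w‖) ^ 2 := by
        gcongr
        exact hv2 t
      have h3 := (abs_le.1 h1).1
      linarith)
    s (Set.left_mem_Icc.2 (by linarith)) (T + s) (Set.right_mem_Icc.2 (by linarith)) (by linarith)
  have e1 : a * T - b * s + b * (T + s) = a * T + b * T := by ring
  have e2 : a * T - b * s + b * s = a * T := by ring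
  simp only [e1, e2] at hle
  have e3 : C * T ^ (-(1 + ε)) * (3 * ‖w‖) ^ 2 * (T + s - s) = 9 * C * T ^ (-ε) * ‖w‖ ^ 2 := by
    rw [neg_add, Real.rpow_add hT0, Real.rpow_neg_one]
    field_simp
    ring
  rw [e3] at hle
  linarith

/-- Propagation bound for the evolution of data whose step mass is `O(1/T)`. -/
theorem weight_evol_le (hδ : 0 < δ) (hb : 0 ≤ b) (hε : 0 ≤ ε) (hC0 : 0 ≤ C)
    {T : ℝ} (hT : 1 ≤ T) (s : ℝ) {w : L2 n} {D : ℝ}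
    (hw : weight (stepFun g ρ (a * T) (δ * T)) w ≤ D * T⁻¹) :
    weight (stepFun g ρ (a * T + b * T) (δ * T)) (evol W (T + s) w)
      ≤ (D + 27 * (b / δ * B + C) * ‖w‖ ^ 2) * (1 + |s|) * T ^ (-min 1 ε) := by
  have hT0 : 0 < T := zero_lt_one.trans_le hT
  have hB := S.B_nonneg
  have hc : a * T ≤ a * T := le_rfl
  have h1 := weight_evol_moving_le hH S hC hb hC0 hT s w
  have h2 := weight_evol_static_le hH S hC hδ hb hε hC0 hT hc s w
  -- The bound is applied twice, once for each resolvent in the initial state of `evol`.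
  have h3 := weight_resolventI_le hH S hC hδ hb hε hC0 hT hc (resolventI (schrodingerOp W) w)
  have h4 := weight_resolventI_le hH S hC hδ hb hε hC0 hT hc w
  rw [evol_zero hH] at h2
  have h5 : ‖resolventI (schrodingerOp W) w‖ ^ 2 ≤ ‖w‖ ^ 2 := by
    gcongr
    exact norm_resolventI_le hH w
  have hK : 0 ≤ b / δ * B + C := by positivity
  have hD : 0 ≤ D := by
    have := (weight_nonneg (fun x => S.g_nonneg _) w).trans hw
    exact nonneg_of_mul_nonneg_left this (inv_pos.2 hT0)
  have t1 : T⁻¹ ≤ T ^ (-min 1 ε) := by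
    rw [← Real.rpow_neg_one]
    exact Real.rpow_le_rpow_of_exponent_le hT (neg_le_neg (min_le_left _ _))
  have t2 : T ^ (-ε) ≤ T ^ (-min 1 ε) :=
    Real.rpow_le_rpow_of_exponent_le hT (neg_le_neg (min_le_right _ _))
  have hTi : 0 < T⁻¹ := inv_pos.2 hT0
  have hτ : 0 < T ^ (-min 1 ε) := Real.rpow_pos_of_pos hT0 _
  set τ := T ^ (-min 1 ε)
  set K := b / δ * B + C with hKdef
  have hCK : C ≤ K := le_add_of_nonneg_left (by positivity)
  calc weight (stepFun g ρ (a * T + b * T) (δ * T)) (evol W (T + s) w)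
      ≤ D * T⁻¹ + 9 * K * T⁻¹ * ‖w‖ ^ 2 + 9 * K * T⁻¹ * ‖w‖ ^ 2
        + 9 * K * T⁻¹ * ‖w‖ ^ 2 * |s| + 9 * C * T ^ (-ε) * ‖w‖ ^ 2 := by
        have : 9 * K * T⁻¹ * ‖resolventI (schrodingerOp W) w‖ ^ 2 ≤ 9 * K * T⁻¹ * ‖w‖ ^ 2 := by
          gcongr
        linarith
    _ ≤ D * τ + 9 * K * τ * ‖w‖ ^ 2 + 9 * K * τ * ‖w‖ ^ 2
        + 9 * K * τ * ‖w‖ ^ 2 * |s| + 9 * K * τ * ‖w‖ ^ 2 := by gcongr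
    _ = D * τ * 1 + 9 * K * τ * ‖w‖ ^ 2 * (3 + |s|) := by ring
    _ ≤ D * τ * (1 + |s|) + 9 * K * τ * ‖w‖ ^ 2 * (3 * (1 + |s|)) := by
        gcongr
        · exact le_add_of_nonneg_right (abs_nonneg s)
        · linarith [abs_nonneg s]
    _ = _ := by ring

end Repulsive

namespace Repulsive

variable {n : ℕ}

/-! ### Energy cutoffs -/

open scoped FourierTransform SchwartzMap

theorem integrable_fourier_mul (f : 𝓢(ℝ, ℂ)) :
    Integrable fun ξ : ℝ => ‖(𝓕 f) ξ‖ * (1 + 2 * Real.pi * |ξ|) := by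
  have h1 := (𝓕 f).integrable.norm (μ := (volume : Measure ℝ))
  have h2 := (SchwartzMap.integrable_pow_mul (volume : Measure ℝ) (𝓕 f) 1).const_mul (2 * Real.pi)
  refine (h1.add h2).congr (ae_of_all _ fun ξ => ?_)
  simp only [Pi.add_apply, pow_one, Real.norm_eq_abs]
  ring

theorem propagator_functionOf_eq_integral_evol {W : Conf n → ℝ}
    (hH : IsSelfAdjoint (schrodingerOp W)) (f : 𝓢(ℝ, ℂ)) {φ : ℝ → ℂ} (hφ : Continuous φ) {B : ℝ}
    (hB : ∀ l, ‖φ l‖ ≤ B) (hf : ∀ l : ℝ, f l = ((l : ℂ) + Complex.I) ^ 2 * φ l) (t : ℝ)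
    (x : L2 n) :
    propagator (schrodingerOp W) t (functionOf (schrodingerOp W) φ x)
      = ∫ ξ : ℝ, (𝓕 f) ξ • evol W (t - 2 * Real.pi * ξ) x :=
  propagator_functionOf_eq_integral hH f hφ hB hf t x

/-- A bound that grows linearly in the time shift survives the superposition, because `f̂` is a
Schwartz function. -/
theorem norm_mulOp_propagator_functionOf_le {W : Conf n → ℝ} (hH : IsSelfAdjoint (schrodingerOp W))
    (f : 𝓢(ℝ, ℂ)) {φ : ℝ → ℂ} (hφ : Continuous φ) {B : ℝ} (hB : ∀ l, ‖φ l‖ ≤ B)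
    (hf : ∀ l : ℝ, f l = ((l : ℂ) + Complex.I) ^ 2 * φ l) {m : Conf n → ℝ} (hm : IsMultiplier m)
    {t M : ℝ} {x : L2 n} (hM : ∀ s, ‖mulOp m (evol W (t + s) x)‖ ≤ M * (1 + |s|)) :
    ‖mulOp m (propagator (schrodingerOp W) t (functionOf (schrodingerOp W) φ x))‖
      ≤ M * ∫ ξ : ℝ, ‖(𝓕 f) ξ‖ * (1 + 2 * Real.pi * |ξ|) := by
  rw [propagator_functionOf_eq_integral_evol hH f hφ hB hf]
  have hc : Continuous fun ξ : ℝ => (𝓕 f) ξ • evol W (t - 2 * Real.pi * ξ) x :=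
    (𝓕 f).continuous.smul ((continuous_evol hH x).comp (by fun_prop))
  have hi : Integrable fun ξ : ℝ => (𝓕 f) ξ • evol W (t - 2 * Real.pi * ξ) x := by
    refine Integrable.mono' ((𝓕 f).integrable.norm.mul_const ‖x‖) hc.aestronglyMeasurable
      (ae_of_all _ fun ξ => ?_)
    rw [norm_smul]
    exact mul_le_mul_of_nonneg_left (norm_evol_le hH _ _) (norm_nonneg _)
  have e := (mulCLM m hm).integral_comp_comm hi
  simp only [map_smul, mulCLM_apply] at e
  rw [← e, ← integral_const_mul]
  refine norm_integral_le_of_norm_le ((integrable_fourier_mul f).const_mul M)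
    (ae_of_all _ fun ξ => ?_)
  rw [norm_smul]
  have h1 := hM (-(2 * Real.pi * ξ))
  rw [← sub_eq_add_neg, abs_neg, abs_mul, abs_of_pos Real.two_pi_pos] at h1
  calc _ ≤ ‖(𝓕 f) ξ‖ * (M * (1 + 2 * Real.pi * |ξ|)) := by gcongr
    _ = _ := by ring

theorem exists_schwartz_eq_sq_mul {φ : ℝ → ℝ} (hφ : ContDiff ℝ ∞ φ) {R : ℝ}
    (hR : ∀ s, R ≤ |s| → φ s = 0) :
    ∃ f : 𝓢(ℝ, ℂ), ∀ l : ℝ, f l = ((l : ℂ) + Complex.I) ^ 2 * (φ l : ℂ) := by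
  have hs : HasCompactSupport fun l : ℝ => ((l : ℂ) + Complex.I) ^ 2 * (φ l : ℂ) := by
    refine HasCompactSupport.intro (isCompact_Icc (a := -R) (b := R)) fun l hl => ?_
    have : R ≤ |l| := by
      by_contra h
      exact hl (abs_le.1 (not_le.1 h).le)
    rw [hR l this]
    simp
  have hc : ContDiff ℝ ∞ fun l : ℝ => ((l : ℂ) + Complex.I) ^ 2 * (φ l : ℂ) :=
    ((Complex.ofRealCLM.contDiff.add contDiff_const).pow 2).mul (Complex.ofRealCLM.contDiff.comp hφ)
  exact ⟨hs.toSchwartzMap hc, fun l => rfl⟩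

/-! ### The weight `⟨x⟩^{-ρ}` and the potential -/

theorem jap_rpow (x : Conf n) (p : ℝ) : jap x ^ p = rad x ^ (p / 2) := by
  have e : jap x = rad x ^ (1 / 2 : ℝ) := Real.sqrt_eq_rpow _
  rw [e, ← Real.rpow_mul (rad_pos x).le]
  congr 1
  ring

theorem jap_rpow_neg (x : Conf n) (ρ : ℝ) : jap x ^ (-ρ) = (rad x ^ (ρ / 2))⁻¹ := by
  rw [jap_rpow, neg_div, Real.rpow_neg (rad_pos x).le]

theorem one_le_rad_rpow {ρ : ℝ} (hρ : 0 ≤ ρ) (x : Conf n) : 1 ≤ rad x ^ (ρ / 2) :=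
  Real.one_le_rpow (one_le_rad x) (by positivity)

theorem abs_jap_rpow_neg_le {ρ : ℝ} (hρ : 0 ≤ ρ) (x : Conf n) : |jap x ^ (-ρ)| ≤ 1 := by
  have h := one_le_rad_rpow hρ x
  rw [jap_rpow_neg, abs_of_nonneg (by positivity)]
  exact inv_le_one_of_one_le₀ h

theorem isMultiplier_jap {ρ : ℝ} (hρ : 0 ≤ ρ) : IsMultiplier fun x : Conf n => jap x ^ (-ρ) := by
  refine isMultiplier_of_continuous ?_ (abs_jap_rpow_neg_le hρ)
  simp only [jap_rpow]
  exact continuous_comp_rad (continuousOn_rpow_Ioi _)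

theorem norm_mulOp_jap_le {ρ : ℝ} (hρ : 0 ≤ ρ) (ψ : L2 n) :
    ‖mulOp (fun x => jap x ^ (-ρ)) ψ‖ ≤ ‖ψ‖ := by
  have := norm_mulOp_le (isMultiplier_jap (n := n) hρ).measurable (abs_jap_rpow_neg_le hρ) ψ
  rwa [one_mul] at this

/-- Where the step is nonzero, `⟨x⟩^ρ > c`, so the squared weight is at most `c⁻²`. -/
theorem weight_stepFun_mulOp_jap_le {g h h₁ h₂ : ℝ → ℝ} {B : ℝ} (S : SmoothStep g h h₁ h₂ B)
    {ρ c d : ℝ} (hρ : 0 ≤ ρ) (hc : 0 < c) (hd : 0 < d) (ψ : L2 n) :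
    weight (stepFun g ρ c d) (mulOp (fun x => jap x ^ (-ρ)) ψ) ≤ (c ^ 2)⁻¹ * ‖ψ‖ ^ 2 := by
  have mj := isMultiplier_jap (n := n) hρ
  have ms := isMultiplier_stepFun (n := n) S ρ c d
  have e : weight (stepFun g ρ c d) (mulOp (fun x => jap x ^ (-ρ)) ψ)
      = weight (fun x => stepFun g ρ c d x * (jap x ^ (-ρ)) ^ 2) ψ := by
    refine integral_congr_ae ?_
    filter_upwards [mj.coeFn_mulOp ψ] with x hx
    rw [hx, norm_mul, mul_pow, Complex.norm_real, Real.norm_eq_abs, sq_abs, mul_assoc]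
  have hle : ∀ x : Conf n, stepFun g ρ c d x * (jap x ^ (-ρ)) ^ 2 ≤ (c ^ 2)⁻¹ := fun x => by
    by_cases hs : stepArg ρ c d (rad x) ≤ 0
    · rw [stepFun, S.g_zero _ hs, zero_mul]
      positivity
    · have hr : c ≤ rad x ^ (ρ / 2) := by
        rw [stepArg, not_le, lt_div_iff₀ hd, zero_mul, sub_pos] at hs
        exact hs.le
      rw [jap_rpow_neg, inv_pow]
      calc _ ≤ 1 * ((rad x ^ (ρ / 2)) ^ 2)⁻¹ := by
            gcongr
            exact S.g_le_one _
        _ ≤ (c ^ 2)⁻¹ := by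
            rw [one_mul]
            gcongr
  have hm : IsMultiplier fun x : Conf n => stepFun g ρ c d x * (jap x ^ (-ρ)) ^ 2 := by
    refine ⟨ms.measurable.mul (mj.measurable.pow_const 2), (c ^ 2)⁻¹, fun x => ?_⟩
    have h0 : 0 ≤ stepFun g ρ c d x * (jap x ^ (-ρ)) ^ 2 := mul_nonneg (S.g_nonneg _) (sq_nonneg _)
    rw [abs_of_nonneg h0]
    exact hle x
  rw [e]
  exact weight_le_of_le hm hle ψ

theorem IsAdmissiblePotential.exists_abs_le {θ : ℝ} {CV : ℕ → ℝ} {V : Conf n → ℝ}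
    (hV : IsAdmissiblePotential θ CV V) (hθ : 0 ≤ θ) : ∃ B, ∀ x, |V x| ≤ B := by
  obtain ⟨r, hr⟩ := hV.decay 0
  obtain ⟨B, hB⟩ := (isCompact_closedBall (0 : Conf n) r).exists_bound_of_continuousOn
    hV.smooth.continuous.continuousOn
  refine ⟨max B (CV 0), fun x => ?_⟩
  rcases le_total ‖x‖ r with hx | hx
  · exact (hB x (by simpa using hx)).trans (le_max_left _ _)
  · refine le_trans ?_ (le_max_right _ _)
    have h1 := hr x hx
    rw [norm_iteratedFDeriv_zero, Real.norm_eq_abs, Nat.cast_zero, sub_zero] at h1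
    refine h1.trans (mul_le_of_le_one_right (hV.const_pos 0).le ?_)
    exact (le_abs_self _).trans (abs_jap_rpow_neg_le hθ x)

theorem IsAdmissiblePotential.isSelfAdjoint_hamiltonian {α σ θ : ℝ} {CV : ℕ → ℝ} {V : Conf n → ℝ}
    (hV : IsAdmissiblePotential θ CV V) (hα0 : 0 ≤ α) (hα2 : α ≤ 2) (hσ : 0 ≤ σ) (hθ : 0 ≤ θ) :
    IsSelfAdjoint (hamiltonian α σ V) := by
  obtain ⟨B, hB⟩ := hV.exists_abs_le hθ
  have hB0 : 0 ≤ B := (abs_nonneg _).trans (hB 0)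
  refine isSelfAdjoint_schrodingerOp (c := σ + B) ?_ (by positivity) fun x => ?_
  · exact (continuous_const.mul (continuous_norm.rpow_const fun _ => Or.inr hα0)).add
      hV.smooth.continuous
  · have h1 : ‖x‖ ^ α ≤ rad x := by
      have e : ‖x‖ ^ α = (‖x‖ ^ 2) ^ (α / 2) := by
        rw [← Real.rpow_natCast, ← Real.rpow_mul (norm_nonneg _)]
        congr 1
        push_cast
        ring
      rw [e]
      calc _ ≤ rad x ^ (α / 2) :=
            Real.rpow_le_rpow (sq_nonneg _) (le_add_of_nonneg_left zero_le_one) (by positivity)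
        _ ≤ rad x ^ (1 : ℝ) := Real.rpow_le_rpow_of_exponent_le (one_le_rad x) (by linarith)
        _ = rad x := Real.rpow_one _
    have h2 := (abs_le.1 (hB x)).1
    have h3 := one_le_rad x
    nlinarith

theorem sqrt_le_bigA0 {α σ CV0 R : ℝ} (hn : 1 ≤ n) (hα : 0 ≤ α) (hσ : 0 ≤ σ) (hCV : 0 ≤ CV0)
    (hR : 0 ≤ R) : √σ ≤ bigA0 n α σ CV0 R := by
  have hn' : (1 : ℝ) ≤ n := by exact_mod_cast hn
  have ha : σ ≤ smallA0 n α σ CV0 R := by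
    have h1 : σ ≤ n * (R + CV0 + σ) := by nlinarith
    have h2 : 0 ≤ (n : ℝ) * (n + 1) * (α ^ 2 + 3 * α) := by positivity
    rw [smallA0]
    linarith
  have h1 : 2 * √σ ≤ √(α ^ 2 * n * (2 * n + 1) ^ 2 + 4 * smallA0 n α σ CV0 R) := by
    refine Real.le_sqrt_of_sq_le ?_
    have h3 : 0 ≤ α ^ 2 * n * (2 * n + 1) ^ 2 := by positivity
    rw [mul_pow, Real.sq_sqrt hσ]
    linarith
  have h2 : 0 ≤ α * √n * (2 * n + 1) := by positivity
  rw [bigA0]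
  linarith

/-- The numerical fact behind the threshold: it is at least twice the limiting speed `2ρ√σ` of
`⟨x⟩^ρ`, which leaves room for the initial position and the width of the moving step. -/
theorem le_bigA1 {α σ CV0 R : ℝ} (hn : 1 ≤ n) (hα : 0 ≤ α) (hα2 : α ≤ 2) (hσ : 0 ≤ σ)
    (hCV : 0 ≤ CV0) (hR : 0 ≤ R) : 4 * (1 - α / 2) * √σ ≤ bigA1 n α σ CV0 R := by
  have hn' : (1 : ℝ) ≤ n := by exact_mod_cast hn
  have h1 := sqrt_le_bigA0 (R := 2 * R) hn hα hσ hCV (by positivity)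
  have h2 : 0 ≤ 1 - α / 2 := by linarith
  have h3 := Real.sqrt_nonneg σ
  rw [bigA1]
  calc 4 * (1 - α / 2) * √σ = 4 * 1 * (1 - α / 2) * √σ := by ring
    _ ≤ _ := by gcongr

/-! ### The propagation estimate -/

theorem exists_norm_mulOp_le_rpow {α σ ρ θ A R : ℝ} (hα0 : 0 < α) (hα2 : α < 2) (hσ : 0 < σ)
    (hρ : ρ = 1 - α / 2) (hθ0 : 0 ≤ θ) (hA : 4 * ρ * √σ ≤ A) {V : Conf n → ℝ} {CV : ℕ → ℝ}
    (hV : IsAdmissiblePotential θ CV V) (hH : IsSelfAdjoint (hamiltonian α σ V)) {φ : ℝ → ℝ}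
    (hφ : ContDiff ℝ ∞ φ) (hφ_range : ∀ s, 0 ≤ φ s ∧ φ s ≤ 1) (hφ_supp : ∀ s, R ≤ |s| → φ s = 0)
    {F : ℝ → ℝ} (hF : Continuous F) (hF_range : ∀ s, 0 ≤ F s ∧ F s ≤ 1)
    (hF_zero : ∀ s, s ≤ A → F s = 0) :
    ∃ ε K : ℝ, 0 < ε ∧ 0 ≤ K ∧ ∀ T, 1 ≤ T → ∀ ψ : L2 n,
      ‖mulOp (fun x => F (‖x‖ ^ ρ / T)) (propagator (hamiltonian α σ V) T
        (functionOf (hamiltonian α σ V) (fun l => (φ l : ℂ))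
          (mulOp (fun x => jap x ^ (-ρ)) ψ)))‖ ^ 2 ≤ K * T ^ (-ε) * ‖ψ‖ ^ 2 := by
  have hρ0 : 0 < ρ := by linarith
  have hs0 : 0 < √σ := Real.sqrt_pos.2 hσ
  have hA0 : 0 < A := lt_of_lt_of_le (by positivity) hA
  obtain ⟨g, h, h₁, h₂, B, S⟩ := exists_smoothStep
  obtain ⟨BV, hBV⟩ := hV.exists_abs_le hθ0
  have hB := S.B_nonneg
  -- The step starts at `aT`, travels by `bT ≤ 2aT` and has width `aT`, so at the end it equals `1`
  -- from `4aT = AT` on, which covers the support of `F(|x|^ρ/T)`.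
  set a := A / 4 with ha
  have ha0 : 0 < a := by positivity
  set b := 2 * ρ * √σ with hb
  have hb0 : 0 ≤ b := by positivity
  obtain ⟨C, hC0, hC'⟩ := exists_commutator_bound (n := n) S hα0 hα2 hσ hρ hV.smooth.continuous hBV
    ha0 ha0
  have hC : CommutatorBound (fun x : Conf n => -σ * ‖x‖ ^ α + V x) g h ρ a a b (α / ρ) C := hC'
  obtain ⟨f, hf⟩ := exists_schwartz_eq_sq_mul hφ hφ_supp
  set J := ∫ ξ : ℝ, ‖(𝓕 f) ξ‖ * (1 + 2 * Real.pi * |ξ|)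
  have hε0 : 0 < α / ρ := by positivity
  set K := (a ^ 2)⁻¹ + 27 * (b / a * B + C) with hK
  have hK0 : 0 ≤ K := by positivity
  refine ⟨min 1 (α / ρ), K * J ^ 2, lt_min one_pos hε0, by positivity, fun T hT ψ => ?_⟩
  have hT0 : 0 < T := zero_lt_one.trans_le hT
  set τ := T ^ (-min 1 (α / ρ))
  have hτ : 0 < τ := Real.rpow_pos_of_pos hT0 _
  set w := mulOp (fun x => jap x ^ (-ρ)) ψ with hw
  have hwn : ‖w‖ ≤ ‖ψ‖ := norm_mulOp_jap_le hρ0.le ψ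
  have hFm : IsMultiplier fun x : Conf n => F (‖x‖ ^ ρ / T) :=
    isMultiplier_of_continuous (hF.comp
      ((continuous_norm.rpow_const fun _ => Or.inr hρ0.le).div_const T)) (B := 1) fun x => by
      rw [abs_of_nonneg (hF_range _).1]
      exact (hF_range _).2
  have hFle : ∀ x : Conf n, F (‖x‖ ^ ρ / T) ^ 2 ≤ stepFun g ρ (a * T + b * T) (a * T) x :=
    fun x => by
    by_cases hx : ‖x‖ ^ ρ / T ≤ A
    · rw [hF_zero _ hx, zero_pow two_ne_zero]
      exact S.g_nonneg _
    · have h1 : A * T ≤ ‖x‖ ^ ρ := by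
        rw [not_le, lt_div_iff₀ hT0] at hx
        exact hx.le
      have h2 : ‖x‖ ^ ρ ≤ rad x ^ (ρ / 2) := by
        have : ‖x‖ ^ ρ = (‖x‖ ^ 2) ^ (ρ / 2) := by
          rw [← Real.rpow_natCast, ← Real.rpow_mul (norm_nonneg _)]
          congr 1
          push_cast
          ring
        rw [this]
        exact Real.rpow_le_rpow (sq_nonneg _) (le_add_of_nonneg_left zero_le_one) (by positivity)
      have h3 : 1 ≤ stepArg ρ (a * T + b * T) (a * T) (rad x) := by
        rw [stepArg, le_div_iff₀ (by positivity), one_mul]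
        have h4 : b ≤ 2 * a := by rw [hb, ha]; linarith
        have h5 : b * T ≤ 2 * a * T := mul_le_mul_of_nonneg_right h4 hT0.le
        have h6 : A * T = 4 * a * T := by rw [ha]; ring
        linarith
      rw [stepFun, S.g_one _ h3]
      exact pow_le_one₀ (hF_range _).1 (hF_range _).2
  have hFm2 : IsMultiplier fun x : Conf n => F (‖x‖ ^ ρ / T) ^ 2 := by
    refine ⟨hFm.measurable.pow_const 2, 1, fun x => ?_⟩
    rw [abs_of_nonneg (sq_nonneg _)]
    exact pow_le_one₀ (hF_range _).1 (hF_range _).2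
  have hinit : weight (stepFun g ρ (a * T) (a * T)) w ≤ ((a ^ 2)⁻¹ * ‖ψ‖ ^ 2) * T⁻¹ := by
    refine (weight_stepFun_mulOp_jap_le S hρ0.le (by positivity) (by positivity) ψ).trans ?_
    have : (T ^ 2)⁻¹ ≤ T⁻¹ := inv_anti₀ hT0 (le_self_pow₀ hT two_ne_zero)
    calc ((a * T) ^ 2)⁻¹ * ‖ψ‖ ^ 2 = (a ^ 2)⁻¹ * ‖ψ‖ ^ 2 * (T ^ 2)⁻¹ := by
          rw [mul_pow, mul_inv]
          ring
      _ ≤ _ := by gcongr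
  have hevol : ∀ s, ‖mulOp (fun x => F (‖x‖ ^ ρ / T))
      (evol (fun x : Conf n => -σ * ‖x‖ ^ α + V x) (T + s) w)‖
      ≤ √(K * τ) * ‖ψ‖ * (1 + |s|) := fun s => by
    have hs1 : 1 ≤ 1 + |s| := le_add_of_nonneg_right (abs_nonneg s)
    refine le_of_sq_le_sq ?_ (by positivity)
    rw [norm_mulOp_sq hFm, mul_pow, mul_pow, Real.sq_sqrt (by positivity)]
    calc _ ≤ weight (stepFun g ρ (a * T + b * T) (a * T))
          (evol (fun x : Conf n => -σ * ‖x‖ ^ α + V x) (T + s) w) :=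
          weight_mono hFm2 (isMultiplier_stepFun S _ _ _) hFle _
      _ ≤ ((a ^ 2)⁻¹ * ‖ψ‖ ^ 2 + 27 * (b / a * B + C) * ‖w‖ ^ 2) * (1 + |s|) * τ :=
          weight_evol_le hH S hC ha0 hb0 hε0.le hC0 hT s hinit
      _ ≤ ((a ^ 2)⁻¹ * ‖ψ‖ ^ 2 + 27 * (b / a * B + C) * ‖ψ‖ ^ 2) * (1 + |s|) ^ 2 * τ := by
          gcongr
          exact le_self_pow₀ hs1 two_ne_zero
      _ = K * τ * ‖ψ‖ ^ 2 * (1 + |s|) ^ 2 := by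
          rw [hK]
          ring
  have key := norm_mulOp_propagator_functionOf_le hH f
    (Complex.continuous_ofReal.comp hφ.continuous) (B := 1) (fun l => by
      rw [Function.comp_apply, Complex.norm_real, Real.norm_eq_abs, abs_of_nonneg (hφ_range l).1]
      exact (hφ_range l).2) hf hFm hevol
  calc _ ≤ (√(K * τ) * ‖ψ‖ * J) ^ 2 := by
        gcongr
        exact key
    _ = K * J ^ 2 * τ * ‖ψ‖ ^ 2 := by
        rw [mul_pow, mul_pow, Real.sq_sqrt (by positivity)]
        ring

end Repulsive

theorem proposition2 (n : ℕ) (hn : 1 ≤ n) (α σ ρ θ R : ℝ) (hα0 : 0 < α) (hα2 : α < 2)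
    (hσ : 0 < σ) (hρ : ρ = 1 - α / 2) (hθ0 : 0 < θ) (hθρ : θ ≤ ρ) (hR : 0 < R)
    (V : Conf n → ℝ) (CV : ℕ → ℝ) (hV : IsAdmissiblePotential θ CV V)
    (φ : ℝ → ℝ) (hφ_smooth : ContDiff ℝ ∞ φ) (hφ_range : ∀ s, 0 ≤ φ s ∧ φ s ≤ 1)
    (hφ_supp : ∀ s, R ≤ |s| → φ s = 0)
    (F : ℝ → ℝ) (hF_smooth : ContDiff ℝ ∞ F) (hF_range : ∀ s, 0 ≤ F s ∧ F s ≤ 1)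
    (hF_zero : ∀ s, s ≤ bigA1 n α σ (CV 0) R → F s = 0)
    (hF_one : ∀ s, 2 * bigA1 n α σ (CV 0) R ≤ s → F s = 1) :
    ∃ C : ℝ, 0 < C ∧ ∀ ψ : L2 n,
      ∫⁻ t in Set.Ioi (1 : ℝ), ENNReal.ofReal
          (‖mulOp (fun x => F (‖x‖ ^ ρ / t))
              (propagator (hamiltonian α σ V) t
                (functionOf (hamiltonian α σ V) (fun l => (φ l : ℂ))
                  (mulOp (fun x => jap x ^ (-ρ)) ψ)))‖ ^ 2 / t)
        ≤ ENNReal.ofReal (C * ‖ψ‖ ^ 2) := by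
  have hH := hV.isSelfAdjoint_hamiltonian hα0.le hα2.le hσ.le hθ0.le
  obtain ⟨ε, K, hε, hK, hbound⟩ := exists_norm_mulOp_le_rpow hα0 hα2 hσ hρ hθ0.le
    (hρ ▸ le_bigA1 hn hα0.le hα2.le hσ.le (hV.const_pos 0).le hR.le) hV hH hφ_smooth hφ_range
    hφ_supp hF_smooth.continuous hF_range hF_zero
  have hint : IntegrableOn (fun t : ℝ => t ^ (-ε - 1)) (Set.Ioi 1) :=
    integrableOn_Ioi_rpow_of_lt (by linarith) one_pos
  have hI0 : 0 ≤ ∫ t in Set.Ioi (1 : ℝ), t ^ (-ε - 1) :=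
    setIntegral_nonneg measurableSet_Ioi fun t ht =>
      Real.rpow_nonneg (zero_le_one.trans (le_of_lt ht)) _
  -- The added `1` makes the constant positive even when `K = 0`.
  refine ⟨K * (∫ t in Set.Ioi (1 : ℝ), t ^ (-ε - 1)) + 1, by positivity, fun ψ => ?_⟩
  calc _ ≤ ∫⁻ t in Set.Ioi (1 : ℝ), ENNReal.ofReal (K * ‖ψ‖ ^ 2 * t ^ (-ε - 1)) := by
        refine setLIntegral_mono' measurableSet_Ioi fun t ht => ENNReal.ofReal_le_ofReal ?_
        have ht1 : (1 : ℝ) < t := ht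
        have ht0 : 0 < t := one_pos.trans ht1
        rw [Real.rpow_sub_one ht0.ne', ← mul_div_assoc]
        gcongr
        refine (hbound t ht1.le ψ).trans_eq ?_
        ring
    _ = ENNReal.ofReal (∫ t in Set.Ioi (1 : ℝ), K * ‖ψ‖ ^ 2 * t ^ (-ε - 1)) := by
        refine (ofReal_integral_eq_lintegral_ofReal (hint.const_mul _) ?_).symm
        refine (ae_restrict_iff' measurableSet_Ioi).2 (ae_of_all _ fun t ht => ?_)
        have ht0 : (0 : ℝ) ≤ t := zero_le_one.trans (le_of_lt ht)
        exact mul_nonneg (by positivity) (Real.rpow_nonneg ht0 _)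
    _ ≤ _ := by
        refine ENNReal.ofReal_le_ofReal ?_
        rw [integral_const_mul]
        nlinarith [sq_nonneg ‖ψ‖]
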